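/- Let $M\ge 0$, let $\nu_1,\dots,\nu_M$ be fixed non-negative integers, put $\nu_0=0$, and let $x,y\in\mathbb R\setminus\{0\}$. For $n\ge 1$ let $K_{2n}=K_{2n}^{\mathrm{even}}+K_{2n}^{\mathrm{odd}}$ be the correlation kernel of the Hermitised product of a $2n\times 2n$ GUE matrix with $M$ complex Ginibre matrices, given by $$K_{2n}^{\mathrm{even}}(x,y)=\frac{1}{2(2\pi i)^2}\int_{c'-i\infty}^{c'+i\infty}\!dt\oint_{\Sigma_n}\!ds\,\frac{|x|^{s}|y|^{-t-1}}{s-t}\,\frac{\Gamma(-\frac s2)\Gamma(\frac{t+1}2)}{\Gamma(-\frac t2)\Gamma(\frac{s+1}2)}\,\frac{\Gamma(\frac{2n-t}2)}{\Gamma(\frac{2n-s}2)}\prod_{m=1}^M\frac{\Gamma(\nu_m+t+1)}{\Gamma(\nu_m+s+1)},$$ $$K_{2n}^{\mathrm{odd}}(x,y)=\frac{\operatorname{sgn}(xy)}{2(2\pi i)^2}\int_{c'-i\infty}^{c'+i\infty}\!dt\oint_{\Sigma_n}\!ds\,\frac{|x|^{s}|y|^{-t-1}}{s-t}\,\frac{\Gamma(\frac{1-s}2)\Gamma(\frac{t+2}2)}{\Gamma(\frac{1-t}2)\Gamma(\frac{s+2}2)}\,\frac{\Gamma(\frac{2n-t+1}2)}{\Gamma(\frac{2n-s+1}2)}\prod_{m=1}^M\frac{\Gamma(\nu_m+t+1)}{\Gamma(\nu_m+s+1)},$$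 where $-1<c'<0$ and $\Sigma_n$ is the boundary of a rectangle $[a',b']\times[-\eta',\eta']$ with $c'<a'<0$, $b'>2n-1$, $\eta'>0$, traversed in the negative direction (so it encircles $0,1,\dots,2n-1$ and $\operatorname{Re}s>c'$ on it); $c',a',b',\eta'$ may be chosen arbitrarily for each $n$. Let $-1<c<-\tfrac12$, $c<a<0$, $\eta>0$, and let $\Sigma$ be the boundary of the half-strip $\{\operatorname{Re}s>a,\ |\operatorname{Im}s|<\eta\}$, which starts and ends at $+\infty$ and encloses the non-negative half-line in the negative direction. Put $$K^{\mathrm{even}}(x,y)=\frac{1}{2(2\pi i)^2}\int_{c-i\infty}^{c+i\infty}\!dt\int_{\Sigma}\!ds\,\frac{|x|^{s}|y|^{-t-1}}{s-t}\,\frac{\Gamma(-\frac s2)\Gamma(\frac{t+1}2)}{\Gamma(-\frac t2)\Gamma(\frac{s+1}2)}\prod_{m=1}^M\frac{\Gamma(\nu_m+t+1)}{\Gamma(\nu_m+s+1)},$$ $$K^{\mathrm{odd}}(x,y)=\frac{\operatorname{sgn}(xy)}{2(2\pi i)^2}\int_{c-i\infty}^{c+i\infty}\!dt\int_{\Sigma}\!ds\,\frac{|x|^{s}|y|^{-t-1}}{s-t}\,\frac{\Gamma(\frac{1-s}2)\Gamma(\frac{t+2}2)}{\Gamma(\frac{1-t}2)\Gamma(\frac{s+2}2)}\prod_{m=1}^M\frac{\Gamma(\nu_m+t+1)}{\Gamma(\nu_m+s+1)}.$$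 Then all these double integrals converge absolutely, and $$\lim_{n\to\infty}\frac1{\sqrt n}\,K_{2n}\Big(\frac x{\sqrt n},\frac y{\sqrt n}\Big)=K^{\mathrm{even}}(x,y)+K^{\mathrm{odd}}(x,y).$$ Moreover, with the Meijer $G$-kernel with indices $\mu_0,\dots,\mu_q$, $$K^{q}_{\mathrm{Meijer}}[\mu_0,\dots,\mu_q](X,Y)=\int_0^1 G^{1,0}_{0,q+1}\big({-};-\mu_0,\dots,-\mu_q\,\big|\,Xu\big)\,G^{q,0}_{0,q+1}\big({-};\mu_q,\dots,\mu_0\,\big|\,Yu\big)\,du\qquad(X,Y>0),$$ where $$G^{m,0}_{0,q}({-};b_1,\dots,b_q\,|\,z)=\frac1{2\pi i}\int_L\frac{\prod_{j\le m}\Gamma(b_j-s)}{\prod_{j>m}\Gamma(1-b_j+s)}\,z^s\,ds$$ and $L$ is a half-strip loop from $+\infty$ to $+\infty$ that encircles all poles of $\Gamma(b_j-s)$, $j\le m$, in the negative direction, one has $$K^{\mathrm{even}}(x,y)=\frac{|y|}{2^{2M}}\,K^{2M+1}_{\mathrm{Meijer}}\Big[\tfrac{\nu_0}2,\tfrac{\nu_0-1}2,\dots,\tfrac{\nu_M}2,\tfrac{\nu_M-1}2\Big]\Big(\frac{x^2}{2^{2M}},\frac{y^2}{2^{2M}}\Big),$$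 $$K^{\mathrm{odd}}(x,y)=\operatorname{sgn}(xy)\,\frac{|x|}{2^{2M}}\,K^{2M+1}_{\mathrm{Meijer}}\Big[\tfrac{\nu_0}2,\tfrac{\nu_0+1}2,\dots,\tfrac{\nu_M}2,\tfrac{\nu_M+1}2\Big]\Big(\frac{x^2}{2^{2M}},\frac{y^2}{2^{2M}}\Big),$$ with absolutely convergent integrals over $u\in(0,1)$. -/

import Mathlib

open Filter Topology MeasureTheory Set

noncomputable section

/-! ### Contours -/

/-- `∫_{c - i∞}^{c + i∞} f(t) dt`, the upward integral along the line `Re t = c`. -/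
def verticalIntegral (c : ℝ) (f : ℂ → ℂ) : ℂ :=
  Complex.I * ∫ y : ℝ, f (c + y * Complex.I)

/-- `∮ f(s) ds` in the negative (clockwise) direction over the boundary of the rectangle
`[a, b] × [-η, η]`: left side upwards, top side to the right, right side downwards,
bottom side to the left. -/
def rectangleIntegral (a b η : ℝ) (f : ℂ → ℂ) : ℂ :=
  Complex.I * (∫ y in (-η)..η, f (a + y * Complex.I))
    + (∫ v in a..b, f (v + η * Complex.I))
    - Complex.I * (∫ y in (-η)..η, f (b + y * Complex.I))
    - ∫ v in a..b, f (v - η * Complex.I)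

/-- `∫ f(s) ds` over the boundary of the half-strip `{Re s > a, |Im s| < η}` in the negative
direction: from `+∞ - iη` to the left to `a - iη`, up to `a + iη`, to the right to `+∞ + iη`.
For `a < 0 < η` this loop starts and ends at `+∞` and encloses the non-negative half-line. -/
def hairpinIntegral (a η : ℝ) (f : ℂ → ℂ) : ℂ :=
  Complex.I * (∫ y in (-η)..η, f (a + y * Complex.I))
    + (∫ v in Ioi a, f (v + η * Complex.I))
    - ∫ v in Ioi a, f (v - η * Complex.I)

/-- Absolute convergence of `∫_{c - i∞}^{c + i∞} dt ∮ ds F(t, s)`, with `s` on the rectangle. -/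
def RectangleAbsConv (c a b η : ℝ) (F : ℂ → ℂ → ℂ) : Prop :=
  Integrable (fun p : ℝ × ℝ => F (c + p.1 * Complex.I) (a + p.2 * Complex.I))
      (volume.prod (volume.restrict (Icc (-η) η))) ∧
  Integrable (fun p : ℝ × ℝ => F (c + p.1 * Complex.I) (p.2 + η * Complex.I))
      (volume.prod (volume.restrict (Icc a b))) ∧
  Integrable (fun p : ℝ × ℝ => F (c + p.1 * Complex.I) (b + p.2 * Complex.I))
      (volume.prod (volume.restrict (Icc (-η) η))) ∧
  Integrable (fun p : ℝ × ℝ => F (c + p.1 * Complex.I) (p.2 - η * Complex.I))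
      (volume.prod (volume.restrict (Icc a b)))

/-- Absolute convergence of `∫_{c - i∞}^{c + i∞} dt ∫ ds F(t, s)`, with `s` on the boundary of
the half-strip. -/
def HairpinAbsConv (c a η : ℝ) (F : ℂ → ℂ → ℂ) : Prop :=
  Integrable (fun p : ℝ × ℝ => F (c + p.1 * Complex.I) (a + p.2 * Complex.I))
      (volume.prod (volume.restrict (Icc (-η) η))) ∧
  Integrable (fun p : ℝ × ℝ => F (c + p.1 * Complex.I) (p.2 + η * Complex.I))
      (volume.prod (volume.restrict (Ioi a))) ∧
  Integrable (fun p : ℝ × ℝ => F (c + p.1 * Complex.I) (p.2 - η * Complex.I))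
      (volume.prod (volume.restrict (Ioi a)))

/-! ### Kernels of the product ensemble and their limits -/

/-- The integrand of the limiting even kernel. -/
def evenIntegrand {M : ℕ} (ν : Fin M → ℕ) (x y : ℝ) (t s : ℂ) : ℂ :=
  ((|x| : ℝ) : ℂ) ^ s * ((|y| : ℝ) : ℂ) ^ (-t - 1) / (s - t)
    * (Complex.Gamma (-s / 2) * Complex.Gamma ((t + 1) / 2)
        / (Complex.Gamma (-t / 2) * Complex.Gamma ((s + 1) / 2)))
    * ∏ m, Complex.Gamma (ν m + t + 1) / Complex.Gamma (ν m + s + 1)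

/-- The integrand of the limiting odd kernel. -/
def oddIntegrand {M : ℕ} (ν : Fin M → ℕ) (x y : ℝ) (t s : ℂ) : ℂ :=
  ((|x| : ℝ) : ℂ) ^ s * ((|y| : ℝ) : ℂ) ^ (-t - 1) / (s - t)
    * (Complex.Gamma ((1 - s) / 2) * Complex.Gamma ((t + 2) / 2)
        / (Complex.Gamma ((1 - t) / 2) * Complex.Gamma ((s + 2) / 2)))
    * ∏ m, Complex.Gamma (ν m + t + 1) / Complex.Gamma (ν m + s + 1)

/-- The integrand of the even kernel of index `2n`. -/
def finiteEvenIntegrand {M : ℕ} (ν : Fin M → ℕ) (n : ℕ) (x y : ℝ) (t s : ℂ) : ℂ :=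
  evenIntegrand ν x y t s
    * (Complex.Gamma ((2 * n - t) / 2) / Complex.Gamma ((2 * n - s) / 2))

/-- The integrand of the odd kernel of index `2n`. -/
def finiteOddIntegrand {M : ℕ} (ν : Fin M → ℕ) (n : ℕ) (x y : ℝ) (t s : ℂ) : ℂ :=
  oddIntegrand ν x y t s
    * (Complex.Gamma ((2 * n - t + 1) / 2) / Complex.Gamma ((2 * n - s + 1) / 2))

/-- `K_{2n}^even(x, y)`, with `t` on `Re t = c` and `s` on the rectangle `[a, b] × [-η, η]`. -/
def finiteEvenKernel {M : ℕ} (ν : Fin M → ℕ) (n : ℕ) (c a b η x y : ℝ) : ℂ :=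
  1 / (2 * (2 * Real.pi * Complex.I) ^ 2)
    * verticalIntegral c fun t => rectangleIntegral a b η fun s =>
        finiteEvenIntegrand ν n x y t s

/-- `K_{2n}^odd(x, y)`, with `t` on `Re t = c` and `s` on the rectangle `[a, b] × [-η, η]`. -/
def finiteOddKernel {M : ℕ} (ν : Fin M → ℕ) (n : ℕ) (c a b η x y : ℝ) : ℂ :=
  (Real.sign (x * y) : ℂ) / (2 * (2 * Real.pi * Complex.I) ^ 2)
    * verticalIntegral c fun t => rectangleIntegral a b η fun s =>
        finiteOddIntegrand ν n x y t s

/-- `K_{2n} = K_{2n}^even + K_{2n}^odd`. -/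
def finiteKernel {M : ℕ} (ν : Fin M → ℕ) (n : ℕ) (c a b η x y : ℝ) : ℂ :=
  finiteEvenKernel ν n c a b η x y + finiteOddKernel ν n c a b η x y

/-- The limiting kernel `K^even(x, y)`. -/
def evenKernel {M : ℕ} (ν : Fin M → ℕ) (c a η x y : ℝ) : ℂ :=
  1 / (2 * (2 * Real.pi * Complex.I) ^ 2)
    * verticalIntegral c fun t => hairpinIntegral a η fun s => evenIntegrand ν x y t s

/-- The limiting kernel `K^odd(x, y)`. -/
def oddKernel {M : ℕ} (ν : Fin M → ℕ) (c a η x y : ℝ) : ℂ :=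
  (Real.sign (x * y) : ℂ) / (2 * (2 * Real.pi * Complex.I) ^ 2)
    * verticalIntegral c fun t => hairpinIntegral a η fun s => oddIntegrand ν x y t s

/-! ### The Meijer G-kernel -/

/-- The Meijer G-function `G^{m,0}_{0,q}(- ; b_1, …, b_q | z)` for `z > 0`,
`(2πi)⁻¹ ∫_L ∏_{j ≤ m} Γ(b_j - s) / ∏_{j > m} Γ(1 - b_j + s) z^s ds`, where the loop `L` starts
and ends at `+∞` and encircles all poles of the `Γ(b_j - s)`, `j ≤ m`, in the negative direction
(here `L` is the boundary of a half-strip to the left of all the `b_j`). -/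
def meijerG {q : ℕ} (m : ℕ) (b : Fin q → ℝ) (z : ℝ) : ℂ :=
  1 / (2 * Real.pi * Complex.I)
    * hairpinIntegral (-1 - ∑ j, |b j|) 1 fun s =>
        (∏ j : Fin q, if (j : ℕ) < m then Complex.Gamma (b j - s)
          else (Complex.Gamma (1 - b j + s))⁻¹) * (z : ℂ) ^ s

/-- The integrand of the Meijer G-kernel. -/
def meijerKernelIntegrand {q : ℕ} (μ : Fin (q + 1) → ℝ) (x y u : ℝ) : ℂ :=
  meijerG 1 (fun j => -μ j) (x * u) * meijerG q (fun j => μ j.rev) (y * u)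

/-- The Meijer G-kernel with indices `μ_0, …, μ_q`:
`∫_0^1 G^{1,0}_{0,q+1}(- ; -μ_0, …, -μ_q | xu) G^{q,0}_{0,q+1}(- ; μ_q, …, μ_0 | yu) du`. -/
def meijerKernel {q : ℕ} (μ : Fin (q + 1) → ℝ) (x y : ℝ) : ℂ :=
  ∫ u in (0 : ℝ)..1, meijerKernelIntegrand μ x y u

/-- `ν_0, ν_1, …, ν_M` with `ν_0 = 0`. -/
def extendedIndex {M : ℕ} (ν : Fin M → ℕ) : Fin (M + 1) → ℝ :=
  Fin.cons 0 fun m => (ν m : ℝ)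

/-- The `2M + 2` indices `ν_0/2, (ν_0 + ε)/2, ν_1/2, (ν_1 + ε)/2, …, ν_M/2, (ν_M + ε)/2`. -/
def splitIndex {M : ℕ} (ν : Fin M → ℕ) (ε : ℝ) : Fin (2 * M + 1 + 1) → ℝ := fun j =>
  (extendedIndex ν ⟨(j : ℕ) / 2, by omega⟩ + if (j : ℕ) % 2 = 0 then 0 else ε) / 2

end

/-!
Put `e = 0` for the even and `e = 1` for the odd kernel, and substitute `s = e + 2σ`,
`t = e - 2 - 2w`. The duplication formula turns each `Γ(ν_m + z + 1)` into two Gamma functions of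
half the argument, and the limiting integrand becomes, up to a constant,
`Γ(-σ) · regFactor γ X σ · gammaFactor γ Y w / (σ + 1 + w)` with `X = x² / 2^(2M)` and
`Y = y² / 2^(2M)`, where `γ` lists the indices of the Meijer G-kernel after the leading `0`. Here
`Γ(-σ) · regFactor γ X σ` is the integrand of `G^{1,0}` at `X`, and `gammaFactor γ Y w` that of
`G^{q,0}` at `Y`. The kernel of index `2n` has the additional factor `Γ(n + 1 + w) / Γ(n - σ)`.
This is the content of `evenIntegrand_eq_productIntegrand` and its three companions.

All integrals over `σ` are sums of residues at `σ = k`: for a hairpin an infinite, rapidly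
converging sum (`hasSum_hairpinIntegral_div`), for the rectangle, by partial fractions, one over
`k < n` (`rectangleIntegral_Gamma_div`). So every kernel is a series in `k` whose terms contain the
vertical integral of `gammaFactor γ Y w / (k + 1 + w)`, for finite `n` with the weight
`Γ(n + 1 + w) / (Γ(n) n^(1 + w))` and with `(n - 1)⋯(n - k) / n^k` as a coefficient.

These weights and coefficients are bounded by `1` and tend to `1`, so that dominated convergence,
for the sum and for the integral, gives the scaling limit
(`tendsto_verticalIntegral_rectangleIntegral`). The majorant is the limiting integrand, which is
integrable since `|gammaFactor γ Y w|` is at most of order `|Im w|^(γ_0 - 2 Re w - 1)`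
(`exists_norm_gammaFactor_le`). This is where `c < -1/2` enters; for finite `n` the line of
integration may first be moved into the region of convergence. The estimate rests on an upper bound
of Stirling type for `Γ`, which comes from the reflection formula on `Re z = 1/2`, the functional
equation and the Phragmén–Lindelöf principle (`norm_Gamma_mul_cpow_le`).

In the Meijer G-kernel, `G^{1,0}(Xu)` is the power series in `u` with the same residues as
coefficients, and integrating `u^(k + w)` over `(0, 1)` produces the factor `1 / (k + 1 + w)`. The
remaining hairpin in `w` is unfolded to a vertical line by Cauchy's theorem
(`verticalIntegral_gammaFactor_eq_hairpinIntegral`), and the resulting series is the one of the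
limiting kernel (`hasSum_meijerKernel`).
-/

/-! ### Cauchy's theorem and residues for rectangles -/

/-- Cauchy's theorem for `rectangleIntegral`; a countable set of points where only continuity
is known is allowed. -/
theorem rectangleIntegral_eq_zero_off_countable {f : ℂ → ℂ} {a b η : ℝ} (hab : a ≤ b)
    (hη : 0 ≤ η) {S : Set ℂ} (hS : S.Countable)
    (hc : ∀ s : ℂ, a ≤ s.re → s.re ≤ b → |s.im| ≤ η → ContinuousAt f s)
    (hd : ∀ s : ℂ, a ≤ s.re → s.re ≤ b → |s.im| ≤ η → s ∉ S → DifferentiableAt ℂ f s) :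
    rectangleIntegral a b η f = 0 := by
  have h := Complex.integral_boundary_rect_eq_zero_of_differentiable_on_off_countable f
    (⟨a, -η⟩ : ℂ) (⟨b, η⟩ : ℂ) S hS ?_ ?_
  · simp only [smul_eq_mul, Complex.ofReal_neg, neg_mul, ← sub_eq_add_neg] at h
    rw [rectangleIntegral]
    linear_combination -h
  · intro s hs
    have h1 := hs.1
    have h2 := hs.2
    simp only [mem_preimage, uIcc_of_le hab, uIcc_of_le (neg_le_self hη)] at h1 h2
    exact (hc s h1.1 h1.2 (abs_le.2 h2)).continuousWithinAt
  · intro s hs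
    have h1 := hs.1.1
    have h2 := hs.1.2
    simp only [mem_preimage, min_eq_left hab, max_eq_right hab, min_eq_left (neg_le_self hη),
      max_eq_right (neg_le_self hη)] at h1 h2
    exact hd s h1.1.le h1.2.le (abs_le.2 ⟨h2.1.le, h2.2.le⟩) hs.2

/-- Cauchy's theorem for the rectangle `[a, b] × [T₁, T₂]`. -/
theorem integral_boundary_eq_zero {f : ℂ → ℂ} {a b T₁ T₂ : ℝ} (hab : a ≤ b) (hT : T₁ ≤ T₂)
    (hd : ∀ s : ℂ, a ≤ s.re → s.re ≤ b → T₁ ≤ s.im → s.im ≤ T₂ → DifferentiableAt ℂ f s) :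
    (∫ v in a..b, f (v + T₁ * Complex.I)) - (∫ v in a..b, f (v + T₂ * Complex.I))
      + Complex.I * (∫ y in T₁..T₂, f (b + y * Complex.I))
      - Complex.I * (∫ y in T₁..T₂, f (a + y * Complex.I)) = 0 := by
  have h := Complex.integral_boundary_rect_eq_zero_of_differentiableOn f
    (⟨a, T₁⟩ : ℂ) (⟨b, T₂⟩ : ℂ) ?_
  · simpa only [smul_eq_mul] using h
  · intro s hs
    have h1 := hs.1
    have h2 := hs.2
    simp only [mem_preimage, uIcc_of_le hab, uIcc_of_le hT] at h1 h2
    exact (hd s h1.1 h1.2 h2.1 h2.2).differentiableWithinAt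

theorem intervalIntegrable_vertical {f : ℂ → ℂ} {a T₁ T₂ : ℝ}
    (hf : ∀ y ∈ uIcc T₁ T₂, ContinuousAt f (a + y * Complex.I)) :
    IntervalIntegrable (fun y : ℝ => f (a + y * Complex.I)) volume T₁ T₂ := by
  refine ContinuousOn.intervalIntegrable fun y hy => ?_
  have : ContinuousAt (fun y : ℝ => (a + y * Complex.I : ℂ)) y := by fun_prop
  exact (ContinuousAt.comp (f := fun y : ℝ => (a + y * Complex.I : ℂ)) (hf y hy)
    this).continuousWithinAt

theorem intervalIntegrable_horizontal {f : ℂ → ℂ} {T a b : ℝ}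
    (hf : ∀ v ∈ uIcc a b, ContinuousAt f (v + T * Complex.I)) :
    IntervalIntegrable (fun v : ℝ => f (v + T * Complex.I)) volume a b := by
  refine ContinuousOn.intervalIntegrable fun y hy => ?_
  have : ContinuousAt (fun y : ℝ => (y + T * Complex.I : ℂ)) y := by fun_prop
  exact (ContinuousAt.comp (f := fun y : ℝ => (y + T * Complex.I : ℂ)) (hf y hy)
    this).continuousWithinAt

/-- The four sides of the rectangle `[a, b] × [-η, η]`. -/
def OnRectangle (a b η : ℝ) (s : ℂ) : Prop :=
  a ≤ s.re ∧ s.re ≤ b ∧ |s.im| ≤ η ∧ (s.re = a ∨ s.re = b ∨ |s.im| = η)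

theorem onRectangle_left {a b η : ℝ} (hab : a ≤ b) (hη : 0 ≤ η) {y : ℝ}
    (hy : y ∈ uIcc (-η) η) : OnRectangle a b η (a + y * Complex.I) := by
  rw [uIcc_of_le (neg_le_self hη)] at hy
  simp [OnRectangle, hab, abs_le, hy.1, hy.2]

theorem onRectangle_right {a b η : ℝ} (hab : a ≤ b) (hη : 0 ≤ η) {y : ℝ}
    (hy : y ∈ uIcc (-η) η) : OnRectangle a b η (b + y * Complex.I) := by
  rw [uIcc_of_le (neg_le_self hη)] at hy
  simp [OnRectangle, hab, abs_le, hy.1, hy.2]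

theorem onRectangle_top {a b η : ℝ} (hab : a ≤ b) (hη : 0 ≤ η) {v : ℝ}
    (hv : v ∈ uIcc a b) : OnRectangle a b η (v + η * Complex.I) := by
  rw [uIcc_of_le hab] at hv
  simp [OnRectangle, hv.1, hv.2, abs_of_nonneg hη]

theorem onRectangle_bottom {a b η : ℝ} (hab : a ≤ b) (hη : 0 ≤ η) {v : ℝ}
    (hv : v ∈ uIcc a b) : OnRectangle a b η (v - η * Complex.I) := by
  rw [uIcc_of_le hab] at hv
  simp [OnRectangle, hv.1, hv.2, abs_of_nonneg hη]

theorem rectangleIntegral_sum {a b η : ℝ} (hab : a ≤ b) (hη : 0 ≤ η) {ι : Type*} (S : Finset ι)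
    {f : ι → ℂ → ℂ}
    (hf : ∀ i ∈ S, ∀ s, OnRectangle a b η s → ContinuousAt (f i) s) :
    rectangleIntegral a b η (fun s => ∑ i ∈ S, f i s) =
      ∑ i ∈ S, rectangleIntegral a b η (f i) := by
  unfold rectangleIntegral
  rw [intervalIntegral.integral_finsetSum fun i hi => intervalIntegrable_vertical fun y hy =>
      hf i hi _ (onRectangle_left hab hη hy),
    intervalIntegral.integral_finsetSum fun i hi => intervalIntegrable_vertical fun y hy =>
      hf i hi _ (onRectangle_right hab hη hy),
    intervalIntegral.integral_finsetSum fun i hi => intervalIntegrable_horizontal fun y hy =>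
      hf i hi _ (onRectangle_top hab hη hy),
    intervalIntegral.integral_finsetSum fun i hi => by
      simpa [sub_eq_add_neg] using intervalIntegrable_horizontal (f := f i) (T := -η)
        (a := a) (b := b) fun y hy => by
          simpa [sub_eq_add_neg] using hf i hi _ (onRectangle_bottom hab hη hy)]
  simp only [Finset.sum_sub_distrib, Finset.sum_add_distrib, Finset.mul_sum]

/-- The integrands need not agree at the two points where the contour meets the real axis. -/
theorem rectangleIntegral_congr {f g : ℂ → ℂ} {a b η : ℝ} (hab : a ≤ b) (hη : 0 < η)
    (h : ∀ s, OnRectangle a b η s → s.im ≠ 0 → f s = g s) :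
    rectangleIntegral a b η f = rectangleIntegral a b η g := by
  have h0 : ∀ᵐ y : ℝ, y ≠ 0 := Measure.ae_ne volume 0
  unfold rectangleIntegral
  congr 1
  · congr 1
    · congr 1
      · congr 1
        refine intervalIntegral.integral_congr_ae (h0.mono fun y hy hy' => ?_)
        exact h _ (onRectangle_left hab hη.le (uIoc_subset_uIcc hy')) (by simpa)
      · exact intervalIntegral.integral_congr fun v hv =>
          h _ (onRectangle_top hab hη.le hv) (by simpa using hη.ne')
    · congr 1
      refine intervalIntegral.integral_congr_ae (h0.mono fun y hy hy' => ?_)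
      exact h _ (onRectangle_right hab hη.le (uIoc_subset_uIcc hy')) (by simpa)
  · exact intervalIntegral.integral_congr fun v hv =>
      h _ (onRectangle_bottom hab hη.le hv) (by simpa using hη.ne')

theorem rectangleIntegral_const_mul (a b η : ℝ) (C : ℂ) (f : ℂ → ℂ) :
    rectangleIntegral a b η (fun s => C * f s) = C * rectangleIntegral a b η f := by
  simp only [rectangleIntegral, intervalIntegral.integral_const_mul]
  ring

theorem hairpinIntegral_const_mul (a η : ℝ) (C : ℂ) (f : ℂ → ℂ) :
    hairpinIntegral a η (fun s => C * f s) = C * hairpinIntegral a η f := by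
  simp only [hairpinIntegral, intervalIntegral.integral_const_mul, integral_const_mul]
  ring

theorem verticalIntegral_const_mul (c : ℝ) (C : ℂ) (f : ℂ → ℂ) :
    verticalIntegral c (fun s => C * f s) = C * verticalIntegral c f := by
  simp only [verticalIntegral, integral_const_mul]
  ring

/-- The integral of `1 / (p - s)` over a negatively oriented rectangle around `p` is `2πi`. -/
theorem rectangleIntegral_inv {a b η p : ℝ} (ha : a < p) (hb : p < b) (hη : 0 < η) :
    rectangleIntegral a b η (fun s => (p - s)⁻¹) = 2 * Real.pi * Complex.I := by
  have key : ∀ (u u' : ℂ) (sg : ℂ) (x₁ x₂ : ℝ),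
      (∀ x ∈ uIcc x₁ x₂, sg * (u + x * u' - p) ∈ Complex.slitPlane) →
      u' * (∫ x in x₁..x₂, ((p : ℂ) - (u + x * u'))⁻¹)
        = -(Complex.log (sg * (u + x₂ * u' - p)) -
          Complex.log (sg * (u + x₁ * u' - p))) := by
    intro u u' sg x₁ x₂ h
    rw [← intervalIntegral.integral_const_mul]
    have hd : ∀ x ∈ uIcc x₁ x₂, HasDerivAt (fun x : ℝ => -Complex.log (sg * (u + x * u' - p)))
        (u' * ((p : ℂ) - (u + x * u'))⁻¹) x := by
      intro x hx
      have h0 : HasDerivAt (fun x : ℝ => sg * (u + x * u' - p)) (sg * u') x := by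
        have := ((((hasDerivAt_id x).ofReal_comp).mul_const u').const_add u).sub_const (p : ℂ)
        simpa using this.const_mul sg
      have h1 := (h0.clog_real (h x hx)).neg
      have hne := Complex.slitPlane_ne_zero (h x hx)
      have h2 : sg ≠ 0 := left_ne_zero_of_mul hne
      have h3 : (u + x * u' - p : ℂ) ≠ 0 := right_ne_zero_of_mul hne
      rw [mul_div_mul_left _ _ h2] at h1
      rw [← neg_sub, inv_neg, mul_neg, ← div_eq_mul_inv]
      exact h1
    rw [intervalIntegral.integral_eq_sub_of_hasDerivAt hd]
    · ring
    · refine ContinuousOn.intervalIntegrable fun x hx => ?_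
      refine (ContinuousAt.continuousWithinAt ?_)
      refine ContinuousAt.mul continuousAt_const (ContinuousAt.inv₀ (by fun_prop) ?_)
      have hne := Complex.slitPlane_ne_zero (h x hx)
      rw [← neg_sub]; exact neg_ne_zero.2 (right_ne_zero_of_mul hne)
  -- `-log (s - p)` is a primitive on three of the sides; on the left side, which meets the branch
  -- cut, `-log (p - s)` is one
  have hL := key a Complex.I (-1) (-η) η (by
    intro x hx; left; simp; linarith)
  have hR := key b Complex.I 1 (-η) η (by
    intro x hx; left; simp; linarith)
  have hT := key (η * Complex.I) 1 1 a b (by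
    intro x hx; right; simp; linarith)
  have hB := key (-(η * Complex.I)) 1 1 a b (by
    intro x hx; right; simp; linarith)
  simp only [mul_one, one_mul] at hL hR hT hB
  have e1 : ∀ x : ℝ, (η * Complex.I + x : ℂ) = x + η * Complex.I := fun x => by ring
  have e2 : ∀ x : ℝ, (-(η * Complex.I) + x : ℂ) = x - η * Complex.I := fun x => by ring
  simp only [e1, e2, Complex.ofReal_neg, neg_mul, one_mul, ← sub_eq_add_neg] at hL hR hT hB
  rw [rectangleIntegral, hL, hR, hT, hB]
  have l1 : Complex.log (-(a + η * Complex.I - p)) =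
      Complex.log (a + η * Complex.I - p) - Real.pi * Complex.I := by
    rw [Complex.log, Complex.log, norm_neg,
      Complex.arg_neg_eq_arg_sub_pi_of_im_pos (by simpa using hη)]
    push_cast; ring
  have l2 : Complex.log (-(a - η * Complex.I - p)) =
      Complex.log (a - η * Complex.I - p) + Real.pi * Complex.I := by
    rw [Complex.log, Complex.log, norm_neg,
      Complex.arg_neg_eq_arg_add_pi_of_im_neg (by simpa using hη)]
    push_cast; ring
  rw [l1, l2]
  ring

/-- Cauchy's integral formula for a negatively oriented rectangle. -/
theorem rectangleIntegral_div {h : ℂ → ℂ} {a b η p : ℝ} (ha : a < p) (hb : p < b) (hη : 0 < η)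
    (hd : ∀ s : ℂ, a ≤ s.re → s.re ≤ b → |s.im| ≤ η → DifferentiableAt ℂ h s) :
    rectangleIntegral a b η (fun s => h s * (p - s)⁻¹) = 2 * Real.pi * Complex.I * h p := by
  have hab : a ≤ b := (ha.trans hb).le
  have hne : ∀ s, OnRectangle a b η s → (p - s : ℂ) ≠ 0 := by
    rintro s ⟨-, -, -, h1⟩ h0
    have : s = p := (sub_eq_zero.1 h0).symm
    subst this
    simp only [Complex.ofReal_re, Complex.ofReal_im, abs_zero] at h1
    rcases h1 with h1 | h1 | h1 <;> linarith
  have h0 : rectangleIntegral a b η (dslope h p) = 0 := by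
    refine rectangleIntegral_eq_zero_off_countable hab hη.le (countable_singleton (p : ℂ)) ?_ ?_
    · intro s h1 h2 h3
      by_cases hs : s = p
      · subst hs; exact continuousAt_dslope_same.2 (hd _ h1 h2 h3)
      · exact (continuousAt_dslope_of_ne hs).2 (hd _ h1 h2 h3).continuousAt
    · intro s h1 h2 h3 hs
      exact (differentiableAt_dslope_of_ne hs).2 (hd _ h1 h2 h3)
  have h1 : rectangleIntegral a b η (fun s => h s * (p - s)⁻¹)
      = rectangleIntegral a b η
        (fun s => ∑ i : Fin 2, (![fun s : ℂ => h p * (p - s)⁻¹,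
          fun s : ℂ => -1 * dslope h p s] : Fin 2 → ℂ → ℂ) i s) := by
    refine rectangleIntegral_congr hab hη fun s hs _ => ?_
    have h2 := hne s hs
    have h3 : s ≠ p := fun e => h2 (by rw [e, sub_self])
    have h4 : (s - p : ℂ) ≠ 0 := sub_ne_zero.2 h3
    simp only [Fin.sum_univ_two, Matrix.cons_val_zero, Matrix.cons_val_one,
      dslope_of_ne _ h3, slope_def_field]
    rw [show (p - s : ℂ) = -(s - p) by ring]
    field_simp
    ring
  rw [h1, rectangleIntegral_sum hab hη.le]
  · simp only [Fin.sum_univ_two, Matrix.cons_val_zero, Matrix.cons_val_one,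
      rectangleIntegral_const_mul, h0, rectangleIntegral_inv ha hb hη]
    ring
  · intro i _ s hs
    fin_cases i
    · exact ContinuousAt.mul continuousAt_const (ContinuousAt.inv₀ (by fun_prop) (hne s hs))
    · refine ContinuousAt.mul continuousAt_const ?_
      have h3 : s ≠ p := fun e => hne s hs (by rw [e, sub_self])
      exact (continuousAt_dslope_of_ne h3).2 (hd _ hs.1 hs.2.1 hs.2.2.1).continuousAt

/-- Partial fractions for `1 / ∏ (k - s)`. -/
theorem prod_inv_natCast_sub (N : ℕ) {s : ℂ} (hs : ∀ k < N + 1, (k - s : ℂ) ≠ 0) :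
    (∏ k ∈ Finset.range (N + 1), (k - s : ℂ))⁻¹ = ∑ k ∈ Finset.range (N + 1),
      (-1) ^ k / (k.factorial * (N - k).factorial : ℂ) * (k - s)⁻¹ := by
  induction N with
  | zero => simp
  | succ N ih =>
    rw [Finset.prod_range_succ, mul_inv, ih fun k hk => hs k (by omega)]
    have hsum : ∑ k ∈ Finset.range (N + 1),
        (-1 : ℂ) ^ k / (k.factorial * (N + 1 - k).factorial : ℂ)
          = -((-1) ^ (N + 1) / (N + 1).factorial) := by
      have h1 := Int.alternating_sum_range_choose_of_ne (Nat.succ_ne_zero N)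
      have h2 : ∑ k ∈ Finset.range (N + 2),
          (-1 : ℂ) ^ k / (k.factorial * (N + 1 - k).factorial : ℂ) = 0 := by
        have h3 : ∑ k ∈ Finset.range (N + 2), (-1 : ℂ) ^ k * ((N + 1).choose k : ℂ) = 0 := by
          exact_mod_cast h1
        have h4 : ((N + 1).factorial : ℂ) ≠ 0 := by exact_mod_cast Nat.factorial_ne_zero _
        rw [← mul_right_inj' h4, mul_zero, ← h3, Finset.mul_sum]
        refine Finset.sum_congr rfl fun k hk => ?_
        rw [Nat.cast_choose ℂ (show k ≤ N + 1 by have := Finset.mem_range.1 hk; omega)]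
        ring
      rw [Finset.sum_range_succ] at h2
      simp only [Nat.sub_self, Nat.factorial_zero, Nat.cast_one, mul_one] at h2
      linear_combination h2
    rw [Finset.sum_range_succ _ (N + 1)]
    simp only [Nat.sub_self, Nat.factorial_zero, Nat.cast_one, mul_one]
    rw [show ((-1 : ℂ) ^ (N + 1) / ((N + 1).factorial : ℂ)) =
      -∑ k ∈ Finset.range (N + 1), (-1 : ℂ) ^ k / (k.factorial * (N + 1 - k).factorial : ℂ) by
        rw [hsum]; ring, neg_mul, Finset.sum_mul, Finset.sum_mul, ← sub_eq_add_neg,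
      ← Finset.sum_sub_distrib]
    refine Finset.sum_congr rfl fun k hk => ?_
    have hk' : k < N + 1 := Finset.mem_range.1 hk
    have e1 : N + 1 - k = (N - k) + 1 := by omega
    rw [e1, Nat.factorial_succ]
    have e2 : (((N - k : ℕ) : ℂ)) = N - k := by
      rw [Nat.cast_sub (by omega)]
    have e3 := hs k (by omega)
    have e4 := hs (N + 1) (by omega)
    have e5 : (N - k + 1 : ℂ) ≠ 0 := by
      rw [← e2]; exact_mod_cast Nat.succ_ne_zero (N - k)
    have e6 : (k.factorial : ℂ) ≠ 0 := by exact_mod_cast Nat.factorial_ne_zero _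
    have e7 : ((N - k).factorial : ℂ) ≠ 0 := by exact_mod_cast Nat.factorial_ne_zero _
    push_cast at e4 ⊢
    rw [e2]
    field_simp
    ring

/-- The residue theorem for `h(s) / ∏_{k < N + 1} (k - s)` and a negatively oriented rectangle. -/
theorem rectangleIntegral_prod_inv {h : ℂ → ℂ} {a b η : ℝ} {N : ℕ} (ha : a < 0) (hb : (N : ℝ) < b)
    (hη : 0 < η)
    (hd : ∀ s : ℂ, a ≤ s.re → s.re ≤ b → |s.im| ≤ η → DifferentiableAt ℂ h s) :
    rectangleIntegral a b η (fun s => h s * (∏ k ∈ Finset.range (N + 1), (k - s : ℂ))⁻¹) =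
      2 * Real.pi * Complex.I * ∑ k ∈ Finset.range (N + 1),
        (-1) ^ k / (k.factorial * (N - k).factorial : ℂ) * h k := by
  have hN : (0 : ℝ) ≤ N := N.cast_nonneg
  have hab : a ≤ b := by linarith
  have hne : ∀ s, OnRectangle a b η s → ∀ k < N + 1, (k - s : ℂ) ≠ 0 := by
    rintro s ⟨-, -, -, h1⟩ k hk h0
    have h2 : (k : ℝ) ≤ N := by exact_mod_cast Nat.lt_succ_iff.1 hk
    have h3 : (0 : ℝ) ≤ k := k.cast_nonneg
    have : s = k := (sub_eq_zero.1 h0).symm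
    subst this
    simp only [Complex.natCast_re, Complex.natCast_im, abs_zero] at h1
    rcases h1 with h1 | h1 | h1 <;> linarith
  have h1 : rectangleIntegral a b η
        (fun s => h s * (∏ k ∈ Finset.range (N + 1), (k - s : ℂ))⁻¹)
      = rectangleIntegral a b η (fun s => ∑ k ∈ Finset.range (N + 1),
        (-1) ^ k / (k.factorial * (N - k).factorial : ℂ) * (h s * (k - s)⁻¹)) := by
    refine rectangleIntegral_congr hab hη fun s hs _ => ?_
    rw [prod_inv_natCast_sub N (hne s hs), Finset.mul_sum]
    exact Finset.sum_congr rfl fun k _ => by ring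
  rw [h1, rectangleIntegral_sum hab hη.le, Finset.mul_sum]
  · refine Finset.sum_congr rfl fun k hk => ?_
    have h2 : (k : ℝ) ≤ N := by exact_mod_cast Nat.lt_succ_iff.1 (Finset.mem_range.1 hk)
    have h3 : (0 : ℝ) ≤ k := k.cast_nonneg
    have := rectangleIntegral_div (p := k) (h := h) (by linarith : a < k) (by linarith) hη hd
    rw [Complex.ofReal_natCast] at this
    rw [rectangleIntegral_const_mul, this]
    ring
  · intro k hk s hs
    refine ContinuousAt.mul continuousAt_const (ContinuousAt.mul
      (hd s hs.1 hs.2.1 hs.2.2.1).continuousAt (ContinuousAt.inv₀ (by fun_prop)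
        (hne s hs k (Finset.mem_range.1 hk))))

/-! ### Bounds for the Gamma function -/

theorem measurable_Gamma : Measurable Complex.Gamma := by
  have h : Measurable fun s : ℂ => ((Complex.Gamma s)⁻¹)⁻¹ :=
    (Complex.differentiable_one_div_Gamma.continuous.measurable).inv
  simpa using h

theorem differentiableAt_Gamma_of_im_ne_zero {z : ℂ} (hz : z.im ≠ 0) :
    DifferentiableAt ℂ Complex.Gamma z :=
  Complex.differentiableAt_Gamma z fun m h => hz (by simp [h])

theorem differentiableAt_Gamma_of_re_pos {z : ℂ} (hz : 0 < z.re) :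
    DifferentiableAt ℂ Complex.Gamma z :=
  Complex.differentiableAt_Gamma z fun m h => by
    have h1 : (0 : ℝ) ≤ m := m.cast_nonneg
    rw [h, Complex.neg_re, Complex.natCast_re] at hz
    linarith

theorem norm_Gamma_le {z : ℂ} (hz : 0 < z.re) : ‖Complex.Gamma z‖ ≤ Real.Gamma z.re := by
  rw [Complex.Gamma_eq_integral hz, Real.Gamma_eq_integral hz, Complex.GammaIntegral]
  refine (norm_integral_le_integral_norm _).trans (le_of_eq ?_)
  refine setIntegral_congr_fun measurableSet_Ioi fun x (hx : 0 < x) => ?_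
  rw [norm_mul, Complex.norm_real, Real.norm_of_nonneg (Real.exp_pos _).le,
    Complex.norm_cpow_eq_rpow_re_of_pos hx]
  simp

/-- On the line `Re z = 1/2` the reflection formula gives `|Γ(z)|² = π / cosh(π Im z)`. -/
theorem norm_Gamma_half_le {z : ℂ} (hz : z.re = 1 / 2) :
    ‖Complex.Gamma z‖ ≤ √(2 * Real.pi) * Real.exp (-(Real.pi / 2 * |z.im|)) := by
  have h1 : (1 : ℂ) - z = (starRingEnd ℂ) z := by
    apply Complex.ext
    · simp [hz]; norm_num
    · simp
  have h2 := Complex.Gamma_mul_Gamma_one_sub z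
  have hz' : (Real.pi * z : ℂ) = Real.pi / 2 + (Real.pi * z.im : ℝ) * Complex.I := by
    apply Complex.ext
    · simp [hz]; ring
    · simp
  rw [h1, Complex.Gamma_conj, Complex.mul_conj, hz', Complex.sin_add, Complex.sin_pi_div_two,
    Complex.cos_pi_div_two, zero_mul, add_zero, one_mul, Complex.cos_mul_I,
    ← Complex.ofReal_cosh, ← Complex.ofReal_div, Complex.ofReal_inj, Complex.normSq_eq_norm_sq]
    at h2
  have h3 : Real.exp (Real.pi * |z.im|) / 2 ≤ Real.cosh (Real.pi * z.im) := by
    rw [← Real.cosh_abs, abs_mul, abs_of_pos Real.pi_pos, Real.cosh_eq]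
    have := Real.exp_pos (-(Real.pi * |z.im|))
    linarith
  refine abs_le_of_sq_le_sq' ?_ (by positivity) |>.2
  rw [h2, mul_pow, Real.sq_sqrt (by positivity), ← Real.exp_nat_mul, div_le_iff₀ (Real.cosh_pos _)]
  calc Real.pi = 2 * Real.pi * Real.exp (-(Real.pi * |z.im|)) *
        (Real.exp (Real.pi * |z.im|) / 2) := by
        rw [Real.exp_neg]; field_simp
    _ ≤ _ := by
      rw [show ((2 : ℕ) : ℝ) * -(Real.pi / 2 * |z.im|) = -(Real.pi * |z.im|) by push_cast; ring]
      gcongr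

theorem im_mul_arg (z : ℂ) : z.im * z.arg = |z.im| * |z.arg| := by
  rcases le_or_gt 0 z.im with h | h
  · rw [abs_of_nonneg h, abs_of_nonneg (Complex.arg_nonneg_iff.2 h)]
  · rw [abs_of_neg h, abs_of_neg (Complex.arg_neg_iff.2 h)]; ring

theorem im_mul_arg_le {z : ℂ} (hz : 0 ≤ z.re) : z.im * z.arg ≤ Real.pi / 2 * |z.im| := by
  rw [im_mul_arg, mul_comm]
  exact mul_le_mul_of_nonneg_right (Complex.abs_arg_le_pi_div_two_iff.2 hz) (abs_nonneg _)

/-- The deviation of `|arg z|` from `π/2` is at most `(π/2) Re z / |z|`, by Jordan's inequality. -/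
theorem le_im_mul_arg {z : ℂ} (hz : 0 < z.re) :
    Real.pi / 2 * |z.im| - Real.pi / 2 * z.re ≤ z.im * z.arg := by
  have hz0 : z ≠ 0 := fun h => by simp [h] at hz
  have h1 := Complex.abs_arg_le_pi_div_two_iff.2 hz.le
  have h2 := Real.mul_le_sin (x := Real.pi / 2 - |z.arg|) (by linarith)
    (by linarith [abs_nonneg z.arg])
  rw [Real.sin_pi_div_two_sub, Real.cos_abs, Complex.cos_arg hz0] at h2
  have h3 : 0 < ‖z‖ := norm_pos_iff.2 hz0
  have h4 : (Real.pi / 2 - |z.arg|) * |z.im| ≤ Real.pi / 2 * z.re := by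
    have h5 : Real.pi / 2 - |z.arg| ≤ Real.pi / 2 * (z.re / ‖z‖) := by
      have hpi := Real.pi_pos
      calc Real.pi / 2 - |z.arg| = Real.pi / 2 * (2 / Real.pi * (Real.pi / 2 - |z.arg|)) := by
            field_simp
        _ ≤ _ := by gcongr
    calc (Real.pi / 2 - |z.arg|) * |z.im| ≤ Real.pi / 2 * (z.re / ‖z‖) * ‖z‖ := by
          refine mul_le_mul h5 (Complex.abs_im_le_norm z) (abs_nonneg _) ?_
          have := Real.pi_pos
          positivity
      _ = _ := by field_simp
  rw [im_mul_arg]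
  linarith

theorem norm_self_cpow {z : ℂ} (hz : z ≠ 0) :
    ‖z ^ (1 / 2 - z)‖ = ‖z‖ ^ (1 / 2 - z.re) * Real.exp (z.im * z.arg) := by
  rw [Complex.norm_cpow_of_ne_zero hz, div_eq_mul_inv, ← Real.exp_neg]
  congr 2
  · norm_num
  · simp; ring

/-- The upper half of Stirling's formula on the strip `1/2 ≤ Re z ≤ 3/2`. On its edges
`Γ(z) z^{1/2 - z}` is bounded by the reflection formula, and the Phragmén–Lindelöf principle
carries the bound over to the interior. -/
theorem norm_Gamma_mul_cpow_le {z : ℂ} (h1 : 1 / 2 ≤ z.re) (h2 : z.re ≤ 3 / 2) :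
    ‖Complex.Gamma z * z ^ (1 / 2 - z)‖ ≤ √(2 * Real.pi) := by
  have edge : ∀ z : ℂ, z.re = 1 / 2 →
      ‖Complex.Gamma z‖ * Real.exp (Real.pi / 2 * |z.im|) ≤ √(2 * Real.pi) := by
    intro z hz
    have := norm_Gamma_half_le hz
    rw [Real.exp_neg, ← div_eq_mul_inv, le_div_iff₀ (Real.exp_pos _)] at this
    exact this
  have hd : ∀ z : ℂ, 0 < z.re →
      DifferentiableAt ℂ (fun z => Complex.Gamma z * z ^ (1 / 2 - z)) z := by
    intro z hz
    refine (differentiableAt_Gamma_of_re_pos hz).mul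
      (differentiableAt_id.cpow (by fun_prop) (Or.inl hz))
  refine PhragmenLindelof.vertical_strip (f := fun z => Complex.Gamma z * z ^ (1 / 2 - z))
    (a := 1 / 2) (b := 3 / 2) ?_ ?_ ?_ ?_ h1 h2
  · refine DifferentiableOn.diffContOnCl fun z hz => (hd z ?_).differentiableWithinAt
    have : closure (Complex.re ⁻¹' Ioo (1 / 2 : ℝ) (3 / 2)) ⊆
        Complex.re ⁻¹' Icc (1 / 2 : ℝ) (3 / 2) :=
      closure_minimal (preimage_mono Ioo_subset_Icc_self)
        (isClosed_Icc.preimage Complex.continuous_re)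
    have := (this hz).1
    linarith
  · refine ⟨1, by linarith [Real.pi_gt_three], Real.pi / 2, ?_⟩
    refine Asymptotics.IsBigO.of_bound (max (Real.Gamma (1 / 2)) (Real.Gamma (3 / 2)) * 2) ?_
    refine Eventually.filter_mono inf_le_right ?_
    refine eventually_principal.2 fun z hz => ?_
    have hz1 : 1 / 2 < z.re := hz.1
    have hz2 : z.re < 3 / 2 := hz.2
    have hz0 : z ≠ 0 := fun h => by simp [h] at hz1; linarith
    rw [norm_mul, norm_self_cpow hz0, Real.norm_of_nonneg (Real.exp_pos _).le, mul_assoc]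
    refine mul_le_mul ((norm_Gamma_le (by linarith)).trans ?_) ?_ (by positivity) ?_
    · exact Real.convexOn_Gamma.le_max_of_mem_Icc (by simp) (by simp) ⟨hz1.le, hz2.le⟩
    · refine mul_le_mul ?_ ?_ (Real.exp_pos _).le two_pos.le
      · have h3 : 1 / 2 ≤ ‖z‖ := hz1.le.trans (Complex.re_le_norm z)
        calc ‖z‖ ^ (1 / 2 - z.re) ≤ (1 / 2 : ℝ) ^ (1 / 2 - z.re) :=
              Real.rpow_le_rpow_of_nonpos (by norm_num) h3 (by linarith)
          _ ≤ (1 / 2 : ℝ) ^ (-1 : ℝ) :=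
              Real.rpow_le_rpow_of_exponent_ge (by norm_num) (by norm_num) (by linarith)
          _ = 2 := by rw [Real.rpow_neg_one]; norm_num
      · refine Real.exp_le_exp.2 ((im_mul_arg_le (by linarith)).trans ?_)
        refine mul_le_mul_of_nonneg_left ?_ (by positivity)
        rw [one_mul]
        linarith [Real.add_one_le_exp |z.im|]
    · exact le_max_of_le_left (Real.Gamma_pos_of_pos (by norm_num)).le
  · intro z hz
    have hz0 : z ≠ 0 := fun h => by simp [h] at hz
    rw [norm_mul, norm_self_cpow hz0, hz, sub_self, Real.rpow_zero, one_mul]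
    refine le_trans ?_ (edge z hz)
    exact mul_le_mul_of_nonneg_left (Real.exp_le_exp.2 (im_mul_arg_le (by rw [hz]; norm_num)))
      (norm_nonneg _)
  · intro z hz
    have hz0 : z ≠ 0 := fun h => by norm_num [h] at hz
    have hz1 : z - 1 ≠ 0 := fun h => by
      rw [sub_eq_zero.1 h] at hz; norm_num at hz
    have hΓ : Complex.Gamma z = (z - 1) * Complex.Gamma (z - 1) := by
      rw [← Complex.Gamma_add_one _ hz1, sub_add_cancel]
    have hzn : 0 < ‖z‖ := norm_pos_iff.2 hz0
    have hle : ‖z - 1‖ ≤ ‖z‖ := by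
      rw [Complex.norm_def, Complex.norm_def, Complex.normSq_apply, Complex.normSq_apply]
      refine Real.sqrt_le_sqrt ?_
      simp [hz]
      norm_num
    rw [norm_mul, norm_self_cpow hz0, hz, hΓ, norm_mul,
      show (1 / 2 - 3 / 2 : ℝ) = -1 by norm_num, Real.rpow_neg_one]
    have e := edge (z - 1) (by simp [hz]; norm_num)
    simp only [Complex.sub_im, Complex.one_im, sub_zero] at e
    calc ‖z - 1‖ * ‖Complex.Gamma (z - 1)‖ * (‖z‖⁻¹ * Real.exp (z.im * z.arg))
        = (‖z - 1‖ * ‖z‖⁻¹) * (‖Complex.Gamma (z - 1)‖ * Real.exp (z.im * z.arg)) := by ring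
      _ ≤ 1 * (‖Complex.Gamma (z - 1)‖ * Real.exp (Real.pi / 2 * |z.im|)) := by
        refine mul_le_mul ?_ ?_ (by positivity) zero_le_one
        · rw [← div_eq_mul_inv]; exact (div_le_one hzn).2 hle
        · exact mul_le_mul_of_nonneg_left
            (Real.exp_le_exp.2 (im_mul_arg_le (by rw [hz]; norm_num))) (norm_nonneg _)
      _ ≤ _ := by rw [one_mul]; exact e

/-- A Stirling-type upper bound in the half-plane `Re z ≤ 3/2`, uniform away from the real axis.
From the strip `1/2 ≤ Re z ≤ 3/2` it is carried to the left by `Γ(z) = Γ(z + 1) / z`. -/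
theorem exists_norm_Gamma_le_of_re_le : ∃ C : ℝ, 0 < C ∧ ∀ z : ℂ, z.re ≤ 3 / 2 → 1 ≤ |z.im| →
    ‖Complex.Gamma z‖ ≤ C * |z.im| ^ (z.re - 1 / 2) * Real.exp (-(Real.pi / 2 * |z.im|)) := by
  set C : ℝ := √(2 * Real.pi) * Real.exp (Real.pi * (3 / 4)) * (5 / 2) with hC
  refine ⟨C, by positivity, fun z hz hz' => ?_⟩
  obtain ⟨n, hn⟩ := exists_nat_ge (1 / 2 - z.re)
  induction n generalizing z with
  | zero =>
    have h1 : 1 / 2 ≤ z.re := by simp at hn; linarith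
    have hz0 : z ≠ 0 := fun h => by simp [h] at h1; linarith
    have hzn : 0 < ‖z‖ := norm_pos_iff.2 hz0
    have h2 := norm_Gamma_mul_cpow_le h1 hz
    rw [norm_mul, norm_self_cpow hz0] at h2
    have h3 : ‖z‖ ≤ 5 / 2 * |z.im| := by
      refine (Complex.norm_le_abs_re_add_abs_im z).trans ?_
      rw [abs_of_pos (by linarith : 0 < z.re)]
      linarith
    have h4 : Real.exp (-(z.im * z.arg)) ≤
        Real.exp (Real.pi * (3 / 4)) * Real.exp (-(Real.pi / 2 * |z.im|)) := by
      rw [← Real.exp_add]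
      refine Real.exp_le_exp.2 ?_
      have := le_im_mul_arg (z := z) (by linarith)
      have : Real.pi / 2 * z.re ≤ Real.pi / 2 * (3 / 2) := by
        have := Real.pi_pos; gcongr
      linarith
    have h5 : ‖z‖ ^ (z.re - 1 / 2) ≤ 5 / 2 * |z.im| ^ (z.re - 1 / 2) := by
      calc ‖z‖ ^ (z.re - 1 / 2) ≤ (5 / 2 * |z.im|) ^ (z.re - 1 / 2) :=
            Real.rpow_le_rpow hzn.le h3 (by linarith)
        _ = (5 / 2) ^ (z.re - 1 / 2) * |z.im| ^ (z.re - 1 / 2) :=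
            Real.mul_rpow (by norm_num) (abs_nonneg _)
        _ ≤ (5 / 2) ^ (1 : ℝ) * |z.im| ^ (z.re - 1 / 2) := by
            gcongr
            · norm_num
            · linarith
        _ = _ := by rw [Real.rpow_one]
    calc ‖Complex.Gamma z‖ = ‖Complex.Gamma z‖ * (‖z‖ ^ (1 / 2 - z.re) *
          Real.exp (z.im * z.arg)) * (‖z‖ ^ (z.re - 1 / 2) * Real.exp (-(z.im * z.arg))) := by
          rw [mul_assoc, mul_mul_mul_comm, ← Real.rpow_add hzn, ← Real.exp_add]
          simp
      _ ≤ √(2 * Real.pi) * (5 / 2 * |z.im| ^ (z.re - 1 / 2) *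
          (Real.exp (Real.pi * (3 / 4)) * Real.exp (-(Real.pi / 2 * |z.im|)))) := by
          gcongr
      _ = _ := by rw [hC]; ring
  | succ n ih =>
    rcases le_or_gt (1 / 2 - z.re) n with h | h
    · exact ih z hz hz' h
    have him : 0 < |z.im| := by linarith
    have hz0 : z ≠ 0 := fun h => by simp [h] at him
    have h1 := ih (z + 1) (by
      have : (0 : ℝ) ≤ n := n.cast_nonneg
      simp; linarith) (by simpa using hz') (by push_cast at hn; simp; linarith)
    rw [Complex.Gamma_add_one z hz0, norm_mul] at h1
    simp only [Complex.add_im, Complex.one_im, add_zero, Complex.add_re, Complex.one_re] at h1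
    rw [show z.re + 1 - 1 / 2 = (z.re - 1 / 2) + 1 by ring, Real.rpow_add him, Real.rpow_one] at h1
    refine le_of_mul_le_mul_left ?_ him
    calc |z.im| * ‖Complex.Gamma z‖ ≤ ‖z‖ * ‖Complex.Gamma z‖ := by
          gcongr; exact Complex.abs_im_le_norm z
      _ ≤ _ := h1
      _ = _ := by ring

/-- `1 / Γ` decays faster than any exponential in a half-strip. -/
theorem exists_norm_inv_Gamma_le (σ₀ η : ℝ) {R : ℝ} (hR : 0 < R) :
    ∃ C : ℝ, 0 < C ∧ ∀ z : ℂ, σ₀ ≤ z.re → |z.im| ≤ η →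
      ‖(Complex.Gamma z)⁻¹‖ ≤ C * R ^ (-z.re) := by
  set L := max R |σ₀| with hL
  have hLR : R ≤ L := le_max_left _ _
  have hLσ : σ₀ ≤ L := (le_abs_self _).trans (le_max_right _ _)
  have hK : IsCompact (Icc σ₀ (L + 1) ×ℂ Icc (-η) η) := isCompact_Icc.reProdIm isCompact_Icc
  obtain ⟨C, hC⟩ := hK.exists_bound_of_continuousOn
    (f := fun z : ℂ => (Complex.Gamma z)⁻¹ * ((R ^ z.re : ℝ) : ℂ)) (by
      refine Continuous.continuousOn (Complex.differentiable_one_div_Gamma.continuous.mul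
        (Complex.continuous_ofReal.comp ?_))
      exact continuous_const.rpow Complex.continuous_re fun _ => Or.inl hR.ne')
  refine ⟨max C 1, by positivity, fun z hz hz' => ?_⟩
  obtain ⟨n, hn⟩ := exists_nat_ge (z.re - (L + 1))
  induction n generalizing z with
  | zero =>
    have h1 := hC z ⟨⟨hz, by simp at hn; linarith⟩, abs_le.1 hz'⟩
    rw [norm_mul, Complex.norm_real, Real.norm_of_nonneg (by positivity)] at h1
    rw [Real.rpow_neg hR.le, ← div_eq_mul_inv, le_div_iff₀ (by positivity)]
    exact h1.trans (le_max_left _ _)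
  | succ n ih =>
    rcases le_or_gt (z.re - (L + 1)) n with h | h
    · exact ih z hz hz' h
    have hn0 : (0 : ℝ) ≤ n := n.cast_nonneg
    have hL0 : 0 < L := hR.trans_le hLR
    have hz1 : z - 1 ≠ 0 := fun h0 => by
      rw [sub_eq_zero.1 h0] at h; simp at h; linarith
    have hΓ : Complex.Gamma z = (z - 1) * Complex.Gamma (z - 1) := by
      rw [← Complex.Gamma_add_one _ hz1, sub_add_cancel]
    have h1 := ih (z - 1) (by simp; linarith) (by simpa using hz')
      (by push_cast at hn; simp; linarith)
    have h2 : R ≤ ‖z - 1‖ := by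
      refine le_trans ?_ (Complex.re_le_norm _)
      simp; linarith
    rw [hΓ, mul_inv, norm_mul, norm_inv]
    calc ‖z - 1‖⁻¹ * ‖(Complex.Gamma (z - 1))⁻¹‖ ≤ R⁻¹ * (max C 1 * R ^ (-(z - 1).re)) := by
          gcongr
      _ = _ := by
          rw [show -(z - 1).re = -z.re + 1 by simp; ring, Real.rpow_add hR, Real.rpow_one]
          field_simp

/-- `Γ` is bounded in a half-strip to the left which avoids the real axis. -/
theorem exists_norm_Gamma_le (σ₁ : ℝ) {T₁ : ℝ} (T₂ : ℝ) (hT : 0 < T₁) :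
    ∃ C : ℝ, 0 < C ∧ ∀ z : ℂ, z.re ≤ σ₁ → T₁ ≤ |z.im| → |z.im| ≤ T₂ →
      ‖Complex.Gamma z‖ ≤ C := by
  have hK : IsCompact (Icc (-1) (max σ₁ 0) ×ℂ {y : ℝ | T₁ ≤ |y| ∧ |y| ≤ T₂}) := by
    refine isCompact_Icc.reProdIm ((isCompact_Icc (a := -T₂) (b := T₂)).of_isClosed_subset ?_ ?_)
    · exact (isClosed_le continuous_const continuous_abs).inter
        (isClosed_le continuous_abs continuous_const)
    · exact fun y hy => abs_le.1 hy.2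
  obtain ⟨C, hC⟩ := hK.exists_bound_of_continuousOn (f := Complex.Gamma) (by
    intro z hz
    refine (differentiableAt_Gamma_of_im_ne_zero fun h => ?_).continuousAt.continuousWithinAt
    have := hz.2.1
    rw [h, abs_zero] at this
    linarith)
  refine ⟨max C 1, by positivity, fun z hz hz1 hz2 => ?_⟩
  have hz' := hz.trans (le_max_left σ₁ 0)
  clear hz
  obtain ⟨n, hn⟩ := exists_nat_ge (-1 - z.re)
  induction n generalizing z with
  | zero => exact (hC z ⟨⟨by simp at hn; linarith, hz'⟩, hz1, hz2⟩).trans (le_max_left _ _)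
  | succ n ih =>
    rcases le_or_gt (-1 - z.re) n with h | h
    · exact ih z hz1 hz2 hz' h
    have hn0 : (0 : ℝ) ≤ n := n.cast_nonneg
    have hz0 : z ≠ 0 := fun h => by simp [h] at hz1; linarith
    have h1 := ih (z + 1) (by simpa using hz1) (by simpa using hz2)
      (le_trans (by simp; linarith) (le_max_right _ _)) (by push_cast at hn; simp; linarith)
    rw [Complex.Gamma_add_one z hz0, norm_mul] at h1
    have h2 : 1 ≤ ‖z‖ := by
      refine le_trans ?_ (Complex.abs_re_le_norm z)
      rw [abs_of_neg (by linarith)]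
      linarith
    calc ‖Complex.Gamma z‖ ≤ ‖z‖ * ‖Complex.Gamma z‖ := le_mul_of_one_le_left (norm_nonneg _) h2
      _ ≤ _ := h1

/-- `Γ` is uniformly bounded on the lines `Re z = 1/2 - N` which separate its poles. -/
theorem norm_Gamma_half_sub_nat_le (N : ℕ) {z : ℂ} (hz : z.re = 1 / 2 - N) :
    ‖Complex.Gamma z‖ ≤ 2 * Real.Gamma (1 / 2) := by
  have hpos : 0 < Real.Gamma (1 / 2) := Real.Gamma_pos_of_pos (by norm_num)
  have step : ∀ z : ℂ, z ≠ 0 → ∀ r B : ℝ, 0 < r → r ≤ |z.re| → ‖Complex.Gamma (z + 1)‖ ≤ r * B →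
      ‖Complex.Gamma z‖ ≤ B := by
    intro z hz r B hr h1 h2
    rw [Complex.Gamma_add_one z hz, norm_mul] at h2
    refine le_of_mul_le_mul_left (le_trans ?_ h2) hr
    gcongr
    exact h1.trans (Complex.abs_re_le_norm z)
  induction N generalizing z with
  | zero =>
    have h : z.re = 1 / 2 := by simpa using hz
    have h1 := norm_Gamma_le (z := z) (by rw [h]; norm_num)
    rw [h] at h1
    linarith
  | succ N ih =>
    have hN : (0 : ℝ) ≤ N := N.cast_nonneg
    have hre : z.re = -(1 / 2 + N) := by rw [hz]; push_cast; ring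
    have hz0 : z ≠ 0 := fun h => by simp [h] at hre; linarith
    have habs : |z.re| = 1 / 2 + N := by rw [hre, abs_neg, abs_of_pos (by linarith)]
    rcases Nat.eq_zero_or_pos N with h | h
    · have h1 : (z + 1).re = 1 / 2 := by simp [hre, h]; norm_num
      have h2 := norm_Gamma_le (z := z + 1) (by rw [h1]; norm_num)
      rw [h1] at h2
      exact step z hz0 (1 / 2) _ (by norm_num) (by rw [habs]; linarith) (by linarith)
    · have h1 : (1 : ℝ) ≤ N := by exact_mod_cast h
      refine step z hz0 1 _ one_pos (by rw [habs]; linarith) ?_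
      rw [one_mul]
      exact ih (by simp [hre]; ring)

theorem Gamma_add_natCast (N : ℕ) {z : ℂ} (hz : ∀ k < N, z + k ≠ 0) :
    Complex.Gamma (z + N) = Complex.Gamma z * ∏ k ∈ Finset.range N, (z + k) := by
  induction N with
  | zero => simp
  | succ N ih =>
    rw [Finset.prod_range_succ, ← mul_assoc, ← ih fun k hk => hz k (by omega), Nat.cast_succ,
      ← add_assoc, Complex.Gamma_add_one _ (hz N (by omega)), mul_comm]

theorem Gamma_neg_div_Gamma (n : ℕ) {s : ℂ} (hs : s.im ≠ 0) :
    Complex.Gamma (-s) / Complex.Gamma (n - s) = (∏ k ∈ Finset.range n, (k - s : ℂ))⁻¹ := by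
  have hne : ∀ k < n, -s + (k : ℂ) ≠ 0 := fun k _ h0 => hs (by
    have := congrArg Complex.im h0
    simpa using this)
  have h2 := Gamma_add_natCast n hne
  have h3 : Complex.Gamma (-s) ≠ 0 := Complex.Gamma_ne_zero fun m h => hs (by
    have := congrArg Complex.im h
    simpa using this)
  rw [show (n : ℂ) - s = -s + (n : ℂ) by ring, h2]
  simp only [sub_eq_add_neg, add_comm _ (-s)]
  rw [div_mul_eq_div_div, div_self h3, one_div]

/-- `Γ(n + r) ≤ Γ(n) n^r` for `0 < r < 1`, by logarithmic convexity. -/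
theorem Gamma_natCast_add_le {n : ℕ} (hn : n ≠ 0) {r : ℝ} (h0 : 0 < r) (h1 : r < 1) :
    Real.Gamma (n + r) ≤ Real.Gamma n * n ^ r := by
  have hn' : (0 : ℝ) < n := by positivity
  have h := Real.Gamma_mul_add_mul_le_rpow_Gamma_mul_rpow_Gamma hn'
    (by linarith : (0 : ℝ) < n + 1) (sub_pos.2 h1) h0 (by ring)
  have hΓ := Real.Gamma_pos_of_pos hn'
  rw [Real.Gamma_add_one hn'.ne', Real.mul_rpow hn'.le hΓ.le, mul_comm ((n : ℝ) ^ r), ← mul_assoc,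
    ← Real.rpow_add hΓ, sub_add_cancel, Real.rpow_one] at h
  convert h using 2
  ring

/-- Euler's limit formula in the form `Γ(n + 1 + w) ~ Γ(n) n^{1 + w}`. -/
theorem tendsto_Gamma_ratio {w : ℂ} (hw : ∀ m : ℕ, w ≠ -m) :
    Tendsto (fun n : ℕ => Complex.Gamma (n + 1 + w) / (Complex.Gamma n * (n : ℂ) ^ (1 + w)))
      atTop (𝓝 1) := by
  have hΓ := Complex.Gamma_ne_zero hw
  have h1 := (Complex.GammaSeq_tendsto_Gamma w).inv₀ hΓ |>.const_mul (Complex.Gamma w)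
  rw [mul_inv_cancel₀ hΓ] at h1
  refine h1.congr' ?_
  filter_upwards [eventually_ne_atTop 0] with n hn
  have hn' : (n : ℂ) ≠ 0 := by exact_mod_cast hn
  have h3 : Complex.Gamma (n + 1 + w) =
      Complex.Gamma w * ∏ k ∈ Finset.range (n + 1), (w + k) := by
    rw [← Gamma_add_natCast (n + 1) fun k _ h => hw k (eq_neg_of_add_eq_zero_left h)]
    congr 1
    push_cast
    ring
  have h4 : (n.factorial : ℂ) = n * Complex.Gamma n := by
    rw [← Complex.Gamma_add_one _ hn', Complex.Gamma_nat_eq_factorial]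
  have h5 : (n : ℂ) ^ (1 + w) = n * (n : ℂ) ^ w := by
    rw [Complex.cpow_add _ _ hn', Complex.cpow_one]
  rw [Complex.GammaSeq, h3, h4, h5, inv_div]
  ring

/-! ### Deformation of unbounded contours -/

theorem measurable_vertical {f : ℂ → ℂ} (hf : Measurable f) (a : ℝ) :
    Measurable fun y : ℝ => f (a + y * Complex.I) :=
  hf.comp (by fun_prop)

theorem measurable_horizontal {f : ℂ → ℂ} (hf : Measurable f) (T : ℝ) :
    Measurable fun v : ℝ => f (v + T * Complex.I) :=
  hf.comp (by fun_prop)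

theorem integrableOn_horizontal {f : ℂ → ℂ} (hf : Measurable f) {a T C : ℝ}
    (hb : ∀ v : ℝ, a ≤ v → ‖f (v + T * Complex.I)‖ ≤ C * Real.exp (-v)) :
    IntegrableOn (fun v : ℝ => f (v + T * Complex.I)) (Ioi a) := by
  refine Integrable.mono' ((integrableOn_exp_neg_Ioi a).const_mul C)
    (measurable_horizontal hf T).aestronglyMeasurable ?_
  exact (ae_restrict_mem measurableSet_Ioi).mono fun v hv => hb v (le_of_lt hv)

theorem integrableOn_horizontal' {f : ℂ → ℂ} (hf : Measurable f) {a T C : ℝ}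
    (hb : ∀ v : ℝ, a ≤ v → ‖f (v - T * Complex.I)‖ ≤ C * Real.exp (-v)) :
    IntegrableOn (fun v : ℝ => f (v - T * Complex.I)) (Ioi a) := by
  have := integrableOn_horizontal (T := -T) hf (a := a) (C := C)
    (by simpa [← sub_eq_add_neg] using hb)
  simpa [← sub_eq_add_neg] using this

theorem norm_integral_vertical_le {f : ℂ → ℂ} {b T₁ T₂ C : ℝ} (hT : T₁ ≤ T₂)
    (hb : ∀ y : ℝ, T₁ ≤ y → y ≤ T₂ → ‖f (b + y * Complex.I)‖ ≤ C) :
    ‖Complex.I * ∫ y in T₁..T₂, f (b + y * Complex.I)‖ ≤ C * |T₂ - T₁| := by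
  rw [norm_mul, Complex.norm_I, one_mul]
  refine intervalIntegral.norm_integral_le_of_norm_le_const fun y hy => ?_
  rw [uIoc_of_le hT] at hy
  exact hb y hy.1.le hy.2

theorem tendsto_integral_vertical {f : ℂ → ℂ} {b : ℕ → ℝ} {T₁ T₂ C : ℝ} (hT : T₁ ≤ T₂)
    (hb : Tendsto b atTop atTop) (h : ∀ n : ℕ, ∀ y : ℝ, T₁ ≤ y → y ≤ T₂ →
      ‖f (b n + y * Complex.I)‖ ≤ C * Real.exp (-b n)) :
    Tendsto (fun n => Complex.I * ∫ y in T₁..T₂, f (b n + y * Complex.I)) atTop (𝓝 0) := by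
  refine squeeze_zero_norm (fun n => norm_integral_vertical_le hT (h n)) ?_
  have := ((Real.tendsto_exp_neg_atTop_nhds_zero.comp hb).const_mul C).mul_const |T₂ - T₁|
  simpa using this

/-- A hairpin integral is a sum of residues: for `g` holomorphic and exponentially decaying in the
half-strip, `∫ Γ(-s) g(s) ds` picks up the residues of `Γ(-s)` at the natural numbers. The hairpin
is the limit of the rectangles whose right side is at `Re s = N + 1/2`, where `Γ(-s)` is bounded. -/
theorem hasSum_hairpinIntegral_Gamma_neg {g : ℂ → ℂ} (hgm : Measurable g) {a η C : ℝ} (ha : a < 0)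
    (hη : 0 < η) (hg : ∀ s : ℂ, a ≤ s.re → |s.im| ≤ η → DifferentiableAt ℂ g s)
    (hC : ∀ s : ℂ, a ≤ s.re → |s.im| ≤ η → ‖g s‖ ≤ C * Real.exp (-s.re)) :
    HasSum (fun k : ℕ => 2 * Real.pi * Complex.I * ((-1) ^ k / k.factorial * g k))
      (hairpinIntegral a η fun s => Complex.Gamma (-s) * g s) := by
  set f : ℂ → ℂ := fun s => Complex.Gamma (-s) * g s with hf
  have hfm : Measurable f := (measurable_Gamma.comp measurable_neg).mul hgm
  have hC0 : 0 ≤ C := by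
    have := (norm_nonneg _).trans (hC 0 (by simpa using ha.le) (by simpa using hη.le))
    simpa using this
  obtain ⟨B, hB0, hB⟩ := exists_norm_Gamma_le (-a) η hη
  have hor : ∀ s : ℂ, a ≤ s.re → |s.im| = η → ‖f s‖ ≤ B * C * Real.exp (-s.re) := by
    intro s h1 h2
    rw [hf, norm_mul, mul_assoc]
    exact mul_le_mul (hB (-s) (by simpa using h1) (by simp [h2]) (by simp [h2]))
      (hC s h1 h2.le) (norm_nonneg _) hB0.le
  have hrect : ∀ N : ℕ, rectangleIntegral a (N + 1 / 2) η f = 2 * Real.pi * Complex.I *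
      ∑ k ∈ Finset.range (N + 1), (-1) ^ k / k.factorial * g k := by
    intro N
    have hN : (0 : ℝ) ≤ N := N.cast_nonneg
    have h1 := rectangleIntegral_prod_inv (h := fun s => g s * Complex.Gamma (N + 1 - s)) ha
      (by linarith : (N : ℝ) < N + 1 / 2) hη (by
        intro s hs1 hs2 hs3
        refine (hg s hs1 hs3).mul (DifferentiableAt.comp s (differentiableAt_Gamma_of_re_pos ?_)
          (by fun_prop))
        simp; linarith)
    have h2 : rectangleIntegral a (N + 1 / 2) η f = rectangleIntegral a (N + 1 / 2) η fun s =>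
        g s * Complex.Gamma (N + 1 - s) * (∏ k ∈ Finset.range (N + 1), (k - s : ℂ))⁻¹ := by
      refine rectangleIntegral_congr (by linarith) hη fun s hs _ => ?_
      have hne : ∀ k < N + 1, -s + (k : ℂ) ≠ 0 := by
        intro k hk h0
        have h3 : s = k := (neg_add_eq_zero.1 h0)
        have h4 : (k : ℝ) ≤ N := by exact_mod_cast Nat.lt_succ_iff.1 hk
        have h5 : (0 : ℝ) ≤ k := k.cast_nonneg
        have h6 := hs.2.2.2
        rw [h3] at h6
        simp only [Complex.natCast_re, Complex.natCast_im, abs_zero] at h6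
        rcases h6 with h6 | h6 | h6 <;> linarith
      have h3 := Gamma_add_natCast (N + 1) hne
      have h4 : ∏ k ∈ Finset.range (N + 1), (-s + k) ≠ 0 :=
        Finset.prod_ne_zero_iff.2 fun k hk => hne k (Finset.mem_range.1 hk)
      simp only [hf]
      rw [show (N + 1 - s : ℂ) = -s + ((N + 1 : ℕ) : ℂ) by push_cast; ring, h3]
      simp only [sub_eq_add_neg, add_comm _ (-s)]
      field_simp
    rw [h2, h1]
    congr 1
    refine Finset.sum_congr rfl fun k hk => ?_
    have hk : k ≤ N := Nat.lt_succ_iff.1 (Finset.mem_range.1 hk)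
    have h3 : Complex.Gamma (N + 1 - k) = (N - k).factorial := by
      rw [← Complex.Gamma_nat_eq_factorial, Nat.cast_sub hk]
      congr 1; ring
    have h4 : ((N - k).factorial : ℂ) ≠ 0 := by exact_mod_cast Nat.factorial_ne_zero _
    rw [h3]
    field_simp
  have hbt : Tendsto (fun N : ℕ => (N + 1 / 2 : ℝ)) atTop atTop :=
    tendsto_atTop_add_const_right _ _ tendsto_natCast_atTop_atTop
  have hlim : Tendsto (fun N : ℕ => rectangleIntegral a (N + 1 / 2) η f) atTop
      (𝓝 (hairpinIntegral a η f)) := by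
    have e1 := intervalIntegral_tendsto_integral_Ioi a (integrableOn_horizontal hfm (T := η)
      (a := a) (C := B * C) (by
        intro v hv
        simpa using hor (v + η * Complex.I) (by simpa) (by simpa using hη.le))) hbt
    have e2 := intervalIntegral_tendsto_integral_Ioi a (integrableOn_horizontal' hfm (T := η)
      (a := a) (C := B * C) (by
        intro v hv
        simpa using hor (v - η * Complex.I) (by simpa) (by simpa using hη.le))) hbt
    have e3 := tendsto_integral_vertical (f := f) (T₁ := -η) (T₂ := η)
      (C := 2 * Real.Gamma (1 / 2) * C) (neg_le_self hη.le) hbt (by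
        intro N y h1 h2
        have hN : (0 : ℝ) ≤ N := N.cast_nonneg
        simp only [hf]
        rw [norm_mul, mul_assoc]
        refine mul_le_mul (norm_Gamma_half_sub_nat_le (N + 1) ?_)
          ((hC _ ?_ ?_).trans_eq ?_) (norm_nonneg _) ?_
        · simp; ring
        · simp; linarith
        · simpa using abs_le.2 ⟨h1, h2⟩
        · simp
        · have := Real.Gamma_pos_of_pos (show (0 : ℝ) < 1 / 2 by norm_num)
          positivity)
    have := ((tendsto_const_nhds (x := Complex.I * ∫ y in (-η)..η, f (a + y * Complex.I))).add
      e1).sub e3 |>.sub e2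
    simp only [sub_zero] at this
    exact this
  have hsum : Summable fun k : ℕ => 2 * Real.pi * Complex.I * ((-1) ^ k / k.factorial * g k) := by
    refine Summable.mul_left _ (Summable.of_norm_bounded (Real.summable_exp_neg_nat.mul_left C) ?_)
    intro k
    have hk : (0 : ℝ) ≤ k := k.cast_nonneg
    have h1 := hC k (by simp; linarith) (by simpa using hη.le)
    rw [norm_mul, norm_div, norm_pow, norm_neg, norm_one, one_pow, Complex.norm_natCast]
    have h2 : (1 : ℝ) ≤ k.factorial := by exact_mod_cast Nat.factorial_pos k
    simp only [Complex.natCast_re] at h1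
    refine le_trans ?_ h1
    exact mul_le_of_le_one_left (norm_nonneg _) ((div_le_one (by linarith)).2 h2)
  rw [hsum.hasSum_iff_tendsto_nat, ← tendsto_add_atTop_iff_nat 1]
  refine hlim.congr fun N => ?_
  rw [hrect, Finset.mul_sum]

/-- Cauchy's theorem for a half-strip which is unbounded to the right. -/
theorem integral_boundary_halfStrip_eq_zero {f : ℂ → ℂ} (hfm : Measurable f) {a T₁ T₂ C : ℝ}
    (hT : T₁ ≤ T₂)
    (hd : ∀ s : ℂ, a ≤ s.re → T₁ ≤ s.im → s.im ≤ T₂ → DifferentiableAt ℂ f s)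
    (hC : ∀ s : ℂ, a ≤ s.re → T₁ ≤ s.im → s.im ≤ T₂ → ‖f s‖ ≤ C * Real.exp (-s.re)) :
    (∫ v in Ioi a, f (v + T₁ * Complex.I)) - (∫ v in Ioi a, f (v + T₂ * Complex.I))
      - Complex.I * (∫ y in T₁..T₂, f (a + y * Complex.I)) = 0 := by
  have hbt : Tendsto (fun N : ℕ => (a + N : ℝ)) atTop atTop :=
    tendsto_atTop_add_const_left _ _ tendsto_natCast_atTop_atTop
  have e : ∀ T, T₁ ≤ T → T ≤ T₂ → Tendsto (fun N : ℕ => ∫ v in a..(a + N), f (v + T * Complex.I))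
      atTop (𝓝 (∫ v in Ioi a, f (v + T * Complex.I))) := fun T h1 h2 =>
    intervalIntegral_tendsto_integral_Ioi a (integrableOn_horizontal hfm (T := T)
      (a := a) (C := C) (by
        intro v hv
        simpa using hC (v + T * Complex.I) (by simpa) (by simpa) (by simpa))) hbt
  have e3 := tendsto_integral_vertical (f := f) (T₁ := T₁) (T₂ := T₂) (C := C) hT hbt (by
    intro N y h1 h2
    have hN : (0 : ℝ) ≤ N := N.cast_nonneg
    simpa using hC ((a + N : ℝ) + y * Complex.I) (by simp) (by simpa) (by simpa))
  have h := (((e T₁ le_rfl hT).sub (e T₂ hT le_rfl)).add e3).sub_const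
    (Complex.I * (∫ y in T₁..T₂, f (a + y * Complex.I)))
  rw [add_zero] at h
  refine tendsto_nhds_unique h (tendsto_const_nhds.congr fun N => ?_)
  have hN : (0 : ℝ) ≤ N := N.cast_nonneg
  exact (integral_boundary_eq_zero (a := a) (b := a + N) (by linarith) hT
    fun s h1 _ h3 h4 => hd s h1 h3 h4).symm

/-- The left side of a hairpin may be moved through a region of holomorphy. -/
theorem hairpinIntegral_eq_of_le {f : ℂ → ℂ} (hfm : Measurable f) {a b η C : ℝ} (hab : a ≤ b)
    (hη : 0 ≤ η)
    (hd : ∀ s : ℂ, a ≤ s.re → s.re ≤ b → |s.im| ≤ η → DifferentiableAt ℂ f s)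
    (hC : ∀ s : ℂ, a ≤ s.re → |s.im| = η → ‖f s‖ ≤ C * Real.exp (-s.re)) :
    hairpinIntegral a η f = hairpinIntegral b η f := by
  have h0 := rectangleIntegral_eq_zero_off_countable (S := ∅) hab hη countable_empty
    (fun s h1 h2 h3 => (hd s h1 h2 h3).continuousAt) (fun s h1 h2 h3 _ => hd s h1 h2 h3)
  have i1 : IntegrableOn (fun v : ℝ => f (v + η * Complex.I)) (Ioi a) :=
    integrableOn_horizontal hfm (C := C) fun v hv => by
      simpa using hC (v + η * Complex.I) (by simpa) (by simpa)
  have i2 : IntegrableOn (fun v : ℝ => f (v - η * Complex.I)) (Ioi a) :=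
    integrableOn_horizontal' hfm (C := C) fun v hv => by
      simpa using hC (v - η * Complex.I) (by simpa) (by simpa)
  have j1 := intervalIntegral.integral_Ioi_sub_Ioi i1 hab
  have j2 := intervalIntegral.integral_Ioi_sub_Ioi i2 hab
  rw [rectangleIntegral, ← j1, ← j2] at h0
  rw [hairpinIntegral, hairpinIntegral]
  linear_combination h0

/-- A vertical line may be folded around the positive half-line, if `f` is holomorphic off the real
axis to the right of the line and decays on far away horizontal half-lines. The bound `hC`, whose
constant may depend on the height, gives Cauchy's theorem for the half-strips above and below the
hairpin; the uniform bound `hB` makes their outer sides disappear in the limit. -/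
theorem verticalIntegral_eq_hairpinIntegral {f : ℂ → ℂ} (hfm : Measurable f) {ρ e B T₀ : ℝ}
    (he : e < 0)
    (hi : Integrable fun y : ℝ => f (ρ + y * Complex.I))
    (hd : ∀ s : ℂ, ρ ≤ s.re → s.im ≠ 0 → DifferentiableAt ℂ f s)
    (hC : ∀ T : ℝ, ∃ C : ℝ, ∀ s : ℂ, ρ ≤ s.re → 1 ≤ |s.im| → |s.im| ≤ T →
      ‖f s‖ ≤ C * Real.exp (-s.re))
    (hB : ∀ s : ℂ, ρ ≤ s.re → T₀ ≤ |s.im| → ‖f s‖ ≤ B * |s.im| ^ e * Real.exp (-s.re)) :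
    verticalIntegral ρ f = hairpinIntegral ρ 1 f := by
  have ht : Tendsto (fun N : ℕ => ((N : ℝ) + 1)) atTop atTop :=
    tendsto_atTop_add_const_right _ _ tendsto_natCast_atTop_atTop
  have h1 : Tendsto (fun N : ℕ => Complex.I * ∫ y in (-((N : ℝ) + 1))..((N : ℝ) + 1),
      f (ρ + y * Complex.I)) atTop (𝓝 (verticalIntegral ρ f)) :=
    (intervalIntegral_tendsto_integral hi (tendsto_neg_atTop_atBot.comp ht) ht).const_mul _
  have hz : ∀ sg : ℝ, |sg| = 1 → Tendsto (fun N : ℕ =>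
      ∫ v in Ioi ρ, f (v + (sg * ((N : ℝ) + 1) : ℝ) * Complex.I)) atTop (𝓝 0) := by
    intro sg hsg
    have h2 : Tendsto (fun N : ℕ => B * ((N : ℝ) + 1) ^ e * ∫ v in Ioi ρ, Real.exp (-v)) atTop
        (𝓝 0) := by
      have := (tendsto_rpow_neg_atTop (neg_pos.2 he)).comp ht
      simpa using (this.const_mul B).mul_const (∫ v in Ioi ρ, Real.exp (-v))
    refine squeeze_zero_norm' ?_ h2
    filter_upwards [ht.eventually_ge_atTop T₀] with N hN
    have hN0 : (0 : ℝ) ≤ N := N.cast_nonneg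
    rw [← integral_const_mul]
    refine norm_integral_le_of_norm_le ((integrableOn_exp_neg_Ioi ρ).const_mul _) ?_
    refine (ae_restrict_mem measurableSet_Ioi).mono fun v hv => ?_
    have h3 : |sg * ((N : ℝ) + 1)| = N + 1 := by
      rw [abs_mul, hsg, one_mul, abs_of_pos (by linarith)]
    have h4 := hB (v + (sg * ((N : ℝ) + 1) : ℝ) * Complex.I)
      (by simpa using le_of_lt hv) (by simp [-abs_mul, h3, hN])
    simp only [Complex.add_im, Complex.ofReal_im, Complex.mul_im, Complex.ofReal_re, Complex.I_im,
      mul_one, Complex.I_re, mul_zero, add_zero, zero_add, Complex.add_re, Complex.mul_re,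
      sub_self, h3] at h4
    exact h4
  have h5 := ((tendsto_const_nhds (x := hairpinIntegral ρ 1 f)).sub (hz 1 (by simp))).add
    (hz (-1) (by simp))
  rw [sub_zero, add_zero] at h5
  refine tendsto_nhds_unique h1 (h5.congr fun N => ?_)
  have hN0 : (0 : ℝ) ≤ N := N.cast_nonneg
  obtain ⟨C, hC⟩ := hC (N + 1)
  have s1 := integral_boundary_halfStrip_eq_zero hfm (a := ρ) (T₁ := 1) (T₂ := N + 1) (C := C)
    (by linarith) (fun s h1 h2 h3 => hd s h1 (by intro h; linarith))
    (fun s h1 h2 h3 => hC s h1 (by rw [abs_of_pos (by linarith)]; exact h2)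
      (by rw [abs_of_pos (by linarith)]; exact h3))
  have s2 := integral_boundary_halfStrip_eq_zero hfm (a := ρ) (T₁ := -(N + 1)) (T₂ := -1) (C := C)
    (by linarith) (fun s h1 h2 h3 => hd s h1 (by intro h; linarith))
    (fun s h1 h2 h3 => hC s h1 (by rw [abs_of_neg (by linarith)]; linarith)
      (by rw [abs_of_neg (by linarith)]; linarith))
  have hint : ∀ u v : ℝ, IntervalIntegrable (fun y : ℝ => f (ρ + y * Complex.I)) volume u v :=
    fun u v => hi.intervalIntegrable
  have s3 := intervalIntegral.integral_add_adjacent_intervals (hint (-(N + 1)) (-1)) (hint (-1) 1)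
  have s4 := intervalIntegral.integral_add_adjacent_intervals (hint (-(N + 1)) 1) (hint 1 (N + 1))
  rw [← s4, ← s3, hairpinIntegral]
  push_cast at s1 s2 ⊢
  simp only [one_mul, neg_mul, ← sub_eq_add_neg] at s1 s2 ⊢
  linear_combination s1 + s2

theorem integrable_of_norm_le_rpow {g : ℝ → ℂ} (hg : Continuous g) {C e : ℝ} (he : e < -1)
    (h : ∀ y : ℝ, 1 ≤ |y| → ‖g y‖ ≤ C * |y| ^ e) : Integrable g := by
  obtain ⟨D, hD⟩ := (isCompact_Icc (a := (-1 : ℝ)) (b := 1)).exists_bound_of_continuousOn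
    hg.continuousOn
  have hD0 : 0 ≤ D := (norm_nonneg _).trans (hD 0 (by simp))
  have hC0 : 0 ≤ C := by simpa using (norm_nonneg _).trans (h 1 (by simp))
  refine Integrable.mono' ((integrable_one_add_norm (E := ℝ) (μ := volume) (r := -e)
    (by simp; linarith)).const_mul ((C + D) * 2 ^ (-e))) hg.aestronglyMeasurable
    (Eventually.of_forall fun y => ?_)
  rw [neg_neg, Real.norm_eq_abs, mul_assoc]
  have hpos : (0 : ℝ) < 1 + |y| := by positivity
  rcases le_total 1 |y| with hy | hy
  · have hy0 : 0 < |y| := by linarith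
    have h1 : |y| ^ e ≤ 2 ^ (-e) * (1 + |y|) ^ e := by
      calc |y| ^ e ≤ ((1 + |y|) / 2) ^ e :=
            Real.rpow_le_rpow_of_nonpos (by positivity) (by linarith) (by linarith)
        _ = _ := by rw [Real.div_rpow hpos.le two_pos.le, Real.rpow_neg two_pos.le]; ring
    calc ‖g y‖ ≤ C * |y| ^ e := h y hy
      _ ≤ (C + D) * (2 ^ (-e) * (1 + |y|) ^ e) := by gcongr; linarith
  · have h1 : 1 ≤ 2 ^ (-e) * (1 + |y|) ^ e := by
      calc (1 : ℝ) = 2 ^ (-e) * 2 ^ e := by rw [← Real.rpow_add two_pos]; simp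
        _ ≤ _ := by
          refine mul_le_mul_of_nonneg_left ?_ (by positivity)
          exact Real.rpow_le_rpow_of_nonpos hpos (by linarith) (by linarith)
    calc ‖g y‖ ≤ D := hD y (abs_le.1 hy)
      _ ≤ (C + D) * 1 := by linarith
      _ ≤ _ := by gcongr

/-- A vertical line of integration may be moved through a strip of holomorphy. -/
theorem verticalIntegral_eq_of_le {f : ℂ → ℂ} {ρ₁ ρ₂ C : ℝ} (hρ : ρ₁ ≤ ρ₂)
    (hd : ∀ s : ℂ, ρ₁ ≤ s.re → s.re ≤ ρ₂ → DifferentiableAt ℂ f s)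
    (hC : ∀ s : ℂ, ρ₁ ≤ s.re → s.re ≤ ρ₂ → 1 ≤ |s.im| → ‖f s‖ ≤ C * |s.im| ^ (-2 : ℝ)) :
    verticalIntegral ρ₁ f = verticalIntegral ρ₂ f := by
  have ht : Tendsto (fun N : ℕ => ((N : ℝ) + 1)) atTop atTop :=
    tendsto_atTop_add_const_right _ _ tendsto_natCast_atTop_atTop
  have h1 : ∀ ρ, ρ₁ ≤ ρ → ρ ≤ ρ₂ → Tendsto (fun N : ℕ => Complex.I *
      ∫ y in (-((N : ℝ) + 1))..((N : ℝ) + 1),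
      f (ρ + y * Complex.I)) atTop (𝓝 (verticalIntegral ρ f)) := by
    intro ρ ha hb
    refine (intervalIntegral_tendsto_integral (integrable_of_norm_le_rpow (C := C) (e := -2) ?_
      (by norm_num) ?_) (tendsto_neg_atTop_atBot.comp ht) ht).const_mul _
    · refine continuous_iff_continuousAt.2 fun y => ?_
      exact ContinuousAt.comp (f := fun y : ℝ => (ρ + y * Complex.I : ℂ))
        (hd _ (by simpa) (by simpa)).continuousAt (by fun_prop)
    · intro y hy
      simpa using hC (ρ + y * Complex.I) (by simpa) (by simpa) (by simpa)
  have hz : ∀ sg : ℝ, |sg| = 1 → Tendsto (fun N : ℕ =>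
      ∫ v in ρ₁..ρ₂, f (v + (sg * ((N : ℝ) + 1) : ℝ) * Complex.I)) atTop (𝓝 0) := by
    intro sg hsg
    have h2 : Tendsto (fun N : ℕ => C * ((N : ℝ) + 1) ^ (-2 : ℝ) * |ρ₂ - ρ₁|) atTop
        (𝓝 0) := by
      have := (tendsto_rpow_neg_atTop two_pos).comp ht
      simpa using (this.const_mul C).mul_const |ρ₂ - ρ₁|
    refine squeeze_zero_norm (fun N => ?_) h2
    have hN0 : (0 : ℝ) ≤ N := N.cast_nonneg
    refine intervalIntegral.norm_integral_le_of_norm_le_const fun v hv => ?_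
    rw [uIoc_of_le hρ] at hv
    have h3 : |sg * ((N : ℝ) + 1)| = N + 1 := by
      rw [abs_mul, hsg, one_mul, abs_of_pos (by linarith)]
    have h4 := hC (v + (sg * ((N : ℝ) + 1) : ℝ) * Complex.I)
      (by simpa using hv.1.le) (by simpa using hv.2) (by simp [-abs_mul, h3])
    simp only [Complex.add_im, Complex.ofReal_im, Complex.mul_im, Complex.ofReal_re, Complex.I_im,
      mul_one, Complex.I_re, mul_zero, add_zero, zero_add, h3] at h4
    exact h4
  have h5 := ((h1 ρ₂ hρ le_rfl).sub (hz 1 (by simp))).add (hz (-1) (by simp))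
  rw [sub_zero, add_zero] at h5
  refine tendsto_nhds_unique (h1 ρ₁ le_rfl hρ) (h5.congr fun N => ?_)
  have hN0 : (0 : ℝ) ≤ N := N.cast_nonneg
  have s1 := integral_boundary_eq_zero hρ (T₁ := -(N + 1)) (T₂ := N + 1) (by linarith)
    fun s h1 h2 _ _ => hd s h1 h2
  push_cast at s1 ⊢
  simp only [one_mul, neg_mul, ← sub_eq_add_neg] at s1 ⊢
  linear_combination s1

/-! ### The two factors of the integrand -/

/-- The regular part `X^σ ∏_j 1 / Γ(1 + γ_j + σ)` of the integrand of
`G^{1,0}(- ; 0, -γ_1, …, -γ_q | X)`; the remaining factor is `Γ(-σ)`. -/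
noncomputable def regFactor {q : ℕ} (γ : Fin q → ℝ) (X : ℝ) (σ : ℂ) : ℂ :=
  (X : ℂ) ^ σ * ∏ j, (Complex.Gamma (1 + γ j + σ))⁻¹

/-- The integrand `Y^w ∏_j Γ(γ_j - w) / Γ(1 + w)` of `G^{q,0}(- ; γ_q, …, γ_1, 0 | Y)`. -/
noncomputable def gammaFactor {q : ℕ} (γ : Fin q → ℝ) (Y : ℝ) (w : ℂ) : ℂ :=
  (Y : ℂ) ^ w * (Complex.Gamma (1 + w))⁻¹ * ∏ j, Complex.Gamma (γ j - w)

section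
variable {q : ℕ} (γ : Fin q → ℝ)

theorem differentiable_regFactor {X : ℝ} (hX : 0 < X) : Differentiable ℂ (regFactor γ X) := by
  intro σ
  have h0 : (X : ℂ) ≠ 0 := by exact_mod_cast hX.ne'
  refine DifferentiableAt.mul (differentiableAt_id.const_cpow (Or.inl h0)) ?_
  refine DifferentiableAt.fun_finsetProd fun j _ => ?_
  exact (Complex.differentiable_one_div_Gamma (1 + γ j + σ)).comp σ (by fun_prop)

theorem measurable_regFactor {X : ℝ} (hX : 0 < X) : Measurable (regFactor γ X) :=
  (differentiable_regFactor γ hX).continuous.measurable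

theorem measurable_gammaFactor (Y : ℝ) : Measurable (gammaFactor γ Y) := by
  refine Measurable.mul (Measurable.mul (by fun_prop) ?_) ?_
  · exact (measurable_Gamma.comp (measurable_id.const_add 1)).inv
  · exact Finset.measurable_fun_prod _ fun j _ => measurable_Gamma.comp (by fun_prop)

theorem differentiableAt_gammaFactor {Y : ℝ} (hY : 0 < Y) {w : ℂ}
    (hw : ∀ j, DifferentiableAt ℂ Complex.Gamma (γ j - w)) :
    DifferentiableAt ℂ (gammaFactor γ Y) w := by
  have h0 : (Y : ℂ) ≠ 0 := by exact_mod_cast hY.ne'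
  refine DifferentiableAt.mul (DifferentiableAt.mul
    (differentiableAt_id.const_cpow (Or.inl h0)) ?_) ?_
  · exact (Complex.differentiable_one_div_Gamma (1 + w)).comp w (by fun_prop)
  · exact DifferentiableAt.fun_finsetProd fun j _ => (hw j).comp w (by fun_prop)

theorem regFactor_mul {X u : ℝ} (hX : 0 < X) (hu : 0 < u) (σ : ℂ) :
    regFactor γ (X * u) σ = (u : ℂ) ^ σ * regFactor γ X σ := by
  rw [regFactor, regFactor, Complex.ofReal_mul, Complex.mul_cpow_ofReal_nonneg hX.le hu.le]
  ring

theorem gammaFactor_mul {Y u : ℝ} (hY : 0 < Y) (hu : 0 < u) (w : ℂ) :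
    gammaFactor γ (Y * u) w = (u : ℂ) ^ w * gammaFactor γ Y w := by
  rw [gammaFactor, gammaFactor, Complex.ofReal_mul, Complex.mul_cpow_ofReal_nonneg hY.le hu.le]
  ring

end

theorem exists_prod_le {q : ℕ} {α : Type*} {P : α → Prop} {f : Fin q → α → ℂ}
    (h : ∀ j, ∃ C : ℝ, 0 < C ∧ ∀ z, P z → ‖f j z‖ ≤ C) :
    ∃ C : ℝ, 0 < C ∧ ∀ z, P z → ‖∏ j, f j z‖ ≤ C := by
  choose C hC0 hC using h
  refine ⟨∏ j, C j, Finset.prod_pos fun j _ => hC0 j, fun z hz => ?_⟩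
  rw [norm_prod]
  exact Finset.prod_le_prod (fun j _ => norm_nonneg _) fun j _ => hC j z hz

/-- The decay of `1 / Γ(1 + γ_0 + σ)` outweighs the factor `X^σ`. -/
theorem exists_norm_regFactor_le {q : ℕ} (γ : Fin (q + 1) → ℝ) {X : ℝ} (hX : 0 < X) (a η : ℝ) :
    ∃ C : ℝ, 0 < C ∧ ∀ σ : ℂ, a ≤ σ.re → |σ.im| ≤ η →
      ‖regFactor γ X σ‖ ≤ C * Real.exp (-σ.re) := by
  have hR : 0 < X * Real.exp 1 := by positivity
  obtain ⟨C₁, hC₁, h₁⟩ := exists_norm_inv_Gamma_le (1 + γ 0 + a) η hR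
  obtain ⟨C₂, hC₂, h₂⟩ := exists_prod_le (P := fun σ : ℂ => a ≤ σ.re ∧ |σ.im| ≤ η)
    (f := fun (j : Fin q) σ => (Complex.Gamma (1 + γ j.succ + σ))⁻¹) (by
      intro j
      obtain ⟨C, hC, h⟩ := exists_norm_inv_Gamma_le (1 + γ j.succ + a) η one_pos
      refine ⟨C, hC, fun σ hσ => ?_⟩
      simpa using h (1 + γ j.succ + σ) (by simpa using hσ.1) (by simpa using hσ.2))
  refine ⟨C₁ * (X * Real.exp 1) ^ (-(1 + γ 0)) * C₂, by positivity, fun σ h1 h2 => ?_⟩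
  rw [regFactor, Fin.prod_univ_succ, norm_mul, norm_mul, Complex.norm_cpow_eq_rpow_re_of_pos hX]
  have e1 := h₁ (1 + γ 0 + σ) (by simpa using h1) (by simpa using h2)
  have e2 : (1 + γ 0 + σ : ℂ).re = 1 + γ 0 + σ.re := by simp
  have e3 : X ^ σ.re * (X * Real.exp 1) ^ (-(1 + γ 0 + σ.re)) =
      (X * Real.exp 1) ^ (-(1 + γ 0)) * Real.exp (-σ.re) := by
    rw [neg_add, Real.rpow_add hR, Real.mul_rpow (y := Real.exp 1) (z := -σ.re) hX.le
      (Real.exp_pos _).le, Real.exp_one_rpow, Real.rpow_neg hX.le]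
    have := Real.rpow_pos_of_pos hX σ.re
    field_simp
  rw [e2] at e1
  calc X ^ σ.re * (‖(Complex.Gamma (1 + γ 0 + σ))⁻¹‖ *
        ‖∏ j : Fin q, (Complex.Gamma (1 + γ j.succ + σ))⁻¹‖)
      ≤ X ^ σ.re * ((C₁ * (X * Real.exp 1) ^ (-(1 + γ 0 + σ.re))) * C₂) := by
        gcongr
        exact h₂ σ ⟨h1, h2⟩
    _ = C₁ * C₂ * (X ^ σ.re * (X * Real.exp 1) ^ (-(1 + γ 0 + σ.re))) := by ring
    _ = _ := by rw [e3]; ring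

/-- At bounded height the decay of `1 / Γ(1 + w)` outweighs the factor `Y^w`. -/
theorem exists_norm_gammaFactor_le_exp {q : ℕ} (γ : Fin q → ℝ) {Y : ℝ} (hY : 0 < Y) (ρ T : ℝ) :
    ∃ C : ℝ, 0 < C ∧ ∀ w : ℂ, ρ ≤ w.re → 1 ≤ |w.im| → |w.im| ≤ T →
      ‖gammaFactor γ Y w‖ ≤ C * Real.exp (-w.re) := by
  have hR : 0 < Y * Real.exp 1 := by positivity
  obtain ⟨C₁, hC₁, h₁⟩ := exists_norm_inv_Gamma_le (1 + ρ) T hR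
  obtain ⟨C₂, hC₂, h₂⟩ := exists_prod_le
    (P := fun w : ℂ => ρ ≤ w.re ∧ 1 ≤ |w.im| ∧ |w.im| ≤ T)
    (f := fun (j : Fin q) w => Complex.Gamma (γ j - w)) (by
      intro j
      obtain ⟨C, hC, h⟩ := exists_norm_Gamma_le (γ j - ρ) T one_pos
      refine ⟨C, hC, fun w hw => ?_⟩
      exact h (γ j - w) (by have := hw.1; simp; linarith) (by simpa using hw.2.1)
        (by simpa using hw.2.2))
  refine ⟨C₁ * (Y * Real.exp 1) ^ (-1 : ℝ) * C₂, by positivity, fun w h1 h2 h3 => ?_⟩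
  rw [gammaFactor, norm_mul, norm_mul, Complex.norm_cpow_eq_rpow_re_of_pos hY]
  have e1 := h₁ (1 + w) (by simpa using h1) (by simpa using h3)
  have e2 : (1 + w : ℂ).re = 1 + w.re := by simp
  have e3 : Y ^ w.re * (Y * Real.exp 1) ^ (-(1 + w.re)) =
      (Y * Real.exp 1) ^ (-1 : ℝ) * Real.exp (-w.re) := by
    rw [neg_add, Real.rpow_add hR, Real.mul_rpow (y := Real.exp 1) (z := -w.re) hY.le
      (Real.exp_pos _).le, Real.exp_one_rpow, Real.rpow_neg (x := Y) hY.le w.re]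
    have := Real.rpow_pos_of_pos hY w.re
    field_simp
  rw [e2] at e1
  calc Y ^ w.re * ‖(Complex.Gamma (1 + w))⁻¹‖ * ‖∏ j : Fin q, Complex.Gamma (γ j - w)‖
      ≤ Y ^ w.re * (C₁ * (Y * Real.exp 1) ^ (-(1 + w.re))) * C₂ := by
        gcongr
        exact h₂ w ⟨h1, h2, h3⟩
    _ = C₁ * C₂ * (Y ^ w.re * (Y * Real.exp 1) ^ (-(1 + w.re))) := by ring
    _ = _ := by rw [e3]; ring

theorem exists_norm_Gamma_le_of_one_le_im (σ₁ : ℝ) : ∃ C : ℝ, 0 < C ∧ ∀ z : ℂ, z.re ≤ σ₁ →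
    1 ≤ |z.im| → ‖Complex.Gamma z‖ ≤ C := by
  obtain ⟨C, hC, h⟩ := exists_norm_Gamma_le_of_re_le
  refine ⟨max C (max (Real.Gamma (1 / 2)) (Real.Gamma σ₁)), by positivity, fun z h1 h2 => ?_⟩
  rcases le_or_gt z.re (1 / 2) with h3 | h3
  · refine le_trans ?_ (le_max_left _ _)
    refine (h z (by linarith) h2).trans ?_
    have h4 : |z.im| ^ (z.re - 1 / 2) ≤ 1 := Real.rpow_le_one_of_one_le_of_nonpos h2 (by linarith)
    have h5 : Real.exp (-(Real.pi / 2 * |z.im|)) ≤ 1 := by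
      rw [Real.exp_le_one_iff, neg_nonpos]; positivity
    calc C * |z.im| ^ (z.re - 1 / 2) * Real.exp (-(Real.pi / 2 * |z.im|)) ≤ C * 1 * 1 := by gcongr
      _ = C := by ring
  · refine le_trans ?_ (le_max_right _ _)
    refine (norm_Gamma_le (by linarith)).trans ?_
    exact Real.convexOn_Gamma.le_max_of_mem_Icc (by simp) (by simp; linarith) ⟨h3.le, h1⟩

theorem norm_sin_le (z : ℂ) : ‖Complex.sin z‖ ≤ Real.exp |z.im| := by
  have h1 : ‖Complex.exp (-z * Complex.I)‖ ≤ Real.exp |z.im| := by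
    rw [Complex.norm_exp]; simpa using le_abs_self _
  have h2 : ‖Complex.exp (z * Complex.I)‖ ≤ Real.exp |z.im| := by
    rw [Complex.norm_exp]; simpa using neg_le_abs _
  rw [Complex.sin, norm_div, norm_mul, Complex.norm_I, mul_one, Complex.norm_ofNat]
  have := norm_sub_le (Complex.exp (-z * Complex.I)) (Complex.exp (z * Complex.I))
  linarith

/-- Polynomial control of `gammaFactor` in a half-plane. The factors `Γ(γ_0 - w)` and
`1 / Γ(1 + w) = -sin(πw) Γ(-w) / π` are estimated by Stirling's bound, where the exponential decay
of the two Gamma functions exactly compensates the growth of the sine. -/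
theorem exists_norm_gammaFactor_le {q : ℕ} (γ : Fin (q + 1) → ℝ) {Y ρ : ℝ} (hY : 0 < Y)
    (hγ : γ 0 ≤ 1 / 2) (hρ : -1 ≤ ρ) :
    ∃ C : ℝ, 0 < C ∧ ∀ w : ℂ, ρ ≤ w.re → 1 ≤ |w.im| →
      ‖gammaFactor γ Y w‖ ≤ C * Y ^ w.re * |w.im| ^ (γ 0 - 2 * w.re - 1) := by
  obtain ⟨C₁, hC₁, h₁⟩ := exists_norm_Gamma_le_of_re_le
  obtain ⟨C₂, hC₂, h₂⟩ := exists_prod_le (P := fun w : ℂ => ρ ≤ w.re ∧ 1 ≤ |w.im|)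
    (f := fun (j : Fin q) w => Complex.Gamma (γ j.succ - w)) (by
      intro j
      obtain ⟨C, hC, h⟩ := exists_norm_Gamma_le_of_one_le_im (γ j.succ - ρ)
      refine ⟨C, hC, fun w hw => ?_⟩
      exact h (γ j.succ - w) (by have := hw.1; simp; linarith) (by simpa using hw.2))
  refine ⟨C₁ * C₁ * C₂, by positivity, fun w h1 h2 => ?_⟩
  have him : 0 < |w.im| := by linarith
  have him0 : w.im ≠ 0 := abs_pos.1 him
  have hinv : ‖(Complex.Gamma (1 + w))⁻¹‖ ≤
      Real.exp (Real.pi * |w.im|) * ‖Complex.Gamma (-w)‖ := by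
    have h3 := Complex.Gamma_mul_Gamma_one_sub (-w)
    have h4 : Complex.Gamma (1 + w) ≠ 0 := Complex.Gamma_ne_zero fun m h => him0 (by
      simpa using congrArg Complex.im h)
    have h5 : Complex.Gamma (-w) ≠ 0 := Complex.Gamma_ne_zero fun m h => him0 (by
      simpa using congrArg Complex.im h)
    rw [sub_neg_eq_add] at h3
    have h6 : Complex.sin (Real.pi * -w) ≠ 0 := fun h0 => by
      rw [h0, div_zero] at h3
      exact mul_ne_zero h5 h4 h3
    have h7 : (Complex.Gamma (1 + w))⁻¹ =
        Complex.sin (Real.pi * -w) * Complex.Gamma (-w) / Real.pi := by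
      have hpi : (Real.pi : ℂ) ≠ 0 := by exact_mod_cast Real.pi_ne_zero
      rw [eq_div_iff h6] at h3
      rw [eq_div_iff hpi, inv_mul_eq_iff_eq_mul₀ h4]
      linear_combination -h3
    rw [h7, norm_div, norm_mul, Complex.norm_real, Real.norm_of_nonneg Real.pi_pos.le]
    have h8 := norm_sin_le (Real.pi * -w)
    have h9 : |((Real.pi : ℂ) * -w).im| = Real.pi * |w.im| := by
      simp [abs_mul, abs_of_pos Real.pi_pos]
    rw [h9] at h8
    calc ‖Complex.sin (Real.pi * -w)‖ * ‖Complex.Gamma (-w)‖ / Real.pi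
        ≤ ‖Complex.sin (Real.pi * -w)‖ * ‖Complex.Gamma (-w)‖ :=
          div_le_self (by positivity) (by linarith [Real.pi_gt_three])
      _ ≤ _ := by gcongr
  have hn := h₁ (-w) (by simp; linarith) (by simpa using h2)
  have hg := h₁ (γ 0 - w) (by simp; linarith) (by simpa using h2)
  simp only [Complex.neg_re, Complex.neg_im, abs_neg, Complex.sub_re, Complex.ofReal_re,
    Complex.sub_im, Complex.ofReal_im, zero_sub] at hn hg
  rw [gammaFactor, Fin.prod_univ_succ, norm_mul, norm_mul, norm_mul,
    Complex.norm_cpow_eq_rpow_re_of_pos hY]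
  calc Y ^ w.re * ‖(Complex.Gamma (1 + w))⁻¹‖ * (‖Complex.Gamma (γ 0 - w)‖ *
        ‖∏ j : Fin q, Complex.Gamma (γ j.succ - w)‖)
      ≤ Y ^ w.re * (Real.exp (Real.pi * |w.im|) *
        (C₁ * |w.im| ^ (-w.re - 1 / 2) * Real.exp (-(Real.pi / 2 * |w.im|)))) *
        ((C₁ * |w.im| ^ (γ 0 - w.re - 1 / 2) * Real.exp (-(Real.pi / 2 * |w.im|))) * C₂) := by
        have := hinv.trans (mul_le_mul_of_nonneg_left hn (Real.exp_pos _).le)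
        gcongr
        exact h₂ w ⟨h1, h2⟩
    _ = C₁ * C₁ * C₂ * Y ^ w.re * (|w.im| ^ (-w.re - 1 / 2) * |w.im| ^ (γ 0 - w.re - 1 / 2)) *
        (Real.exp (Real.pi * |w.im|) * (Real.exp (-(Real.pi / 2 * |w.im|)) *
          Real.exp (-(Real.pi / 2 * |w.im|)))) := by ring
    _ = _ := by
      rw [← Real.rpow_add him, ← Real.exp_add, ← Real.exp_add]
      ring_nf
      simp

/-! ### The Meijer G-kernel as a series -/

theorem integral_pow_mul_cpow {w : ℂ} (hw : -1 < w.re) (k : ℕ) :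
    ∫ u in Ioc (0 : ℝ) 1, (u : ℂ) ^ k * (u : ℂ) ^ w = (k + 1 + w)⁻¹ := by
  have hk : (0 : ℝ) ≤ k := k.cast_nonneg
  have h1 : ∫ u in Ioc (0 : ℝ) 1, (u : ℂ) ^ k * (u : ℂ) ^ w
      = ∫ u in (0 : ℝ)..1, (u : ℂ) ^ (k + w) := by
    rw [intervalIntegral.integral_of_le zero_le_one]
    refine setIntegral_congr_fun measurableSet_Ioc fun u hu => ?_
    have : (u : ℂ) ≠ 0 := by exact_mod_cast hu.1.ne'
    rw [Complex.cpow_add _ _ this, Complex.cpow_natCast]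
  have h2 : (k + w : ℂ) + 1 ≠ 0 := fun h => by
    have := congrArg Complex.re h
    simp at this
    linarith
  rw [h1, integral_cpow (Or.inl (by simp; linarith)), Complex.ofReal_one, Complex.one_cpow,
    Complex.ofReal_zero, Complex.zero_cpow h2, sub_zero, one_div]
  congr 1
  ring

theorem integrable_cpow_mul_prod {G : ℝ → ℂ} {w : ℝ → ℂ} (hw : Measurable w) {S : Set ℝ}
    (hS : MeasurableSet S) {ρ : ℝ} (hρ : -1 < ρ) (hwρ : ∀ p ∈ S, ρ ≤ (w p).re)
    (hG : IntegrableOn G S) (k : ℕ) :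
    Integrable (fun z : ℝ × ℝ => (z.1 : ℂ) ^ k * ((z.1 : ℂ) ^ w z.2 * G z.2))
      ((volume.restrict (Ioc 0 1)).prod (volume.restrict S)) := by
  have h1 : IntegrableOn (fun u : ℝ => u ^ ρ) (Ioc 0 1) :=
    (intervalIntegrable_iff_integrableOn_Ioc_of_le zero_le_one).1
      (intervalIntegral.intervalIntegrable_rpow' hρ)
  refine (h1.mul_prod hG.norm).mono' ?_ ?_
  · refine AEStronglyMeasurable.mul (by fun_prop) (AEStronglyMeasurable.mul ?_ ?_)
    · refine Measurable.aestronglyMeasurable ?_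
      exact (Complex.measurable_ofReal.comp measurable_fst).pow (hw.comp measurable_snd)
    · exact hG.aestronglyMeasurable.comp_snd
  · rw [Measure.prod_restrict]
    refine (ae_restrict_mem (measurableSet_Ioc.prod hS)).mono fun z hz => ?_
    have h0 : 0 < z.1 := hz.1.1
    rw [norm_mul, norm_mul, Complex.norm_cpow_eq_rpow_re_of_pos h0, norm_pow, Complex.norm_real,
      Real.norm_of_nonneg h0.le]
    calc z.1 ^ k * (z.1 ^ (w z.2).re * ‖G z.2‖) ≤ 1 * (z.1 ^ ρ * ‖G z.2‖) := by
          gcongr ?_ * (?_ * _)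
          · exact pow_le_one₀ h0.le hz.1.2
          · exact Real.rpow_le_rpow_of_exponent_ge h0 hz.1.2 (hwρ _ hz.2)
      _ = _ := one_mul _

theorem integrable_pow_mul_integral_cpow {G : ℝ → ℂ} {w : ℝ → ℂ} (hw : Measurable w) {S : Set ℝ}
    (hS : MeasurableSet S) {ρ : ℝ} (hρ : -1 < ρ) (hwρ : ∀ p ∈ S, ρ ≤ (w p).re)
    (hG : IntegrableOn G S) (k : ℕ) :
    IntegrableOn (fun u : ℝ => (u : ℂ) ^ k * ∫ p in S, (u : ℂ) ^ w p * G p) (Ioc 0 1) := by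
  have := (integrable_cpow_mul_prod hw hS hρ hwρ hG k).integral_prod_left
  simp only [integral_const_mul] at this
  exact this

theorem integral_pow_mul_integral_cpow {G : ℝ → ℂ} {w : ℝ → ℂ} (hw : Measurable w) {S : Set ℝ}
    (hS : MeasurableSet S) {ρ : ℝ} (hρ : -1 < ρ) (hwρ : ∀ p ∈ S, ρ ≤ (w p).re)
    (hG : IntegrableOn G S) (k : ℕ) :
    ∫ u in Ioc (0 : ℝ) 1, (u : ℂ) ^ k * ∫ p in S, (u : ℂ) ^ w p * G p =
      ∫ p in S, G p * (k + 1 + w p)⁻¹ := by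
  simp only [← integral_const_mul]
  rw [integral_integral_swap (integrable_cpow_mul_prod hw hS hρ hwρ hG k)]
  refine setIntegral_congr_fun hS fun p hp => ?_
  rw [← integral_pow_mul_cpow (hρ.trans_le (hwρ p hp)) k, mul_comm (G p), ← integral_mul_const]
  congr 1
  ext u
  ring

/-- Integration of `u^{k + w}` over `(0, 1)` under a hairpin integral. -/
theorem integral_pow_mul_hairpinIntegral {G : ℂ → ℂ} {ρ η : ℝ} (hρ : -1 < ρ) (hη : 0 ≤ η)
    (h1 : IntegrableOn (fun y : ℝ => G (ρ + y * Complex.I)) (Ioc (-η) η))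
    (h2 : IntegrableOn (fun v : ℝ => G (v + η * Complex.I)) (Ioi ρ))
    (h3 : IntegrableOn (fun v : ℝ => G (v - η * Complex.I)) (Ioi ρ)) (k : ℕ) :
    IntegrableOn (fun u : ℝ => (u : ℂ) ^ k * hairpinIntegral ρ η fun w => (u : ℂ) ^ w * G w)
        (Ioc 0 1) ∧
      ∫ u in Ioc (0 : ℝ) 1, (u : ℂ) ^ k * hairpinIntegral ρ η (fun w => (u : ℂ) ^ w * G w) =
        hairpinIntegral ρ η fun w => G w * (k + 1 + w)⁻¹ := by
  have w1 : Measurable fun y : ℝ => (ρ + y * Complex.I : ℂ) := by fun_prop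
  have w2 : Measurable fun v : ℝ => (v + η * Complex.I : ℂ) := by fun_prop
  have w3 : Measurable fun v : ℝ => (v - η * Complex.I : ℂ) := by fun_prop
  have r1 : ∀ y ∈ Ioc (-η) η, ρ ≤ (ρ + y * Complex.I : ℂ).re := by intro y _; simp
  have r2 : ∀ v ∈ Ioi ρ, ρ ≤ (v + η * Complex.I : ℂ).re := by
    intro v hv; simpa using le_of_lt hv
  have r3 : ∀ v ∈ Ioi ρ, ρ ≤ (v - η * Complex.I : ℂ).re := by
    intro v hv; simpa using le_of_lt hv
  have i1 := (integrable_pow_mul_integral_cpow w1 measurableSet_Ioc hρ r1 h1 k).const_mul Complex.I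
  have i2 := integrable_pow_mul_integral_cpow w2 measurableSet_Ioi hρ r2 h2 k
  have i3 := integrable_pow_mul_integral_cpow w3 measurableSet_Ioi hρ r3 h3 k
  have e : ∀ u : ℝ, (u : ℂ) ^ k * hairpinIntegral ρ η (fun w => (u : ℂ) ^ w * G w) =
      Complex.I * ((u : ℂ) ^ k * ∫ y in Ioc (-η) η, (u : ℂ) ^ (ρ + y * Complex.I : ℂ) *
        G (ρ + y * Complex.I)) + ((u : ℂ) ^ k * ∫ v in Ioi ρ, (u : ℂ) ^ (v + η * Complex.I : ℂ) *
        G (v + η * Complex.I)) - ((u : ℂ) ^ k * ∫ v in Ioi ρ, (u : ℂ) ^ (v - η * Complex.I : ℂ) *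
        G (v - η * Complex.I)) := by
    intro u
    rw [hairpinIntegral, intervalIntegral.integral_of_le (neg_le_self hη)]
    ring
  simp only [e]
  refine ⟨(i1.add i2).sub i3, ?_⟩
  rw [integral_sub ?_ i3, integral_add i1 i2, integral_const_mul,
    integral_pow_mul_integral_cpow w1 measurableSet_Ioc hρ r1 h1,
    integral_pow_mul_integral_cpow w2 measurableSet_Ioi hρ r2 h2,
    integral_pow_mul_integral_cpow w3 measurableSet_Ioi hρ r3 h3, hairpinIntegral,
    intervalIntegral.integral_of_le (neg_le_self hη)]
  exact i1.add i2

/-- The coefficients of the power series of `G^{1,0}(- ; 0, -γ_1, …, -γ_q | X)`. -/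
noncomputable def residueCoeff {q : ℕ} (γ : Fin q → ℝ) (X : ℝ) (k : ℕ) : ℂ :=
  (-1) ^ k / k.factorial * regFactor γ X k

theorem exists_norm_residueCoeff_le {q : ℕ} (γ : Fin (q + 1) → ℝ) {X : ℝ} (hX : 0 < X) :
    ∃ C : ℝ, 0 < C ∧ ∀ k : ℕ, ‖residueCoeff γ X k‖ ≤ C * Real.exp (-k) := by
  obtain ⟨C, hC, h⟩ := exists_norm_regFactor_le γ hX 0 0
  refine ⟨C, hC, fun k => ?_⟩
  have h1 := h k (by simp) (by simp)
  rw [Complex.natCast_re] at h1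
  rw [residueCoeff, norm_mul, norm_div, norm_pow, norm_neg, norm_one, one_pow,
    Complex.norm_natCast]
  have h2 : (1 : ℝ) ≤ k.factorial := by exact_mod_cast Nat.factorial_pos k
  exact le_trans (mul_le_of_le_one_left (norm_nonneg _) ((div_le_one (by linarith)).2 h2)) h1

theorem summable_norm_residueCoeff {q : ℕ} (γ : Fin (q + 1) → ℝ) {X : ℝ} (hX : 0 < X) :
    Summable fun k => ‖residueCoeff γ X k‖ := by
  obtain ⟨C, -, h⟩ := exists_norm_residueCoeff_le γ hX
  exact Summable.of_nonneg_of_le (fun _ => norm_nonneg _) h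
    (Real.summable_exp_neg_nat.mul_left C)

theorem residueCoeff_mul {q : ℕ} (γ : Fin q → ℝ) {X u : ℝ} (hX : 0 < X) (hu : 0 < u) (k : ℕ) :
    residueCoeff γ (X * u) k = residueCoeff γ X k * (u : ℂ) ^ k := by
  rw [residueCoeff, residueCoeff, regFactor_mul γ hX hu, Complex.cpow_natCast]
  ring

/-- `∫ Γ(-σ) regFactor(σ) / (σ + 1 + w) dσ` over a hairpin to the right of `-1 - w`, as a sum of
residues. -/
theorem hasSum_hairpinIntegral_div {q : ℕ} (γ : Fin (q + 1) → ℝ) {X : ℝ} (hX : 0 < X) {a η : ℝ}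
    (ha : a < 0) (hη : 0 < η) {w : ℂ} (hw : -1 - w.re < a) :
    HasSum (fun k : ℕ => 2 * Real.pi * Complex.I * (residueCoeff γ X k * (k + 1 + w)⁻¹))
      (hairpinIntegral a η fun σ =>
        Complex.Gamma (-σ) * (regFactor γ X σ * (σ + 1 + w)⁻¹)) := by
  obtain ⟨C, hC, h⟩ := exists_norm_regFactor_le γ hX a η
  have hd : 0 < a + 1 + w.re := by linarith
  have hle : ∀ s : ℂ, a ≤ s.re → a + 1 + w.re ≤ ‖s + 1 + w‖ := by
    intro s hs
    refine le_trans ?_ (Complex.re_le_norm _)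
    simpa using hs
  have hne : ∀ s : ℂ, a ≤ s.re → s + 1 + w ≠ 0 := fun s hs =>
    norm_pos_iff.1 (hd.trans_le (hle s hs))
  have := hasSum_hairpinIntegral_Gamma_neg (g := fun σ => regFactor γ X σ * (σ + 1 + w)⁻¹)
    ((measurable_regFactor γ hX).mul (by fun_prop)) (C := C * (a + 1 + w.re)⁻¹) ha hη ?_ ?_
  · convert this using 3 with k
    rw [residueCoeff]
    ring
  · intro s h1 h2
    exact (differentiable_regFactor γ hX s).mul (DifferentiableAt.inv (by fun_prop) (hne s h1))
  · intro s h1 h2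
    rw [norm_mul, norm_inv]
    calc ‖regFactor γ X s‖ * ‖s + 1 + w‖⁻¹ ≤ C * Real.exp (-s.re) * (a + 1 + w.re)⁻¹ := by
          gcongr
          · exact h s h1 h2
          · exact hle s h1
      _ = _ := by ring

/-- The power series of `G^{1,0}` at `X`. -/
theorem hasSum_meijerG_one {q : ℕ} (μ : Fin (q + 1 + 1) → ℝ) (h0 : μ 0 = 0) {X : ℝ} (hX : 0 < X) :
    HasSum (fun k : ℕ => residueCoeff (fun j => μ j.succ) X k) (meijerG 1 (fun j => -μ j) X) := by
  have ha : -1 - ∑ j, |(-μ j)| < 0 := by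
    have : 0 ≤ ∑ j, |(-μ j)| := Finset.sum_nonneg fun _ _ => abs_nonneg _
    linarith
  obtain ⟨C, hC, h⟩ := exists_norm_regFactor_le (fun j => μ j.succ) hX (-1 - ∑ j, |(-μ j)|) 1
  have h1 := hasSum_hairpinIntegral_Gamma_neg (measurable_regFactor (fun j => μ j.succ) hX)
    ha one_pos (fun s _ _ => differentiable_regFactor _ hX s) h
  have h2 := h1.mul_left (1 / (2 * Real.pi * Complex.I))
  have hpi : (Real.pi : ℂ) ≠ 0 := by exact_mod_cast Real.pi_ne_zero
  have h3 : meijerG 1 (fun j => -μ j) X = 1 / (2 * Real.pi * Complex.I) *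
      hairpinIntegral (-1 - ∑ j, |(-μ j)|) 1 fun s =>
        Complex.Gamma (-s) * regFactor (fun j => μ j.succ) X s := by
    rw [meijerG]
    congr 2
    ext s
    rw [Fin.prod_univ_succ]
    simp [h0, regFactor]
    ring
  rw [h3]
  refine h2.congr_fun ?_
  intro k
  have := Complex.I_ne_zero
  rw [residueCoeff]
  field_simp

theorem gammaFactor_eq_meijer_integrand {q : ℕ} (μ : Fin (q + 1) → ℝ) (h0 : μ 0 = 0) (Y : ℝ)
    (w : ℂ) :
    (∏ j : Fin (q + 1), if (j : ℕ) < q then Complex.Gamma ((fun j => μ j.rev) j - w)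
      else (Complex.Gamma (1 - (fun j => μ j.rev) j + w))⁻¹) * (Y : ℂ) ^ w =
      gammaFactor (fun j => μ j.succ) Y w := by
  rw [Fin.prod_univ_castSucc, gammaFactor]
  have h1 : ∏ j : Fin q, Complex.Gamma (μ j.succ - w) =
      ∏ j : Fin q, Complex.Gamma (μ j.rev.succ - w) :=
    (Equiv.prod_comp Fin.revPerm fun j => Complex.Gamma (μ j.succ - w)).symm
  rw [h1]
  simp [h0, Fin.rev_castSucc]
  ring

/-! ### The limiting kernel as a Meijer G-kernel -/

theorem norm_inv_natCast_add_one_add_le {w : ℂ} (hw : -1 < w.re) (k : ℕ) :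
    ‖(k + 1 + w)⁻¹‖ ≤ ‖(1 + w)⁻¹‖ := by
  have hk : (0 : ℝ) ≤ k := k.cast_nonneg
  have h0 : (1 + w : ℂ) ≠ 0 := fun h => by
    have := congrArg Complex.re h
    simp at this
    linarith
  rw [norm_inv, norm_inv]
  refine inv_anti₀ (norm_pos_iff.2 h0) ?_
  rw [Complex.norm_def, Complex.norm_def, Complex.normSq_apply, Complex.normSq_apply]
  refine Real.sqrt_le_sqrt ?_
  simp
  nlinarith

theorem norm_inv_natCast_add_one_add_le_inv_abs_im {w : ℂ} (hw : 1 ≤ |w.im|) (k : ℕ) :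
    ‖(k + 1 + w)⁻¹‖ ≤ |w.im|⁻¹ := by
  rw [norm_inv]
  refine inv_anti₀ (by linarith) ?_
  simpa using Complex.abs_im_le_norm (k + 1 + w)

theorem natCast_add_one_add_ne_zero {w : ℂ} (hw : -1 < w.re) (k : ℕ) : (k + 1 + w : ℂ) ≠ 0 := by
  intro h
  have hk : (0 : ℝ) ≤ k := k.cast_nonneg
  have := congrArg Complex.re h
  simp at this
  linarith

theorem differentiableAt_gammaFactor_of_im_ne_zero {q : ℕ} (γ : Fin q → ℝ) {Y : ℝ} (hY : 0 < Y)
    {w : ℂ} (hw : w.im ≠ 0) : DifferentiableAt ℂ (gammaFactor γ Y) w :=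
  differentiableAt_gammaFactor γ hY fun j => differentiableAt_Gamma_of_im_ne_zero (by simpa)

theorem differentiableAt_gammaFactor_of_re_lt {q : ℕ} {γ : Fin q → ℝ} {δ : ℝ} (hγ : ∀ j, δ ≤ γ j)
    {Y : ℝ} (hY : 0 < Y) {w : ℂ} (hw : w.re < δ) : DifferentiableAt ℂ (gammaFactor γ Y) w :=
  differentiableAt_gammaFactor γ hY fun j => differentiableAt_Gamma_of_re_pos (by
    have := hγ j
    simp; linarith)

theorem continuous_vertical {f : ℂ → ℂ} {ρ : ℝ} (hf : ∀ w : ℂ, w.re = ρ → ContinuousAt f w) :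
    Continuous fun y : ℝ => f (ρ + y * Complex.I) :=
  continuous_iff_continuousAt.2 fun y =>
    ContinuousAt.comp (f := fun y : ℝ => (ρ + y * Complex.I : ℂ)) (hf _ (by simp)) (by fun_prop)

section
variable {q : ℕ} {γ : Fin (q + 1) → ℝ} {δ ρ : ℝ}

/-- Absolute convergence on the line `Re w = ρ`. The exponent `γ_0 - 2ρ - 2` of the decay is
less than `-1` exactly when `δ - 1/4 < ρ`. -/
theorem integrable_gammaFactor_mul_inv (hδ : -1 / 2 ≤ δ) (hδ' : δ ≤ 0) (hγ0 : γ 0 = 2 * δ + 1 / 2)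
    (hγ : ∀ j, δ ≤ γ j) (hρ : δ - 1 / 4 < ρ) (hρ' : ρ < δ) {Y : ℝ} (hY : 0 < Y) (k : ℕ) :
    Integrable fun y : ℝ => gammaFactor γ Y (ρ + y * Complex.I) *
      (k + 1 + (ρ + y * Complex.I))⁻¹ := by
  obtain ⟨C, hC, h⟩ := exists_norm_gammaFactor_le γ (ρ := ρ) hY (by linarith) (by linarith)
  refine integrable_of_norm_le_rpow (C := C * Y ^ ρ) (e := γ 0 - 2 * ρ - 1 - 1)
    (continuous_vertical (f := fun w => gammaFactor γ Y w * (k + 1 + w)⁻¹) fun w hw => ?_)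
    (by linarith) fun y hy => ?_
  · refine (differentiableAt_gammaFactor_of_re_lt hγ hY (hw.trans_lt hρ')).continuousAt.mul
      (ContinuousAt.inv₀ (by fun_prop) (natCast_add_one_add_ne_zero (by linarith) k))
  · have hy0 : 0 < |y| := by linarith
    have h1 := h (ρ + y * Complex.I) (by simp) (by simpa)
    have h2 := norm_inv_natCast_add_one_add_le_inv_abs_im (w := ρ + y * Complex.I) (by simpa) k
    simp only [Complex.add_re, Complex.ofReal_re, Complex.mul_re, Complex.I_re, mul_zero,
      Complex.ofReal_im, Complex.I_im, mul_one, sub_self, add_zero, Complex.add_im, Complex.mul_im,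
      zero_add] at h1 h2
    rw [norm_mul, Real.rpow_sub_one hy0.ne', div_eq_mul_inv, ← mul_assoc]
    gcongr

/-- The line `Re w = ρ` may be folded around the positive half-line. Far from the real axis
`gammaFactor` is of order `|Im w|^(γ_0 - 2 Re w - 1) Y^(Re w)`, so that the horizontal sides of a
hairpin of growing width contribute nothing. -/
theorem verticalIntegral_gammaFactor_eq_hairpinIntegral (hδ : -1 / 2 ≤ δ) (hδ' : δ ≤ 0)
    (hγ0 : γ 0 = 2 * δ + 1 / 2) (hγ : ∀ j, δ ≤ γ j) (hρ : δ - 1 / 4 < ρ) (hρ' : ρ < δ) {Y : ℝ}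
    (hY : 0 < Y) (k : ℕ) :
    verticalIntegral ρ (fun w => gammaFactor γ Y w * (k + 1 + w)⁻¹) =
      hairpinIntegral ρ 1 fun w => gammaFactor γ Y w * (k + 1 + w)⁻¹ := by
  obtain ⟨C, hC, h⟩ := exists_norm_gammaFactor_le γ (ρ := ρ) hY (by linarith) (by linarith)
  refine verticalIntegral_eq_hairpinIntegral (e := γ 0 - 2 * ρ - 1 - 1)
    (B := C * Y ^ ρ * Real.exp ρ) (T₀ := 1 + Real.exp 1 * Y)
    ((measurable_gammaFactor γ Y).mul (by fun_prop)) (by linarith)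
    (integrable_gammaFactor_mul_inv hδ hδ' hγ0 hγ hρ hρ' hY k) ?_ ?_ ?_
  · intro s h1 h2
    refine (differentiableAt_gammaFactor_of_im_ne_zero γ hY h2).mul
      (DifferentiableAt.inv (by fun_prop) fun h0 => h2 ?_)
    simpa using congrArg Complex.im h0
  · intro T
    obtain ⟨D, hD, h'⟩ := exists_norm_gammaFactor_le_exp γ hY ρ T
    refine ⟨D, fun s h1 h2 h3 => ?_⟩
    rw [Pi.mul_apply, norm_mul]
    calc ‖gammaFactor γ Y s‖ * ‖(k + 1 + s)⁻¹‖ ≤ (D * Real.exp (-s.re)) * 1 := by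
          gcongr
          · exact h' s h1 h2 h3
          · exact (norm_inv_natCast_add_one_add_le_inv_abs_im h2 k).trans (inv_le_one_of_one_le₀ h2)
      _ = _ := mul_one _
  · intro s h1 h2
    have hexp := Real.exp_pos 1
    have hs1 : 1 ≤ |s.im| := by nlinarith
    have hs0 : 0 < |s.im| := by linarith
    have h3 : Y ^ (s.re - ρ) * |s.im| ^ (-2 * (s.re - ρ)) ≤ Real.exp (-(s.re - ρ)) := by
      have h4 : |s.im| ^ (-2 * (s.re - ρ)) = ((|s.im| ^ 2)⁻¹) ^ (s.re - ρ) := by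
        rw [Real.rpow_mul hs0.le, Real.rpow_neg hs0.le, Real.rpow_two]
      have h5 : Real.exp (-(s.re - ρ)) = (Real.exp (-1)) ^ (s.re - ρ) := by
        rw [← Real.exp_mul]; ring_nf
      rw [h4, h5, ← Real.mul_rpow hY.le (by positivity)]
      refine Real.rpow_le_rpow (by positivity) ?_ (by linarith)
      rw [Real.exp_neg, ← div_eq_mul_inv, div_le_iff₀ (by positivity), inv_mul_eq_div,
        le_div_iff₀ hexp]
      nlinarith
    rw [Pi.mul_apply, norm_mul]
    calc ‖gammaFactor γ Y s‖ * ‖(k + 1 + s)⁻¹‖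
        ≤ (C * Y ^ s.re * |s.im| ^ (γ 0 - 2 * s.re - 1)) * |s.im|⁻¹ := by
          gcongr
          · exact h s h1 hs1
          · exact norm_inv_natCast_add_one_add_le_inv_abs_im hs1 k
      _ = C * Y ^ ρ * |s.im| ^ (γ 0 - 2 * ρ - 1 - 1) *
          (Y ^ (s.re - ρ) * |s.im| ^ (-2 * (s.re - ρ))) := by
          rw [show γ 0 - 2 * s.re - 1 = (γ 0 - 2 * ρ - 1 - 1) + (-2 * (s.re - ρ)) + 1 by ring,
            Real.rpow_add_one hs0.ne', Real.rpow_add hs0,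
            show s.re = ρ + (s.re - ρ) by ring, Real.rpow_add hY]
          field_simp
          ring_nf
      _ ≤ C * Y ^ ρ * |s.im| ^ (γ 0 - 2 * ρ - 1 - 1) * Real.exp (-(s.re - ρ)) := by gcongr
      _ = _ := by
          rw [show -(s.re - ρ) = ρ + -s.re by ring, Real.exp_add]
          ring

/-- The double contour integral of the limiting kernels as a sum over the residues in `σ`. -/
theorem hasSum_verticalIntegral_hairpinIntegral (hδ : -1 / 2 ≤ δ) (hδ' : δ ≤ 0)
    (hγ0 : γ 0 = 2 * δ + 1 / 2) (hγ : ∀ j, δ ≤ γ j) (hρ : δ - 1 / 4 < ρ) (hρ' : ρ < δ) {X Y : ℝ}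
    (hX : 0 < X) (hY : 0 < Y) {a η : ℝ} (ha : a < 0) (haρ : -1 - ρ < a) (hη : 0 < η) :
    HasSum (fun k : ℕ => 2 * Real.pi * Complex.I * residueCoeff γ X k *
        verticalIntegral ρ fun w => gammaFactor γ Y w * (k + 1 + w)⁻¹)
      (verticalIntegral ρ fun w => gammaFactor γ Y w * hairpinIntegral a η fun σ =>
        Complex.Gamma (-σ) * (regFactor γ X σ * (σ + 1 + w)⁻¹)) := by
  have hint := integrable_gammaFactor_mul_inv hδ hδ' hγ0 hγ hρ hρ' hY
  have hsum := hasSum_integral_of_summable_integral_norm (μ := volume)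
    (F := fun (k : ℕ) (y : ℝ) => 2 * Real.pi * Complex.I * residueCoeff γ X k *
      (gammaFactor γ Y (ρ + y * Complex.I) * (k + 1 + (ρ + y * Complex.I))⁻¹))
    (fun k => (hint k).const_mul _) ?_
  · have h1 : ∀ y : ℝ, ∑' k : ℕ, 2 * Real.pi * Complex.I * residueCoeff γ X k *
        (gammaFactor γ Y (ρ + y * Complex.I) * (k + 1 + (ρ + y * Complex.I))⁻¹) =
        gammaFactor γ Y (ρ + y * Complex.I) * hairpinIntegral a η fun σ =>
          Complex.Gamma (-σ) * (regFactor γ X σ * (σ + 1 + (ρ + y * Complex.I))⁻¹) := by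
      intro y
      refine HasSum.tsum_eq ?_
      refine ((hasSum_hairpinIntegral_div γ hX ha hη (w := ρ + y * Complex.I)
        (by simpa using haρ)).mul_left (gammaFactor γ Y (ρ + y * Complex.I))).congr_fun ?_
      intro k
      ring
    simp only [h1, integral_const_mul] at hsum
    have h2 := hsum.mul_left Complex.I
    refine h2.congr_fun ?_
    intro k
    rw [verticalIntegral]
    ring
  · refine Summable.of_nonneg_of_le (fun k => integral_nonneg fun _ => norm_nonneg _)
      (fun k => ?_) ((summable_norm_residueCoeff γ hX).mul_left
        (2 * Real.pi * ∫ y : ℝ, ‖gammaFactor γ Y (ρ + y * Complex.I) *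
          ((0 : ℕ) + 1 + (ρ + y * Complex.I))⁻¹‖))
    rw [mul_right_comm (2 * Real.pi), ← integral_const_mul]
    refine integral_mono ((hint k).const_mul _).norm ((hint 0).norm.const_mul _) fun y => ?_
    have h1 := norm_inv_natCast_add_one_add_le (w := ρ + y * Complex.I) (by simp; linarith) k
    simp only [norm_mul, Complex.norm_I, Complex.norm_ofNat, Complex.norm_real, mul_one,
      Real.norm_of_nonneg Real.pi_pos.le, Nat.cast_zero, zero_add]
    gcongr

end

/-- The Meijer G-kernel as a series: `G^{1,0}` is expanded in a power series, and the contour of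
`G^{q,0}` is unfolded to a vertical line after the integration over `u`. -/
theorem hasSum_meijerKernel {q : ℕ} {μ : Fin (q + 1 + 1) → ℝ} {δ ρ : ℝ} (h0 : μ 0 = 0)
    (hδ : -1 / 2 ≤ δ) (hδ' : δ ≤ 0)
    (hγ0 : μ 1 = 2 * δ + 1 / 2) (hγ : ∀ j : Fin (q + 1), δ ≤ μ j.succ) (hρ : δ - 1 / 4 < ρ)
    (hρ' : ρ < δ) {X Y : ℝ} (hX : 0 < X) (hY : 0 < Y) :
    IntervalIntegrable (meijerKernelIntegrand μ X Y) volume 0 1 ∧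
    HasSum (fun k : ℕ => residueCoeff (fun j => μ j.succ) X k * (1 / (2 * Real.pi * Complex.I) *
        verticalIntegral ρ fun w => gammaFactor (fun j => μ j.succ) Y w * (k + 1 + w)⁻¹))
      (meijerKernel μ X Y) := by
  set γ : Fin (q + 1) → ℝ := fun j => μ j.succ with hγdef
  have hρ1 : -1 < ρ := by linarith
  obtain ⟨C, hC, hCb⟩ := exists_norm_gammaFactor_le_exp γ hY ρ 1
  -- the two Meijer G-functions
  have hG1 : ∀ u : ℝ, 0 < u → HasSum (fun k : ℕ => residueCoeff γ X k * (u : ℂ) ^ k)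
      (meijerG 1 (fun j => -μ j) (X * u)) := by
    intro u hu
    simpa only [residueCoeff_mul _ hX hu] using hasSum_meijerG_one μ h0 (mul_pos hX hu)
  set H : ℝ → ℂ := fun u => hairpinIntegral ρ 1 fun w => (u : ℂ) ^ w * gammaFactor γ Y w with hH
  have hG2 : ∀ u : ℝ, 0 < u → meijerG (q + 1) (fun j => μ j.rev) (Y * u) =
      1 / (2 * Real.pi * Complex.I) * H u := by
    intro u hu
    rw [meijerG]
    congr 1
    have e1 : (fun s : ℂ => (∏ j : Fin (q + 1 + 1), if (j : ℕ) < q + 1 then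
        Complex.Gamma (μ j.rev - s) else (Complex.Gamma (1 - μ j.rev + s))⁻¹) *
          ((Y * u : ℝ) : ℂ) ^ s) = gammaFactor γ (Y * u) := by
      ext w
      exact gammaFactor_eq_meijer_integrand μ h0 (Y * u) w
    rw [e1]
    have hYu := mul_pos hY hu
    have ha : -1 - ∑ j : Fin (q + 1 + 1), |μ j.rev| ≤ ρ := by
      have : 0 ≤ ∑ j : Fin (q + 1 + 1), |μ j.rev| := Finset.sum_nonneg fun _ _ => abs_nonneg _
      linarith
    obtain ⟨D, hD, hDb⟩ := exists_norm_gammaFactor_le_exp γ hYu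
      (-1 - ∑ j : Fin (q + 1 + 1), |μ j.rev|) 1
    rw [hairpinIntegral_eq_of_le (measurable_gammaFactor γ _) (C := D) ha zero_le_one
      (fun s _ h2 _ => differentiableAt_gammaFactor_of_re_lt hγ hYu (by linarith))
      (fun s h1 h2 => hDb s h1 h2.ge h2.le)]
    exact congrArg _ (funext fun w => gammaFactor_mul γ hY hu w)
  -- integration over `u`
  have hmel := integral_pow_mul_hairpinIntegral (G := gammaFactor γ Y) (η := 1) hρ1 zero_le_one
    (by
      refine (Continuous.continuousOn ?_).integrableOn_Icc.mono_set Ioc_subset_Icc_self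
      exact continuous_vertical fun w hw =>
        (differentiableAt_gammaFactor_of_re_lt hγ hY (hw.trans_lt hρ')).continuousAt)
    (integrableOn_horizontal (measurable_gammaFactor γ Y) (C := C) fun v hv => by
      simpa using hCb (v + (1 : ℝ) * Complex.I) (by simpa) (by simp) (by simp))
    (integrableOn_horizontal' (measurable_gammaFactor γ Y) (C := C) fun v hv => by
      simpa using hCb (v - (1 : ℝ) * Complex.I) (by simpa) (by simp) (by simp))
  have hHint : IntegrableOn H (Ioc 0 1) := by simpa using (hmel 0).1
  have hK : EqOn (meijerKernelIntegrand μ X Y) (fun u => ∑' k : ℕ, residueCoeff γ X k *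
      (1 / (2 * Real.pi * Complex.I)) * ((u : ℂ) ^ k * H u)) (Ioc 0 1) := by
    intro u hu
    refine (HasSum.tsum_eq ?_).symm
    rw [meijerKernelIntegrand, hG2 u hu.1]
    refine ((hG1 u hu.1).mul_right (1 / (2 * Real.pi * Complex.I) * H u)).congr_fun ?_
    intro k
    ring
  have hS := summable_norm_residueCoeff γ hX
  have hsum := hasSum_integral_of_summable_integral_norm (μ := volume.restrict (Ioc (0 : ℝ) 1))
    (F := fun (k : ℕ) (u : ℝ) => residueCoeff γ X k *
      (1 / (2 * Real.pi * Complex.I)) * ((u : ℂ) ^ k * H u))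
    (fun k => ((hmel k).1).const_mul _) (by
      refine Summable.of_nonneg_of_le (fun k => integral_nonneg fun _ => norm_nonneg _)
        (fun k => ?_) (hS.mul_right (‖1 / (2 * Real.pi * Complex.I)‖ * ∫ u in Ioc (0 : ℝ) 1, ‖H u‖))
      rw [← mul_assoc, ← integral_const_mul]
      refine setIntegral_mono_on ((hmel k).1.const_mul _).norm (hHint.norm.const_mul _)
        measurableSet_Ioc fun u hu => ?_
      rw [norm_mul, norm_mul, norm_mul ((u : ℂ) ^ k), norm_pow, Complex.norm_real,
        Real.norm_of_nonneg hu.1.le]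
      gcongr
      exact mul_le_of_le_one_left (norm_nonneg _) (pow_le_one₀ hu.1.le hu.2))
  refine ⟨?_, ?_⟩
  · rw [intervalIntegrable_iff_integrableOn_Ioc_of_le zero_le_one]
    have hcont : ContinuousOn (fun u : ℝ => ∑' k : ℕ, residueCoeff γ X k * (u : ℂ) ^ k)
        (Ioc 0 1) := by
      refine continuousOn_tsum (u := fun k => ‖residueCoeff γ X k‖)
        (fun k => by fun_prop) hS fun k u hu => ?_
      rw [norm_mul, norm_pow, Complex.norm_real, Real.norm_of_nonneg hu.1.le]
      exact mul_le_of_le_one_right (norm_nonneg _) (pow_le_one₀ hu.1.le hu.2)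
    have hbd : Integrable (fun u : ℝ => (∑' k : ℕ, residueCoeff γ X k * (u : ℂ) ^ k) * H u)
        (volume.restrict (Ioc 0 1)) := by
      refine Integrable.bdd_mul (c := ∑' k, ‖residueCoeff γ X k‖) hHint
        (hcont.aestronglyMeasurable measurableSet_Ioc) ?_
      refine (ae_restrict_mem measurableSet_Ioc).mono fun u hu => ?_
      refine tsum_of_norm_bounded hS.hasSum fun k => ?_
      rw [norm_mul, norm_pow, Complex.norm_real, Real.norm_of_nonneg hu.1.le]
      exact mul_le_of_le_one_right (norm_nonneg _) (pow_le_one₀ hu.1.le hu.2)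
    refine IntegrableOn.congr_fun (hbd.const_mul (1 / (2 * Real.pi * Complex.I))) ?_
      measurableSet_Ioc
    intro u hu
    simp only [meijerKernelIntegrand]
    rw [hG2 u hu.1, (hG1 u hu.1).tsum_eq]
    ring
  · rw [meijerKernel, intervalIntegral.integral_of_le zero_le_one,
      setIntegral_congr_fun measurableSet_Ioc hK]
    simp only [integral_const_mul] at hsum
    refine hsum.congr_fun ?_
    intro k
    rw [(hmel k).2, verticalIntegral_gammaFactor_eq_hairpinIntegral hδ hδ' hγ0 hγ hρ hρ' hY k]
    ring

/-! ### The kernels of finite index and their limit -/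

section
variable {q : ℕ} {γ : Fin (q + 1) → ℝ} {δ : ℝ}

/-- Two steps of the functional equation gain the factor `|Im w|⁻²`. -/
theorem norm_Gamma_natCast_add_le {n : ℕ} {w : ℂ} (h1 : -1 < w.re) (h2 : w.re < 0)
    (h3 : 1 ≤ |w.im|) :
    ‖Complex.Gamma (n + 1 + w)‖ ≤
      max (Real.Gamma (n + 2)) (Real.Gamma (n + 3)) * |w.im| ^ (-2 : ℝ) := by
  have hn : (0 : ℝ) ≤ n := n.cast_nonneg
  have him : 0 < |w.im| := by linarith
  have hne : ∀ z : ℂ, z.im = w.im → z ≠ 0 := fun z hz h0 => by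
    rw [h0, Complex.zero_im] at hz
    rw [← hz, abs_zero] at him
    exact him.false
  have e1 : Complex.Gamma (n + 1 + w + 1 + 1) =
      (n + 1 + w + 1) * ((n + 1 + w) * Complex.Gamma (n + 1 + w)) := by
    rw [Complex.Gamma_add_one _ (hne _ (by simp)), Complex.Gamma_add_one _ (hne _ (by simp))]
  have e2 : ‖Complex.Gamma (n + 1 + w + 1 + 1)‖ ≤
      max (Real.Gamma (n + 2)) (Real.Gamma (n + 3)) := by
    refine (norm_Gamma_le (by simp; linarith)).trans ?_
    refine Real.convexOn_Gamma.le_max_of_mem_Icc (by simp; linarith) (by simp; linarith) ?_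
    constructor <;> simp <;> linarith
  rw [e1, norm_mul, norm_mul] at e2
  rw [Real.rpow_neg him.le, Real.rpow_two, ← div_eq_mul_inv, le_div_iff₀ (by positivity)]
  refine le_trans ?_ e2
  have i1 : |w.im| ≤ ‖(n + 1 + w + 1 : ℂ)‖ := by
    simpa using Complex.abs_im_le_norm (n + 1 + w + 1)
  have i2 : |w.im| ≤ ‖(n + 1 + w : ℂ)‖ := by
    simpa using Complex.abs_im_le_norm (n + 1 + w)
  calc ‖Complex.Gamma (n + 1 + w)‖ * |w.im| ^ 2
      = |w.im| * (|w.im| * ‖Complex.Gamma (n + 1 + w)‖) := by ring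
    _ ≤ _ := by gcongr

/-- The extra factor `Γ(n + 1 + w)` of the kernels of finite index improves the decay enough for
the whole strip `δ - 1/2 < Re w < δ`. -/
theorem exists_norm_gammaFactor_mul_Gamma_le (hδ : -1 / 2 ≤ δ) (hδ' : δ ≤ 0)
    (hγ0 : γ 0 = 2 * δ + 1 / 2) {Y : ℝ} (hY : 0 < Y) (n : ℕ) {ρ₁ ρ₂ : ℝ} (h1 : δ - 1 / 2 < ρ₁)
    (h2 : ρ₂ < δ) :
    ∃ C : ℝ, 0 < C ∧ ∀ w : ℂ, ρ₁ ≤ w.re → w.re ≤ ρ₂ → 1 ≤ |w.im| →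
      ‖gammaFactor γ Y w * Complex.Gamma (n + 1 + w)‖ ≤ C * |w.im|⁻¹ := by
  obtain ⟨C, hC, h⟩ := exists_norm_gammaFactor_le γ (ρ := ρ₁) hY (by linarith) (by linarith)
  have hn : (0 : ℝ) ≤ n := n.cast_nonneg
  set D : ℝ := max (Real.Gamma (n + 2)) (Real.Gamma (n + 3)) with hD
  have hD0 : 0 < D := lt_max_of_lt_left (Real.Gamma_pos_of_pos (by linarith))
  refine ⟨C * (Y ^ ρ₁ + Y ^ ρ₂) * D, by positivity, fun w hw1 hw2 hw3 => ?_⟩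
  have him : 0 < |w.im| := by linarith
  have hYle : Y ^ w.re ≤ Y ^ ρ₁ + Y ^ ρ₂ := by
    have p1 := Real.rpow_pos_of_pos hY ρ₁
    have p2 := Real.rpow_pos_of_pos hY ρ₂
    rcases le_total 1 Y with hY1 | hY1
    · exact (Real.rpow_le_rpow_of_exponent_le hY1 hw2).trans (by linarith)
    · exact (Real.rpow_le_rpow_of_exponent_ge hY hY1 hw1).trans (by linarith)
  rw [norm_mul]
  calc ‖gammaFactor γ Y w‖ * ‖Complex.Gamma (n + 1 + w)‖
      ≤ (C * Y ^ w.re * |w.im| ^ (γ 0 - 2 * w.re - 1)) * (D * |w.im| ^ (-2 : ℝ)) := by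
        gcongr
        · exact h w hw1 hw3
        · exact norm_Gamma_natCast_add_le (by linarith) (by linarith) hw3
    _ ≤ (C * (Y ^ ρ₁ + Y ^ ρ₂) * |w.im| ^ (1 : ℝ)) * (D * |w.im| ^ (-2 : ℝ)) := by
        gcongr
        linarith
    _ = C * (Y ^ ρ₁ + Y ^ ρ₂) * D * (|w.im| ^ (1 : ℝ) * |w.im| ^ (-2 : ℝ)) := by ring
    _ = _ := by
        rw [← Real.rpow_add him, show (1 + -2 : ℝ) = -1 by norm_num, Real.rpow_neg_one]

theorem differentiableAt_gammaFactor_mul_Gamma (hγ : ∀ j, δ ≤ γ j) {Y : ℝ} (hY : 0 < Y) (n : ℕ)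
    {w : ℂ} (h1 : -1 < w.re) (h2 : w.re < δ) :
    DifferentiableAt ℂ (fun w => gammaFactor γ Y w * Complex.Gamma (n + 1 + w)) w := by
  refine (differentiableAt_gammaFactor_of_re_lt hγ hY h2).mul
    (DifferentiableAt.comp w (differentiableAt_Gamma_of_re_pos ?_) (by fun_prop))
  have hn : (0 : ℝ) ≤ n := n.cast_nonneg
  simp
  linarith

theorem integrable_gammaFactor_mul_Gamma_mul_inv (hδ : -1 / 2 ≤ δ) (hδ' : δ ≤ 0)
    (hγ0 : γ 0 = 2 * δ + 1 / 2) (hγ : ∀ j, δ ≤ γ j) {Y : ℝ} (hY : 0 < Y) (n : ℕ) {ρ : ℝ}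
    (h1 : δ - 1 / 2 < ρ) (h2 : ρ < δ) (k : ℕ) :
    Integrable fun y : ℝ => gammaFactor γ Y (ρ + y * Complex.I) *
      Complex.Gamma (n + 1 + (ρ + y * Complex.I)) * (k + 1 + (ρ + y * Complex.I))⁻¹ := by
  obtain ⟨C, hC, h⟩ := exists_norm_gammaFactor_mul_Gamma_le hδ hδ' hγ0 hY n h1 h2
  refine integrable_of_norm_le_rpow (C := C) (e := -2) (continuous_vertical
    (f := fun w => gammaFactor γ Y w * Complex.Gamma (n + 1 + w) * (k + 1 + w)⁻¹) fun w hw => ?_)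
    (by norm_num) fun y hy => ?_
  · refine (differentiableAt_gammaFactor_mul_Gamma hγ hY n (by linarith)
      (by linarith)).continuousAt.mul
      (ContinuousAt.inv₀ (by fun_prop) (natCast_add_one_add_ne_zero (by linarith) k))
  · have hy0 : 0 < |y| := by linarith
    have e1 := h (ρ + y * Complex.I) (by simp) (by simp) (by simpa)
    have e2 := norm_inv_natCast_add_one_add_le_inv_abs_im (w := ρ + y * Complex.I) (by simpa) k
    simp only [Complex.ofReal_re, Complex.I_re, mul_zero, Complex.ofReal_im, Complex.I_im,
      mul_one, add_zero, Complex.add_im, Complex.mul_im, zero_add] at e1 e2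
    rw [norm_mul, Real.rpow_neg hy0.le, Real.rpow_two, sq, mul_inv, ← mul_assoc]
    gcongr

/-- For the kernels of finite index the line of integration is arbitrary in the strip
`δ - 1/2 < Re w < δ`, although the limiting integrand need not be integrable to the left of
`Re w = δ - 1/4`. -/
theorem verticalIntegral_gammaFactor_mul_Gamma_eq (hδ : -1 / 2 ≤ δ) (hδ' : δ ≤ 0)
    (hγ0 : γ 0 = 2 * δ + 1 / 2) (hγ : ∀ j, δ ≤ γ j) {Y : ℝ} (hY : 0 < Y) (n : ℕ) {ρ₁ ρ₂ : ℝ}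
    (h1 : δ - 1 / 2 < ρ₁) (h2 : ρ₁ < δ) (h3 : δ - 1 / 2 < ρ₂) (h4 : ρ₂ < δ) (k : ℕ) :
    verticalIntegral ρ₁ (fun w => gammaFactor γ Y w * Complex.Gamma (n + 1 + w) *
      (k + 1 + w)⁻¹) =
    verticalIntegral ρ₂ fun w => gammaFactor γ Y w * Complex.Gamma (n + 1 + w) * (k + 1 + w)⁻¹ := by
  wlog h : ρ₁ ≤ ρ₂ generalizing ρ₁ ρ₂
  · exact (this h3 h4 h1 h2 (le_of_not_ge h)).symm
  obtain ⟨C, hC, hb⟩ := exists_norm_gammaFactor_mul_Gamma_le hδ hδ' hγ0 hY n h1 h4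
  refine verticalIntegral_eq_of_le (C := C) h (fun s hs1 hs2 => ?_) fun s hs1 hs2 hs3 => ?_
  · exact (differentiableAt_gammaFactor_mul_Gamma hγ hY n (by linarith) (by linarith)).mul
      (DifferentiableAt.inv (by fun_prop) (natCast_add_one_add_ne_zero (by linarith) k))
  · have hs0 : 0 < |s.im| := by linarith
    rw [norm_mul, Real.rpow_neg hs0.le, Real.rpow_two, sq, mul_inv, ← mul_assoc]
    gcongr
    · exact hb s hs1 hs2 hs3
    · exact norm_inv_natCast_add_one_add_le_inv_abs_im hs3 k

/-- The residue theorem for the inner integral of the kernels of finite index. -/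
theorem rectangleIntegral_Gamma_div (γ : Fin q → ℝ) {X : ℝ} (hX : 0 < X) {n : ℕ} (hn : n ≠ 0)
    {a b η : ℝ} (ha : a < 0) (hb : (n : ℝ) - 1 < b) (hη : 0 < η) {w : ℂ} (hw : -1 - w.re < a) :
    rectangleIntegral a b η (fun σ => Complex.Gamma (-σ) / Complex.Gamma (n - σ) *
        (regFactor γ X σ * (σ + 1 + w)⁻¹)) =
      2 * Real.pi * Complex.I * ∑ k ∈ Finset.range n,
        residueCoeff γ X k / (n - 1 - k).factorial * (k + 1 + w)⁻¹ := by
  obtain ⟨N, rfl⟩ := Nat.exists_eq_succ_of_ne_zero hn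
  have hN : (0 : ℝ) ≤ N := N.cast_nonneg
  have hb' : (N : ℝ) < b := by push_cast at hb; linarith
  have h1 := rectangleIntegral_prod_inv (h := fun σ => regFactor γ X σ * (σ + 1 + w)⁻¹) ha hb' hη
    (by
      intro s hs1 hs2 hs3
      refine (differentiable_regFactor γ hX s).mul (DifferentiableAt.inv (by fun_prop) fun h0 => ?_)
      have := congrArg Complex.re h0
      simp at this
      linarith)
  rw [rectangleIntegral_congr (g := fun σ => regFactor γ X σ * (σ + 1 + w)⁻¹ *
    (∏ k ∈ Finset.range (N + 1), (k - σ : ℂ))⁻¹) (by linarith) hη, h1]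
  · congr 1
    refine Finset.sum_congr rfl fun k _ => ?_
    have h2 : (k.factorial : ℂ) ≠ 0 := by exact_mod_cast Nat.factorial_ne_zero _
    have h3 : ((N - k).factorial : ℂ) ≠ 0 := by exact_mod_cast Nat.factorial_ne_zero _
    rw [residueCoeff, Nat.succ_sub_one]
    field_simp
  · intro s _ hs
    rw [Gamma_neg_div_Gamma N.succ hs]
    ring

/-- The rescaled double contour integral of the kernels of index `2n`, as a series. It has only the
`n` residues with `k < n`; the falling factorial makes the further terms vanish. -/
theorem verticalIntegral_rectangleIntegral_eq (hδ : -1 / 2 ≤ δ) (hδ' : δ ≤ 0)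
    (hγ0 : γ 0 = 2 * δ + 1 / 2) (hγ : ∀ j, δ ≤ γ j) {X Y : ℝ} (hX : 0 < X) (hY : 0 < Y) {n : ℕ}
    (hn : n ≠ 0) {ρ ρ' : ℝ} (h1 : δ - 1 / 2 < ρ) (h2 : ρ < δ) (h3 : δ - 1 / 2 < ρ') (h4 : ρ' < δ)
    {a b η : ℝ} (ha : a < 0) (haρ : -1 - ρ' < a) (hb : (n : ℝ) - 1 < b) (hη : 0 < η) :
    (n : ℂ)⁻¹ * verticalIntegral ρ' (fun w => gammaFactor γ (Y / n) w *
      Complex.Gamma (n + 1 + w) * rectangleIntegral a b η fun σ =>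
        Complex.Gamma (-σ) / Complex.Gamma (n - σ) *
          (regFactor γ (X / n) σ * (σ + 1 + w)⁻¹)) =
      ∑' k : ℕ, 2 * Real.pi * Complex.I * residueCoeff γ X k *
        ((n - 1).descFactorial k / n ^ k) * verticalIntegral ρ fun w => gammaFactor γ Y w *
          (Complex.Gamma (n + 1 + w) / (Complex.Gamma n * (n : ℂ) ^ (1 + w))) *
            (k + 1 + w)⁻¹ := by
  have hn0 : (0 : ℝ) < n := by positivity
  have hnC : (n : ℂ) ≠ 0 := by exact_mod_cast hn
  have hinv : (0 : ℝ) < (n : ℝ)⁻¹ := by positivity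
  have hYn : 0 < Y / n := by positivity
  have hXn : 0 < X / n := by positivity
  have hV : verticalIntegral ρ' (fun w => gammaFactor γ (Y / n) w *
      Complex.Gamma (n + 1 + w) * rectangleIntegral a b η fun σ =>
        Complex.Gamma (-σ) / Complex.Gamma (n - σ) *
          (regFactor γ (X / n) σ * (σ + 1 + w)⁻¹)) =
      ∑ k ∈ Finset.range n, 2 * Real.pi * Complex.I * (residueCoeff γ (X / n) k /
        (n - 1 - k).factorial) * verticalIntegral ρ' fun w => gammaFactor γ (Y / n) w *
          Complex.Gamma (n + 1 + w) * (k + 1 + w)⁻¹ := by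
    have e1 : ∀ y : ℝ, (gammaFactor γ (Y / n) (ρ' + y * Complex.I) *
        Complex.Gamma (n + 1 + (ρ' + y * Complex.I)) * rectangleIntegral a b η fun σ =>
        Complex.Gamma (-σ) / Complex.Gamma (n - σ) *
          (regFactor γ (X / n) σ * (σ + 1 + (ρ' + y * Complex.I))⁻¹)) =
        ∑ k ∈ Finset.range n, 2 * Real.pi * Complex.I * (residueCoeff γ (X / n) k /
        (n - 1 - k).factorial) * (gammaFactor γ (Y / n) (ρ' + y * Complex.I) *
          Complex.Gamma (n + 1 + (ρ' + y * Complex.I)) * (k + 1 + (ρ' + y * Complex.I))⁻¹) := by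
      intro y
      rw [rectangleIntegral_Gamma_div γ hXn hn ha hb hη (by simpa using haρ), ← mul_assoc,
        Finset.mul_sum]
      exact Finset.sum_congr rfl fun k _ => by ring
    rw [verticalIntegral]
    simp only [e1]
    rw [integral_finsetSum _ fun k _ =>
      (integrable_gammaFactor_mul_Gamma_mul_inv hδ hδ' hγ0 hγ hYn n h3 h4 k).const_mul _,
      Finset.mul_sum]
    refine Finset.sum_congr rfl fun k _ => ?_
    rw [integral_const_mul, verticalIntegral]
    ring
  rw [hV, tsum_eq_sum (s := Finset.range n), Finset.mul_sum]
  · refine Finset.sum_congr rfl fun k hk => ?_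
    have hk : k ≤ n - 1 := by have := Finset.mem_range.1 hk; omega
    rw [verticalIntegral_gammaFactor_mul_Gamma_eq hδ hδ' hγ0 hγ hYn n h3 h4 h1 h2 k]
    have hΓ : Complex.Gamma n = (n - 1).factorial := by
      rw [← Complex.Gamma_nat_eq_factorial, Nat.cast_sub (by omega)]
      simp
    have hf := Nat.factorial_mul_descFactorial hk
    have hfC : (((n - 1).factorial : ℕ) : ℂ) = (n - 1 - k).factorial * (n - 1).descFactorial k := by
      exact_mod_cast hf.symm
    have hf1 : ((n - 1 - k).factorial : ℂ) ≠ 0 := by exact_mod_cast Nat.factorial_ne_zero _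
    have hf2 : ((n - 1).factorial : ℂ) ≠ 0 := by exact_mod_cast Nat.factorial_ne_zero _
    have hw : ∀ w : ℂ, gammaFactor γ (Y / n) w * Complex.Gamma (n + 1 + w) * (k + 1 + w)⁻¹ =
        n * (n - 1).factorial * (gammaFactor γ Y w *
          (Complex.Gamma (n + 1 + w) / (Complex.Gamma n * (n : ℂ) ^ (1 + w))) *
            (k + 1 + w)⁻¹) := by
      intro w
      have hcp : ((n : ℂ)) ^ w ≠ 0 := by
        rw [Complex.cpow_def_of_ne_zero hnC]; exact Complex.exp_ne_zero _
      rw [div_eq_mul_inv Y, gammaFactor_mul γ hY hinv, Complex.ofReal_inv,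
        Complex.inv_cpow_ofReal_nonneg hn0.le, Complex.ofReal_natCast, hΓ,
        Complex.cpow_add _ _ hnC, Complex.cpow_one]
      field_simp
    simp only [hw]
    rw [verticalIntegral_const_mul, div_eq_mul_inv X, residueCoeff_mul γ hX hinv,
      Complex.ofReal_inv, Complex.ofReal_natCast, inv_pow, hfC]
    field_simp
  · intro k hk
    have : (n - 1).descFactorial k = 0 := by
      rw [Nat.descFactorial_eq_zero_iff_lt]
      have := Finset.mem_range.not.1 hk
      omega
    rw [this]
    simp

theorem tendsto_descFactorial_div_pow (k : ℕ) :
    Tendsto (fun n : ℕ => ((n - 1).descFactorial k / n ^ k : ℂ)) atTop (𝓝 1) := by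
  induction k with
  | zero => simp
  | succ k ih =>
    have h1 : Tendsto (fun n : ℕ => 1 - ((k + 1 : ℕ) : ℂ) / n) atTop (𝓝 1) := by
      simpa using (tendsto_const_div_atTop_nhds_zero_nat ((k + 1 : ℕ) : ℂ)).const_sub 1
    have h2 := h1.mul ih
    rw [mul_one] at h2
    refine h2.congr' ?_
    filter_upwards [eventually_ge_atTop (k + 1)] with n hn
    have hn0 : (n : ℂ) ≠ 0 := by
      have : n ≠ 0 := by omega
      exact_mod_cast this
    rw [Nat.descFactorial_succ, Nat.cast_mul, show n - 1 - k = n - (k + 1) by omega,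
      Nat.cast_sub hn]
    field_simp
    ring

theorem norm_descFactorial_div_pow_le (n k : ℕ) :
    ‖((n - 1).descFactorial k / n ^ k : ℂ)‖ ≤ 1 := by
  rw [norm_div, norm_pow, Complex.norm_natCast, Complex.norm_natCast]
  refine div_le_one_of_le₀ ?_ (by positivity)
  exact_mod_cast (Nat.descFactorial_le_pow _ _).trans (Nat.pow_le_pow_left (Nat.sub_le n 1) k)

/-- The quotient of `tendsto_Gamma_ratio` is bounded by its limit `1`, for all `n` and all
`w` in the strip `-1 < Re w < 0`. -/
theorem norm_Gamma_ratio_le {n : ℕ} (hn : n ≠ 0) {w : ℂ} (h1 : -1 < w.re) (h2 : w.re < 0) :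
    ‖Complex.Gamma (n + 1 + w) / (Complex.Gamma n * (n : ℂ) ^ (1 + w))‖ ≤ 1 := by
  have hn0 : (0 : ℝ) < n := by positivity
  have h3 := Gamma_natCast_add_le hn (r := 1 + w.re) (by linarith) (by linarith)
  have h4 := norm_Gamma_le (z := n + 1 + w) (by simp; linarith)
  have h5 : Complex.Gamma n = ((Real.Gamma n : ℝ) : ℂ) := by
    rw [← Complex.Gamma_ofReal, Complex.ofReal_natCast]
  have hΓ := Real.Gamma_pos_of_pos hn0
  rw [norm_div, norm_mul, h5, Complex.norm_real, Real.norm_of_nonneg hΓ.le,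
    ← Complex.ofReal_natCast, Complex.norm_cpow_eq_rpow_re_of_pos hn0]
  refine div_le_one_of_le₀ ?_ (by positivity)
  simp only [Complex.add_re, Complex.one_re, Complex.natCast_re, Complex.ofReal_natCast] at h4 ⊢
  rw [← add_assoc] at h3
  exact h4.trans h3

/-- The scaling limit at the origin: both the sum over the residues and the remaining vertical
integrals converge dominatedly. -/
theorem tendsto_verticalIntegral_rectangleIntegral (hδ : -1 / 2 ≤ δ) (hδ' : δ ≤ 0)
    (hγ0 : γ 0 = 2 * δ + 1 / 2) (hγ : ∀ j, δ ≤ γ j) {ρ : ℝ} (hρ : δ - 1 / 4 < ρ) (hρ' : ρ < δ)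
    {X Y : ℝ} (hX : 0 < X) (hY : 0 < Y) {ρn a b η : ℕ → ℝ}
    (hfin : ∀ n : ℕ, 1 ≤ n → δ - 1 / 2 < ρn n ∧ ρn n < δ ∧ a n < 0 ∧ -1 - ρn n < a n ∧
      (n : ℝ) - 1 < b n ∧ 0 < η n) {a₀ η₀ : ℝ} (ha : a₀ < 0) (haρ : -1 - ρ < a₀) (hη : 0 < η₀) :
    Tendsto (fun n : ℕ => (n : ℂ)⁻¹ * verticalIntegral (ρn n) (fun w => gammaFactor γ (Y / n) w *
      Complex.Gamma (n + 1 + w) * rectangleIntegral (a n) (b n) (η n) fun σ =>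
        Complex.Gamma (-σ) / Complex.Gamma (n - σ) *
          (regFactor γ (X / n) σ * (σ + 1 + w)⁻¹))) atTop
      (𝓝 (verticalIntegral ρ fun w => gammaFactor γ Y w * hairpinIntegral a₀ η₀ fun σ =>
        Complex.Gamma (-σ) * (regFactor γ X σ * (σ + 1 + w)⁻¹))) := by
  rw [← (hasSum_verticalIntegral_hairpinIntegral hδ hδ' hγ0 hγ hρ hρ' hX hY ha haρ hη).tsum_eq]
  have hint := integrable_gammaFactor_mul_inv hδ hδ' hγ0 hγ hρ hρ' hY
  set B : ℝ := ∫ y : ℝ, ‖gammaFactor γ Y (ρ + y * Complex.I) *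
    ((0 : ℕ) + 1 + (ρ + y * Complex.I))⁻¹‖ with hB
  have hdom : ∀ n : ℕ, n ≠ 0 → ∀ k : ℕ, ∀ y : ℝ, ‖gammaFactor γ Y (ρ + y * Complex.I) *
      (Complex.Gamma (n + 1 + (ρ + y * Complex.I)) / (Complex.Gamma n *
        (n : ℂ) ^ (1 + (ρ + y * Complex.I)))) * (k + 1 + (ρ + y * Complex.I))⁻¹‖ ≤
      ‖gammaFactor γ Y (ρ + y * Complex.I) * ((0 : ℕ) + 1 + (ρ + y * Complex.I))⁻¹‖ := by
    intro n hn k y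
    have e1 := norm_Gamma_ratio_le hn (w := ρ + y * Complex.I) (by simp; linarith)
      (by simp; linarith)
    have e2 := norm_inv_natCast_add_one_add_le (w := ρ + y * Complex.I) (by simp; linarith) k
    rw [norm_mul, norm_mul, norm_mul, Nat.cast_zero, zero_add]
    calc _ ≤ ‖gammaFactor γ Y (ρ + y * Complex.I)‖ * 1 * ‖(1 + (ρ + y * Complex.I) : ℂ)⁻¹‖ := by
          gcongr
      _ = _ := by rw [mul_one]
  have hlim := tendsto_tsum_of_dominated_convergence (𝓕 := atTop)
    (f := fun (n : ℕ) (k : ℕ) => 2 * Real.pi * Complex.I * residueCoeff γ X k *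
        ((n - 1).descFactorial k / n ^ k) * verticalIntegral ρ fun w => gammaFactor γ Y w *
          (Complex.Gamma (n + 1 + w) / (Complex.Gamma n * (n : ℂ) ^ (1 + w))) * (k + 1 + w)⁻¹)
    (g := fun k : ℕ => 2 * Real.pi * Complex.I * residueCoeff γ X k *
        verticalIntegral ρ fun w => gammaFactor γ Y w * (k + 1 + w)⁻¹)
    (bound := fun k => 2 * Real.pi * ‖residueCoeff γ X k‖ * B)
    (((summable_norm_residueCoeff γ hX).mul_left (2 * Real.pi)).mul_right B) ?_ ?_
  · refine hlim.congr' ?_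
    filter_upwards [eventually_ge_atTop 1] with n hn
    obtain ⟨f1, f2, f3, f4, f5, f6⟩ := hfin n hn
    exact (verticalIntegral_rectangleIntegral_eq hδ hδ' hγ0 hγ hX hY (by omega)
      (by linarith) hρ' f1 f2 f3 f4 f5 f6).symm
  · intro k
    have h1 := (tendsto_descFactorial_div_pow k).const_mul
      (2 * Real.pi * Complex.I * residueCoeff γ X k)
    rw [mul_one] at h1
    refine h1.mul (Tendsto.const_mul _ ?_)
    refine tendsto_integral_filter_of_dominated_convergence
      (fun y : ℝ => ‖gammaFactor γ Y (ρ + y * Complex.I) *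
        ((0 : ℕ) + 1 + (ρ + y * Complex.I))⁻¹‖) ?_ ?_ (hint 0).norm ?_
    · refine Eventually.of_forall fun n => Measurable.aestronglyMeasurable ?_
      refine measurable_vertical (f := fun w => gammaFactor γ Y w *
        (Complex.Gamma (n + 1 + w) / (Complex.Gamma n * (n : ℂ) ^ (1 + w))) * (k + 1 + w)⁻¹) ?_ ρ
      exact ((measurable_gammaFactor γ Y).mul ((measurable_Gamma.comp (by fun_prop)).div
        (by fun_prop))).mul (by fun_prop)
    · filter_upwards [eventually_ne_atTop 0] with n hn
      exact Eventually.of_forall (hdom n hn k)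
    · refine Eventually.of_forall fun y => ?_
      have h2 := tendsto_Gamma_ratio (w := ρ + y * Complex.I) (by
        intro m hm
        have h3 := congrArg Complex.re hm
        simp only [Complex.add_re, Complex.ofReal_re, Complex.mul_re, Complex.I_re, mul_zero,
          Complex.ofReal_im, Complex.I_im, mul_one, sub_self, add_zero, Complex.neg_re,
          Complex.natCast_re] at h3
        have h4 : (m : ℝ) < 1 := by linarith
        have h5 : m = 0 := by
          have : m < 1 := by exact_mod_cast h4
          omega
        rw [h5, Nat.cast_zero, neg_zero] at h3
        linarith)
      simpa using (h2.const_mul (gammaFactor γ Y (ρ + y * Complex.I))).mul_const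
        ((k + 1 + (ρ + y * Complex.I))⁻¹)
  · filter_upwards [eventually_ne_atTop 0] with n hn k
    have h1 : ‖verticalIntegral ρ fun w => gammaFactor γ Y w *
          (Complex.Gamma (n + 1 + w) / (Complex.Gamma n * (n : ℂ) ^ (1 + w))) *
            (k + 1 + w)⁻¹‖ ≤ B := by
      rw [verticalIntegral, norm_mul, Complex.norm_I, one_mul]
      exact norm_integral_le_of_norm_le (hint 0).norm (Eventually.of_forall (hdom n hn k))
    rw [norm_mul, norm_mul, norm_mul, norm_mul, norm_mul, Complex.norm_I, Complex.norm_ofNat,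
      Complex.norm_real, mul_one, Real.norm_of_nonneg Real.pi_pos.le]
    calc _ ≤ 2 * Real.pi * ‖residueCoeff γ X k‖ * 1 * B := by
          gcongr
          exact norm_descFactorial_div_pow_le n k
      _ = _ := by ring

end

/-! ### Change of variables `s = e + 2σ`, `t = e - 2 - 2w` -/

theorem integral_Ioi_comp_div_sub (f : ℝ → ℂ) (a d : ℝ) :
    ∫ v in Ioi a, f (v / 2 - d) = 2 * ∫ x in Ioi (a / 2 - d), f x := by
  have h1 := integral_comp_mul_left_Ioi (fun v => f (v - d)) a (b := 1 / 2) (by norm_num)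
  have h2 : ∫ v in Ioi (1 / 2 * a), f (v - d) = ∫ x in Ioi (a / 2 - d), f x := by
    rw [← integral_indicator measurableSet_Ioi, ← integral_indicator measurableSet_Ioi,
      ← integral_sub_right_eq_self ((Ioi (a / 2 - d)).indicator f) d]
    congr 1
    ext x
    simp only [indicator, mem_Ioi]
    refine if_congr ?_ rfl rfl
    constructor <;> intro h <;> linarith
  rw [h2] at h1
  simp only [one_div, inv_inv, Complex.real_smul, Complex.ofReal_ofNat] at h1
  rw [← h1]
  congr 1
  ext v
  congr 1
  ring

theorem hairpinIntegral_comp (a η e : ℝ) (f : ℂ → ℂ) :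
    hairpinIntegral a η (fun s => f ((s - e) / 2)) =
      2 * hairpinIntegral ((a - e) / 2) (η / 2) f := by
  have h1 := intervalIntegral.integral_comp_div (a := -η) (b := η)
    (fun y : ℝ => f (((a - e) / 2 : ℝ) + y * Complex.I)) (two_ne_zero' ℝ)
  have h2 := integral_Ioi_comp_div_sub (fun v : ℝ => f (v + (η / 2 : ℝ) * Complex.I)) a (e / 2)
  have h3 := integral_Ioi_comp_div_sub (fun v : ℝ => f (v - (η / 2 : ℝ) * Complex.I)) a (e / 2)
  have e1 : ∀ a y : ℝ, ((a - e) / 2 : ℝ) + ((y / 2 : ℝ) : ℂ) * Complex.I =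
      (a + y * Complex.I - e) / 2 := fun a y => by push_cast; ring
  have e3 : ∀ v : ℝ, (((v - e) / 2 : ℝ) : ℂ) - (η / 2 : ℝ) * Complex.I =
      (v - η * Complex.I - e) / 2 := fun y => by push_cast; ring
  simp only [e1, e3, Complex.real_smul, Complex.ofReal_ofNat, ← sub_div, neg_div] at h1 h2 h3
  rw [hairpinIntegral, hairpinIntegral, h1, h2, h3]
  ring

theorem rectangleIntegral_comp (a b η e : ℝ) (f : ℂ → ℂ) :
    rectangleIntegral a b η (fun s => f ((s - e) / 2)) =
      2 * rectangleIntegral ((a - e) / 2) ((b - e) / 2) (η / 2) f := by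
  have h1 := intervalIntegral.integral_comp_div (a := -η) (b := η)
    (fun y : ℝ => f (((a - e) / 2 : ℝ) + y * Complex.I)) (two_ne_zero' ℝ)
  have h4 := intervalIntegral.integral_comp_div (a := -η) (b := η)
    (fun y : ℝ => f (((b - e) / 2 : ℝ) + y * Complex.I)) (two_ne_zero' ℝ)
  have h2 := intervalIntegral.integral_comp_div_sub (a := a) (b := b)
    (fun v : ℝ => f (v + (η / 2 : ℝ) * Complex.I)) (two_ne_zero' ℝ) (e / 2)
  have h3 := intervalIntegral.integral_comp_div_sub (a := a) (b := b)
    (fun v : ℝ => f (v - (η / 2 : ℝ) * Complex.I)) (two_ne_zero' ℝ) (e / 2)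
  have e1 : ∀ a y : ℝ, ((a - e) / 2 : ℝ) + ((y / 2 : ℝ) : ℂ) * Complex.I =
      (a + y * Complex.I - e) / 2 := fun a y => by push_cast; ring
  have e3 : ∀ v : ℝ, (((v - e) / 2 : ℝ) : ℂ) - (η / 2 : ℝ) * Complex.I =
      (v - η * Complex.I - e) / 2 := fun y => by push_cast; ring
  simp only [e1, e3, Complex.real_smul, Complex.ofReal_ofNat, ← sub_div, neg_div]
    at h1 h2 h3 h4
  rw [rectangleIntegral, rectangleIntegral, h1, h2, h3, h4]
  ring

theorem verticalIntegral_comp (c e : ℝ) (f : ℂ → ℂ) :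
    verticalIntegral c (fun t => f ((e - 2 - t) / 2)) =
      2 * verticalIntegral ((e - 2 - c) / 2) f := by
  have h1 := Measure.integral_comp_mul_left
    (fun y : ℝ => f (((e - 2 - c) / 2 : ℝ) + y * Complex.I)) (-1 / 2)
  have e1 : ∀ y : ℝ, ((e - 2 - c) / 2 : ℝ) + ((-1 / 2 * y : ℝ) : ℂ) * Complex.I =
      (e - 2 - (c + y * Complex.I)) / 2 := fun y => by push_cast; ring
  have e2 : |((-1 / 2 : ℝ))⁻¹| = 2 := by norm_num
  simp only [e1, e2, Complex.real_smul, Complex.ofReal_ofNat] at h1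
  rw [verticalIntegral, verticalIntegral, h1]
  ring

/-- The common shape of the integrands of all four kernels: with `s = e + 2σ` and `t = e - 2 - 2w`,
the product of `A(σ)`, `B(w)` and the Cauchy factor `1 / (s - t)`. The value `e = 0` belongs to the
even and `e = 1` to the odd kernels. -/
noncomputable def productIntegrand (K e : ℝ) (A B : ℂ → ℂ) (t s : ℂ) : ℂ :=
  K * A ((s - e) / 2) * B ((e - 2 - t) / 2) * (s - t)⁻¹

theorem productIntegrand_eq (K e : ℝ) (A B : ℂ → ℂ) (t s : ℂ) :
    productIntegrand K e A B t s = (K / 2 * B ((e - 2 - t) / 2)) *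
      (A ((s - e) / 2) * ((s - e) / 2 + 1 + (e - 2 - t) / 2)⁻¹) := by
  rw [productIntegrand, show (s - e) / 2 + 1 + (e - 2 - t) / 2 = (s - t) / 2 by ring, inv_div]
  ring

theorem verticalIntegral_hairpinIntegral_productIntegrand (K e c a η : ℝ) (A B : ℂ → ℂ) :
    (verticalIntegral c fun t => hairpinIntegral a η fun s => productIntegrand K e A B t s) =
      2 * K * verticalIntegral ((e - 2 - c) / 2) fun w => B w *
        hairpinIntegral ((a - e) / 2) (η / 2) fun σ => A σ * (σ + 1 + w)⁻¹ := by
  simp only [productIntegrand_eq, hairpinIntegral_const_mul]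
  have h : ∀ t : ℂ, hairpinIntegral a η (fun s =>
      A ((s - e) / 2) * ((s - e) / 2 + 1 + (e - 2 - t) / 2)⁻¹) =
      2 * hairpinIntegral ((a - e) / 2) (η / 2) fun σ => A σ * (σ + 1 + (e - 2 - t) / 2)⁻¹ :=
    fun t => hairpinIntegral_comp a η e fun σ => A σ * (σ + 1 + (e - 2 - t) / 2)⁻¹
  have h' : (fun w => K / 2 * B w * (2 * hairpinIntegral ((a - e) / 2) (η / 2)
        fun σ => A σ * (σ + 1 + w)⁻¹)) =
      fun w => K * (B w * hairpinIntegral ((a - e) / 2) (η / 2) fun σ => A σ * (σ + 1 + w)⁻¹) := by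
    ext w
    ring
  simp only [h]
  rw [verticalIntegral_comp c e fun w => K / 2 * B w *
    (2 * hairpinIntegral ((a - e) / 2) (η / 2) fun σ => A σ * (σ + 1 + w)⁻¹), h',
    verticalIntegral_const_mul]
  ring

theorem verticalIntegral_rectangleIntegral_productIntegrand (K e c a b η : ℝ) (A B : ℂ → ℂ) :
    (verticalIntegral c fun t => rectangleIntegral a b η fun s => productIntegrand K e A B t s) =
      2 * K * verticalIntegral ((e - 2 - c) / 2) fun w => B w *
        rectangleIntegral ((a - e) / 2) ((b - e) / 2) (η / 2) fun σ => A σ * (σ + 1 + w)⁻¹ := by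
  simp only [productIntegrand_eq, rectangleIntegral_const_mul]
  have h : ∀ t : ℂ, rectangleIntegral a b η (fun s =>
      A ((s - e) / 2) * ((s - e) / 2 + 1 + (e - 2 - t) / 2)⁻¹) =
      2 * rectangleIntegral ((a - e) / 2) ((b - e) / 2) (η / 2)
        fun σ => A σ * (σ + 1 + (e - 2 - t) / 2)⁻¹ :=
    fun t => rectangleIntegral_comp a b η e fun σ => A σ * (σ + 1 + (e - 2 - t) / 2)⁻¹
  have h' : (fun w => K / 2 * B w * (2 * rectangleIntegral ((a - e) / 2) ((b - e) / 2) (η / 2)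
        fun σ => A σ * (σ + 1 + w)⁻¹)) =
      fun w => K * (B w * rectangleIntegral ((a - e) / 2) ((b - e) / 2) (η / 2)
        fun σ => A σ * (σ + 1 + w)⁻¹) := by
    ext w
    ring
  simp only [h]
  rw [verticalIntegral_comp c e fun w => K / 2 * B w *
    (2 * rectangleIntegral ((a - e) / 2) ((b - e) / 2) (η / 2) fun σ => A σ * (σ + 1 + w)⁻¹), h',
    verticalIntegral_const_mul]
  ring

/-! ### Absolute convergence of the double integrals -/

/-- On a contour to the right of `Re t = c` and at bounded height, `1 / (s - t)` is bounded by a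
multiple of `1 / (e - t)`, uniformly in `s`. -/
theorem exists_norm_inv_sub_le {c a : ℝ} (hca : c < a) (η : ℝ) {e : ℝ} (hce : c < e) :
    ∃ D : ℝ, 0 ≤ D ∧ ∀ s t : ℂ, a ≤ s.re → |s.im| ≤ η → t.re = c →
      ‖(s - t)⁻¹‖ ≤ D * ‖((e : ℂ) - t)⁻¹‖ := by
  refine ⟨(e - c + max η 0) / (a - c) + 1, ?_, fun s t hs hη ht => ?_⟩
  · have h1 := sub_pos.2 hce
    have h2 := sub_pos.2 hca
    positivity
  have hac := sub_pos.2 hca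
  have h1 : a - c ≤ ‖s - t‖ := by
    refine le_trans ?_ (Complex.re_le_norm _)
    simp [ht]; linarith
  have h2 : |t.im| ≤ ‖s - t‖ + max η 0 := by
    have h3 := Complex.abs_im_le_norm (s - t)
    rw [Complex.sub_im] at h3
    have h4 : |t.im| ≤ |s.im - t.im| + |s.im| := by
      have := abs_sub_abs_le_abs_sub t.im s.im
      rw [abs_sub_comm] at this
      linarith
    have := le_max_left η 0
    linarith
  have h3 : ‖(e : ℂ) - t‖ ≤ (e - c) + |t.im| := by
    refine (Complex.norm_le_abs_re_add_abs_im _).trans ?_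
    simp [ht, abs_of_pos (sub_pos.2 hce)]
  have hpos : 0 < ‖s - t‖ := hac.trans_le h1
  have hpos' : 0 < ‖(e : ℂ) - t‖ := by
    refine lt_of_lt_of_le (sub_pos.2 hce) (le_trans ?_ (Complex.re_le_norm _))
    simp [ht]
  rw [norm_inv, norm_inv, ← div_eq_mul_inv, le_div_iff₀ hpos', inv_mul_le_iff₀ hpos]
  have h4 : e - c + max η 0 ≤ (e - c + max η 0) / (a - c) * ‖s - t‖ := by
    rw [div_mul_eq_mul_div, le_div_iff₀ hac]
    have : 0 ≤ e - c + max η 0 := by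
      have := le_max_right η 0
      have := sub_pos.2 hce
      linarith
    gcongr
  linarith

/-- One side of a contour: by `exists_norm_inv_sub_le` the integrand is dominated by a product of
a function of `t` and a function of `s`. -/
theorem integrable_productIntegrand {K e c a η : ℝ} {A B : ℂ → ℂ} (hA : Measurable A)
    (hB : Measurable B) (hca : c < a) (hce : c < e) {s : ℝ → ℂ} (hs : Measurable s) {S : Set ℝ}
    (hS : MeasurableSet S) (hsa : ∀ v ∈ S, a ≤ (s v).re) (hsη : ∀ v ∈ S, |(s v).im| ≤ η)
    (h1 : IntegrableOn (fun v => A ((s v - e) / 2)) S)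
    (h2 : Integrable fun y : ℝ => B ((e - 2 - c) / 2 + y * Complex.I) *
      (1 + ((e - 2 - c) / 2 + y * Complex.I))⁻¹) :
    Integrable (fun p : ℝ × ℝ => productIntegrand K e A B (c + p.1 * Complex.I) (s p.2))
      (volume.prod (volume.restrict S)) := by
  obtain ⟨D, hD0, hD⟩ := exists_norm_inv_sub_le hca η hce
  have h3 := (h2.comp_mul_left' (R := -1 / 2) (by norm_num)).norm.mul_prod h1.norm
  refine (h3.const_mul (|K| * D * (1 / 2))).mono' ?_ ?_
  · refine Measurable.aestronglyMeasurable ?_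
    unfold productIntegrand
    refine Measurable.mul (Measurable.mul (Measurable.mul measurable_const
      (hA.comp (by fun_prop))) (hB.comp (by fun_prop))) (by fun_prop)
  · have hrw : (volume : Measure ℝ).prod (volume.restrict S) =
        (volume.prod volume).restrict (univ ×ˢ S) := by
      rw [← Measure.prod_restrict, Measure.restrict_univ]
    rw [hrw]
    refine (ae_restrict_mem (MeasurableSet.univ.prod hS)).mono fun p hp => ?_
    have e1 := hD (s p.2) (c + p.1 * Complex.I) (hsa _ hp.2) (hsη _ hp.2) (by simp)
    have e2 : ((e : ℂ) - 2 - c) / 2 + ((-1 / 2 * p.1 : ℝ) : ℂ) * Complex.I =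
        (e - 2 - (c + p.1 * Complex.I)) / 2 := by push_cast; ring
    rw [productIntegrand, norm_mul, norm_mul, norm_mul, Complex.norm_real, Real.norm_eq_abs,
      e2, show (1 + (e - 2 - (c + p.1 * Complex.I)) / 2 : ℂ) = (e - (c + p.1 * Complex.I)) / 2 by
        ring, inv_div, norm_mul, norm_div, Complex.norm_ofNat]
    rw [norm_inv] at e1
    calc _ ≤ |K| * ‖A ((s p.2 - e) / 2)‖ * ‖B ((e - 2 - (c + p.1 * Complex.I)) / 2)‖ *
          (D * ‖((e : ℂ) - (c + p.1 * Complex.I))⁻¹‖) := by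
          rw [norm_inv]
          gcongr
      _ = _ := by rw [norm_inv]; ring

theorem hairpinAbsConv_productIntegrand {K e c a η : ℝ} {A B : ℂ → ℂ} (hA : Measurable A)
    (hB : Measurable B) (hca : c < a) (hce : c < e) (hη : 0 ≤ η)
    (h1 : IntegrableOn (fun y : ℝ => A ((a + y * Complex.I - e) / 2)) (Icc (-η) η))
    (h2 : IntegrableOn (fun v : ℝ => A ((v + η * Complex.I - e) / 2)) (Ioi a))
    (h3 : IntegrableOn (fun v : ℝ => A ((v - η * Complex.I - e) / 2)) (Ioi a))
    (hint : Integrable fun y : ℝ => B ((e - 2 - c) / 2 + y * Complex.I) *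
      (1 + ((e - 2 - c) / 2 + y * Complex.I))⁻¹) :
    HairpinAbsConv c a η (productIntegrand K e A B) := by
  refine ⟨?_, ?_, ?_⟩
  · exact integrable_productIntegrand hA hB hca hce (s := fun y : ℝ => a + y * Complex.I) (η := η)
      (by fun_prop) measurableSet_Icc (by simp) (fun v hv => by simpa using abs_le.2 hv) h1 hint
  · exact integrable_productIntegrand hA hB hca hce (s := fun v : ℝ => v + η * Complex.I) (η := η)
      (by fun_prop) measurableSet_Ioi (fun v hv => by simpa using le_of_lt hv)
      (fun v hv => by simp [abs_of_nonneg hη]) h2 hint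
  · exact integrable_productIntegrand hA hB hca hce (s := fun v : ℝ => v - η * Complex.I) (η := η)
      (by fun_prop) measurableSet_Ioi (fun v hv => by simpa using le_of_lt hv)
      (fun v hv => by simp [abs_of_nonneg hη]) h3 hint

/-- `A` need only agree off the real axis, which the contour meets in two points, with a function
that is continuous on the contour. -/
theorem rectangleAbsConv_productIntegrand {K e c a b η : ℝ} {A h B : ℂ → ℂ} (hA : Measurable A)
    (hB : Measurable B) (hca : c < a) (hce : c < e) (hab : a ≤ b) (hη : 0 < η)
    (hAh : ∀ s : ℂ, s.im ≠ 0 → A ((s - e) / 2) = h s)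
    (hh : ∀ s : ℂ, OnRectangle a b η s → ContinuousAt h s)
    (hint : Integrable fun y : ℝ => B ((e - 2 - c) / 2 + y * Complex.I) *
      (1 + ((e - 2 - c) / 2 + y * Complex.I))⁻¹) :
    RectangleAbsConv c a b η (productIntegrand K e A B) := by
  have hne : ∀ᵐ y : ℝ, y ≠ 0 := Measure.ae_ne volume 0
  have hcont : ∀ (s : ℝ → ℂ), Continuous s → ∀ (x₁ x₂ : ℝ), x₁ ≤ x₂ →
      (∀ x ∈ Icc x₁ x₂, OnRectangle a b η (s x)) → (∀ᵐ x : ℝ, (s x).im ≠ 0) →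
      IntegrableOn (fun x => A ((s x - e) / 2)) (Icc x₁ x₂) := by
    intro s hs x₁ x₂ _ hx him
    have h1 : IntegrableOn (fun x => h (s x)) (Icc x₁ x₂) := by
      refine ContinuousOn.integrableOn_Icc fun x hx' => ContinuousAt.continuousWithinAt ?_
      exact ContinuousAt.comp (f := s) (hh _ (hx x hx')) hs.continuousAt
    refine h1.congr ?_
    exact (ae_restrict_of_ae him).mono fun x hx' => (hAh _ hx').symm
  have hηη : -η ≤ η := by linarith
  refine ⟨?_, ?_, ?_, ?_⟩
  · refine integrable_productIntegrand hA hB hca hce (s := fun y : ℝ => a + y * Complex.I) (η := η)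
      (by fun_prop) measurableSet_Icc (by simp) (fun v hv => by simpa using abs_le.2 hv)
      (hcont _ (by fun_prop) _ _ hηη (fun y hy => ?_) ?_) hint
    · exact onRectangle_left hab hη.le (by rwa [uIcc_of_le hηη])
    · simpa using hne
  · refine integrable_productIntegrand hA hB hca hce (s := fun v : ℝ => v + η * Complex.I) (η := η)
      (by fun_prop) measurableSet_Icc (fun v hv => by simpa using hv.1)
      (fun v hv => by simp [abs_of_pos hη])
      (hcont _ (by fun_prop) _ _ hab (fun y hy => ?_) ?_) hint
    · exact onRectangle_top hab hη.le (by rwa [uIcc_of_le hab])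
    · simp [hη.ne']
  · refine integrable_productIntegrand hA hB hca hce (s := fun y : ℝ => b + y * Complex.I) (η := η)
      (by fun_prop) measurableSet_Icc (by simp [hab]) (fun v hv => by simpa using abs_le.2 hv)
      (hcont _ (by fun_prop) _ _ hηη (fun y hy => ?_) ?_) hint
    · exact onRectangle_right hab hη.le (by rwa [uIcc_of_le hηη])
    · simpa using hne
  · refine integrable_productIntegrand hA hB hca hce (s := fun v : ℝ => v - η * Complex.I) (η := η)
      (by fun_prop) measurableSet_Icc (fun v hv => by simpa using hv.1)
      (fun v hv => by simp [abs_of_pos hη])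
      (hcont _ (by fun_prop) _ _ hab (fun y hy => ?_) ?_) hint
    · exact onRectangle_bottom hab hη.le (by rwa [uIcc_of_le hab])
    · simp [hη.ne']

theorem hairpinAbsConv_regFactor_gammaFactor {q : ℕ} {γ : Fin (q + 1) → ℝ} {δ : ℝ}
    (hδ : -1 / 2 ≤ δ) (hδ' : δ ≤ 0) (hγ0 : γ 0 = 2 * δ + 1 / 2) (hγ : ∀ j, δ ≤ γ j) {X Y : ℝ}
    (hX : 0 < X) (hY : 0 < Y) {K e c a η : ℝ} (he : e = 2 * δ + 1) (hc : -1 < c)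
    (hc' : c < -1 / 2) (hca : c < a) (ha : a < 0) (hη : 0 < η) :
    HairpinAbsConv c a η (productIntegrand K e
      (fun σ => Complex.Gamma (-σ) * regFactor γ X σ) (gammaFactor γ Y)) := by
  have hA : Measurable fun σ => Complex.Gamma (-σ) * regFactor γ X σ :=
    (measurable_Gamma.comp measurable_neg).mul (measurable_regFactor γ hX)
  obtain ⟨C₁, hC₁, h₁⟩ := exists_norm_Gamma_le (-((a - e) / 2)) (η / 2) (half_pos hη)
  obtain ⟨C₂, hC₂, h₂⟩ := exists_norm_regFactor_le γ hX ((a - e) / 2) (η / 2)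
  have hor : ∀ s : ℝ → ℂ, Measurable s → (∀ v, (s v).re = v) → (∀ v, |(s v).im| = η) →
      IntegrableOn (fun v : ℝ => Complex.Gamma (-((s v - e) / 2)) * regFactor γ X ((s v - e) / 2))
        (Ioi a) := by
    intro s hs hre him
    refine Integrable.mono' (((exp_neg_integrableOn_Ioi a (b := 1 / 2)
      (by norm_num)).const_mul (C₁ * C₂ * Real.exp (e / 2))))
      (hA.comp (by fun_prop : Measurable fun v : ℝ => (s v - e) / 2)).aestronglyMeasurable
      ((ae_restrict_mem measurableSet_Ioi).mono fun v hv => ?_)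
    have r1 : ((s v - e) / 2 : ℂ).re = (v - e) / 2 := by simp [hre]
    have r2 : |((s v - e) / 2 : ℂ).im| = η / 2 := by simp [abs_div, him]
    have hv' : a < v := hv
    have g1 := h₁ (-((s v - e) / 2)) (by rw [Complex.neg_re, r1]; linarith)
      (by rw [Complex.neg_im, abs_neg, r2]) (by rw [Complex.neg_im, abs_neg, r2])
    have g2 := h₂ ((s v - e) / 2) (by rw [r1]; linarith) r2.le
    rw [r1] at g2
    rw [norm_mul]
    calc _ ≤ C₁ * (C₂ * Real.exp (-((v - e) / 2))) := by gcongr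
      _ = _ := by
        rw [show -((v - e) / 2) = e / 2 + -(1 / 2) * v by ring, Real.exp_add]
        ring
  refine hairpinAbsConv_productIntegrand hA (measurable_gammaFactor γ Y) hca (by linarith) hη.le
    ?_ (hor _ (by fun_prop) (by simp) (by simp [abs_of_pos hη]))
    (hor _ (by fun_prop) (by simp) (by simp [abs_of_pos hη])) ?_
  · refine (Continuous.continuousOn ?_).integrableOn_Icc
    refine continuous_iff_continuousAt.2 fun y => ?_
    refine ContinuousAt.mul ?_ ?_
    · refine ContinuousAt.comp (g := Complex.Gamma)
        (differentiableAt_Gamma_of_re_pos ?_).continuousAt (by fun_prop)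
      simp
      linarith
    · exact ((differentiable_regFactor γ hX).continuous.comp (by fun_prop)).continuousAt
  · have := integrable_gammaFactor_mul_inv hδ hδ' hγ0 hγ (ρ := (e - 2 - c) / 2) (by linarith)
      (by linarith) hY 0
    simpa using this

theorem rectangleAbsConv_regFactor_gammaFactor {q : ℕ} {γ : Fin (q + 1) → ℝ} {δ : ℝ}
    (hδ : -1 / 2 ≤ δ) (hδ' : δ ≤ 0) (hγ0 : γ 0 = 2 * δ + 1 / 2) (hγ : ∀ j, δ ≤ γ j) {X Y : ℝ}
    (hX : 0 < X) (hY : 0 < Y) (n : ℕ) {K e c a b η : ℝ} (he : e = 2 * δ + 1) (hc : -1 < c)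
    (hca : c < a) (ha : a < 0) (hb : 2 * (n : ℝ) - 2 + e < b) (hab : a ≤ b)
    (hη : 0 < η) :
    RectangleAbsConv c a b η (productIntegrand K e
      (fun σ => Complex.Gamma (-σ) / Complex.Gamma (n - σ) * regFactor γ X σ)
      (fun w => gammaFactor γ Y w * Complex.Gamma (n + 1 + w))) := by
  refine rectangleAbsConv_productIntegrand (h := fun s => (∏ k ∈ Finset.range n,
    (k - (s - e) / 2 : ℂ))⁻¹ * regFactor γ X ((s - e) / 2)) ?_ ?_ hca (by linarith) hab hη ?_ ?_ ?_
  · exact ((measurable_Gamma.comp measurable_neg).div (measurable_Gamma.comp (by fun_prop))).mul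
      (measurable_regFactor γ hX)
  · exact (measurable_gammaFactor γ Y).mul (measurable_Gamma.comp (by fun_prop))
  · intro s hs
    rw [Gamma_neg_div_Gamma n (by simpa using hs)]
  · intro s hs
    refine ContinuousAt.mul (ContinuousAt.inv₀ (by fun_prop) ?_)
      (ContinuousAt.comp (differentiable_regFactor γ hX _).continuousAt (by fun_prop))
    refine Finset.prod_ne_zero_iff.2 fun k hk h0 => ?_
    have hk' : (k : ℝ) + 1 ≤ n := by exact_mod_cast Finset.mem_range.1 hk
    have hk0 : (0 : ℝ) ≤ k := k.cast_nonneg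
    have h1 : s = ((2 * k + e : ℝ) : ℂ) := by push_cast; linear_combination -2 * h0
    have h2 := hs.2.2.2
    rw [h1, Complex.ofReal_re, Complex.ofReal_im, abs_zero] at h2
    rcases h2 with h2 | h2 | h2 <;> linarith
  · have := integrable_gammaFactor_mul_Gamma_mul_inv hδ hδ' hγ0 hγ hY n (ρ := (e - 2 - c) / 2)
      (by linarith) (by linarith) 0
    simpa using this

/-! ### Factorization of the integrands -/

theorem prod_range_two_mul (F : ℕ → ℂ) (M : ℕ) :
    ∏ k ∈ Finset.range (2 * M), F k = ∏ m ∈ Finset.range M, F (2 * m) * F (2 * m + 1) := by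
  induction M with
  | zero => simp
  | succ M ih =>
    rw [show 2 * (M + 1) = 2 * M + 1 + 1 by ring, Finset.prod_range_succ, Finset.prod_range_succ,
      Finset.prod_range_succ, ih, mul_assoc]

theorem splitIndex_zero {M : ℕ} (ν : Fin M → ℕ) (ε : ℝ) : splitIndex ν ε 0 = 0 := by
  simp [splitIndex, extendedIndex]

theorem splitIndex_one {M : ℕ} (ν : Fin M → ℕ) (ε : ℝ) : splitIndex ν ε 1 = ε / 2 := by
  simp [splitIndex, extendedIndex]

theorem splitIndex_ge {M : ℕ} (ν : Fin M → ℕ) {ε δ : ℝ} (hδ : δ ≤ 0) (hε : 2 * δ ≤ ε)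
    (j : Fin (2 * M + 1 + 1)) : δ ≤ splitIndex ν ε j := by
  have h : ∀ m, 0 ≤ extendedIndex ν m := by
    intro m
    refine Fin.cases ?_ (fun m => ?_) m <;> simp [extendedIndex]
  have := h ⟨(j : ℕ) / 2, by omega⟩
  rw [splitIndex]
  split_ifs <;> linarith

/-- The indices after the leading `ν_0/2 = 0`: one single `ε/2`, and a pair for every `ν_m`. -/
theorem prod_splitIndex_succ {M : ℕ} (ν : Fin M → ℕ) (ε : ℝ) (f : ℝ → ℂ) :
    ∏ j : Fin (2 * M + 1), f (splitIndex ν ε j.succ) =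
      f (ε / 2) * ∏ m, f (ν m / 2) * f ((ν m + ε) / 2) := by
  set F : ℕ → ℂ := fun k =>
    if h : k + 1 < 2 * M + 1 + 1 then f (splitIndex ν ε ⟨k + 1, h⟩) else 1 with hF
  have h1 : ∀ j : Fin (2 * M + 1), f (splitIndex ν ε j.succ) = F j := by
    intro j
    simp only [hF, Nat.add_lt_add_right j.isLt 1, dif_pos]
    rfl
  have h2 : F 0 = f (ε / 2) := by
    rw [← splitIndex_one ν ε, hF]
    simp only [zero_add, show 1 < 2 * M + 1 + 1 by omega, dif_pos]
    rfl
  have h3 : ∀ m : Fin M, F (2 * (m : ℕ) + 1) = f (ν m / 2) := by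
    intro m
    have e1 : (2 * (m : ℕ) + 1 + 1) / 2 = m + 1 := by omega
    have e2 : (2 * (m : ℕ) + 1 + 1) % 2 = 0 := by omega
    have e3 : 2 * (m : ℕ) + 1 + 1 < 2 * M + 1 + 1 := by omega
    have e4 : (⟨(m : ℕ) + 1, by omega⟩ : Fin (M + 1)) = m.succ := rfl
    simp only [hF, e3, dif_pos, splitIndex, e1, e2, if_true, e4, extendedIndex, Fin.cons_succ,
      add_zero]
  have h4 : ∀ m : Fin M, F (2 * (m : ℕ) + 1 + 1) = f ((ν m + ε) / 2) := by
    intro m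
    have e1 : (2 * (m : ℕ) + 1 + 1 + 1) / 2 = m + 1 := by omega
    have e2 : (2 * (m : ℕ) + 1 + 1 + 1) % 2 = 1 := by omega
    have e3 : 2 * (m : ℕ) + 1 + 1 + 1 < 2 * M + 1 + 1 := by omega
    have e4 : (⟨(m : ℕ) + 1, by omega⟩ : Fin (M + 1)) = m.succ := rfl
    simp only [hF, e3, dif_pos, splitIndex, e1, e2, e4, extendedIndex, Fin.cons_succ,
      one_ne_zero, if_false]
  simp only [h1]
  rw [← Finset.prod_range, Finset.prod_range_succ', h2, prod_range_two_mul, mul_comm,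
    Finset.prod_range]
  simp only [h3, h4]

/-- The duplication formula splits `Γ(ν + z + 1)` into two Gamma functions of half the argument.
It holds without exceptions: at a pole both sides are `0`, the value of
`Complex.Gamma` there. -/
theorem Gamma_add_one_div_eq (ν s t : ℂ) :
    Complex.Gamma (ν + t + 1) / Complex.Gamma (ν + s + 1) = (2 : ℂ) ^ (t - s) *
      (Complex.Gamma ((ν + t + 1) / 2) * Complex.Gamma ((ν + t + 2) / 2)) *
      (Complex.Gamma ((ν + s + 1) / 2) * Complex.Gamma ((ν + s + 2) / 2))⁻¹ := by
  have h : ∀ z : ℂ, Complex.Gamma ((ν + z + 1) / 2) * Complex.Gamma ((ν + z + 2) / 2) =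
      Complex.Gamma (ν + z + 1) * (2 : ℂ) ^ (-ν - z) * (√Real.pi : ℝ) := by
    intro z
    have := Complex.Gamma_mul_Gamma_add_half ((ν + z + 1) / 2)
    rw [show (ν + z + 1) / 2 + 1 / 2 = (ν + z + 2) / 2 by ring,
      show 2 * ((ν + z + 1) / 2) = ν + z + 1 by ring,
      show 1 - (ν + z + 1) = -ν - z by ring] at this
    exact this
  have hpi : ((√Real.pi : ℝ) : ℂ) ≠ 0 := by
    exact_mod_cast (Real.sqrt_pos.2 Real.pi_pos).ne'
  have h2 : (2 : ℂ) ^ (-ν - t) ≠ 0 := Complex.cpow_ne_zero_iff.2 (Or.inl two_ne_zero)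
  have h3 : (2 : ℂ) ^ (t - s) ≠ 0 := Complex.cpow_ne_zero_iff.2 (Or.inl two_ne_zero)
  rw [h, h, show -ν - s = (t - s) + (-ν - t) by ring, Complex.cpow_add _ _ two_ne_zero,
    div_eq_mul_inv]
  simp only [mul_inv]
  field_simp

theorem cpow_sq_div_two_pow {p : ℝ} (hp : 0 < p) (M : ℕ) (z : ℂ) :
    ((p ^ 2 / 2 ^ (2 * M) : ℝ) : ℂ) ^ z = (p : ℂ) ^ (2 * z) * ((2 : ℂ) ^ (-2 * z)) ^ M := by
  have h2 : (0 : ℝ) < 2 ^ (2 * M) := by positivity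
  have h3 : Real.log (p ^ 2 / 2 ^ (2 * M)) = 2 * Real.log p - 2 * M * Real.log 2 := by
    rw [Real.log_div (by positivity) h2.ne', Real.log_pow, Real.log_pow]
    push_cast
    ring
  have h4 : ((p ^ 2 / 2 ^ (2 * M) : ℝ) : ℂ) ≠ 0 := by
    exact_mod_cast (div_pos (by positivity) h2).ne'
  rw [Complex.cpow_def_of_ne_zero h4, Complex.cpow_def_of_ne_zero (by exact_mod_cast hp.ne'),
    Complex.cpow_def_of_ne_zero two_ne_zero, ← Complex.ofReal_log (by positivity), h3,
    ← Complex.ofReal_log hp.le, ← Complex.exp_nat_mul, ← Complex.exp_add,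
    ← Complex.ofReal_ofNat 2, ← Complex.ofReal_log zero_le_two]
  congr 1
  push_cast
  ring

theorem regFactor_splitIndex {M : ℕ} (ν : Fin M → ℕ) (ε : ℝ) {x : ℝ} (hx : x ≠ 0) (σ : ℂ) :
    regFactor (fun j => splitIndex ν ε j.succ) (x ^ 2 / 2 ^ (2 * M)) σ =
      ((|x| : ℝ) : ℂ) ^ (2 * σ) * ((2 : ℂ) ^ (-2 * σ)) ^ M *
        ((Complex.Gamma (1 + ε / 2 + σ))⁻¹ * ∏ m, (Complex.Gamma (1 + (ν m + ε) / 2 + σ) *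
          Complex.Gamma (1 + ν m / 2 + σ))⁻¹) := by
  rw [regFactor, ← sq_abs x, cpow_sq_div_two_pow (abs_pos.2 hx),
    prod_splitIndex_succ ν ε fun r => (Complex.Gamma (1 + r + σ))⁻¹]
  simp only [mul_inv]
  push_cast
  simp only [mul_comm]

theorem gammaFactor_splitIndex {M : ℕ} (ν : Fin M → ℕ) (ε : ℝ) {y : ℝ} (hy : y ≠ 0) (w : ℂ) :
    gammaFactor (fun j => splitIndex ν ε j.succ) (y ^ 2 / 2 ^ (2 * M)) w =
      ((|y| : ℝ) : ℂ) ^ (2 * w) * ((2 : ℂ) ^ (-2 * w)) ^ M * (Complex.Gamma (1 + w))⁻¹ *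
        (Complex.Gamma (ε / 2 - w) * ∏ m, (Complex.Gamma ((ν m + ε) / 2 - w) *
          Complex.Gamma (ν m / 2 - w))) := by
  rw [gammaFactor, ← sq_abs y, cpow_sq_div_two_pow (abs_pos.2 hy),
    prod_splitIndex_succ ν ε fun r => Complex.Gamma (r - w)]
  push_cast
  simp only [mul_comm]

theorem evenIntegrand_eq_productIntegrand {M : ℕ} (ν : Fin M → ℕ) {x y : ℝ} (hx : x ≠ 0)
    (hy : y ≠ 0) (t s : ℂ) :
    evenIntegrand ν x y t s = productIntegrand (|y| / 2 ^ (2 * M)) 0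
      (fun σ => Complex.Gamma (-σ) *
        regFactor (fun j => splitIndex ν (-1) j.succ) (x ^ 2 / 2 ^ (2 * M)) σ)
      (gammaFactor (fun j => splitIndex ν (-1) j.succ) (y ^ 2 / 2 ^ (2 * M))) t s := by
  have hy0 : ((|y| : ℝ) : ℂ) ≠ 0 := by exact_mod_cast abs_ne_zero.2 hy
  have h1 : ((|y| : ℝ) : ℂ) ^ (-t - 1) = |y| * ((|y| : ℝ) : ℂ) ^ (-t - 2) := by
    rw [show -t - 1 = 1 + (-t - 2) by ring, Complex.cpow_add _ _ hy0, Complex.cpow_one]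
  have h2 : ((2 : ℂ) ^ (t - s)) ^ M =
      ((2 : ℂ) ^ (-s)) ^ M * ((2 : ℂ) ^ (2 + t)) ^ M * (2 ^ (2 * M))⁻¹ := by
    rw [show t - s = -s + (2 + t) - (2 : ℕ) by push_cast; ring, Complex.cpow_sub _ _ two_ne_zero,
      Complex.cpow_natCast, Complex.cpow_add _ _ two_ne_zero, div_pow, ← pow_mul, mul_pow,
      div_eq_mul_inv]
  have r1 : 1 + ((-1 : ℝ) : ℂ) / 2 + (s - (0 : ℝ)) / 2 = (s + 1) / 2 := by push_cast; ring
  have r2 : ∀ n : ℂ, 1 + (n + ((-1 : ℝ) : ℂ)) / 2 + (s - (0 : ℝ)) / 2 = (n + s + 1) / 2 :=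
    fun n => by push_cast; ring
  have r3 : ∀ n : ℂ, 1 + n / 2 + (s - (0 : ℝ)) / 2 = (n + s + 2) / 2 := fun n => by push_cast; ring
  have r4 : ((-1 : ℝ) : ℂ) / 2 - ((0 : ℝ) - 2 - t) / 2 = (t + 1) / 2 := by push_cast; ring
  have r5 : ∀ n : ℂ, (n + ((-1 : ℝ) : ℂ)) / 2 - ((0 : ℝ) - 2 - t) / 2 = (n + t + 1) / 2 :=
    fun n => by push_cast; ring
  have r6 : ∀ n : ℂ, n / 2 - ((0 : ℝ) - 2 - t) / 2 = (n + t + 2) / 2 := fun n => by push_cast; ring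
  have r7 : -((s - (0 : ℝ)) / 2) = -s / 2 := by push_cast; ring
  have r8 : 1 + (((0 : ℝ) : ℂ) - 2 - t) / 2 = -t / 2 := by push_cast; ring
  have r9 : 2 * ((s - (0 : ℝ)) / 2) = s := by push_cast; ring
  have r10 : 2 * ((((0 : ℝ) : ℂ) - 2 - t) / 2) = -t - 2 := by push_cast; ring
  have r11 : -2 * ((s - (0 : ℝ)) / 2) = -s := by push_cast; ring
  have r12 : -2 * ((((0 : ℝ) : ℂ) - 2 - t) / 2) = 2 + t := by push_cast; ring
  rw [evenIntegrand, productIntegrand, regFactor_splitIndex ν _ hx, gammaFactor_splitIndex ν _ hy]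
  simp only [r1, r2, r3, r4, r5, r6, r7, r8, r9, r10, r11, r12]
  simp only [Gamma_add_one_div_eq]
  simp only [Finset.prod_mul_distrib, Finset.prod_const, Finset.card_univ, Fintype.card_fin,
    mul_inv, h1, h2, div_eq_mul_inv]
  push_cast
  ring

theorem oddIntegrand_eq_productIntegrand {M : ℕ} (ν : Fin M → ℕ) {x y : ℝ} (hx : x ≠ 0)
    (hy : y ≠ 0) (t s : ℂ) :
    oddIntegrand ν x y t s = productIntegrand (|x| / 2 ^ (2 * M)) 1
      (fun σ => Complex.Gamma (-σ) *
        regFactor (fun j => splitIndex ν 1 j.succ) (x ^ 2 / 2 ^ (2 * M)) σ)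
      (gammaFactor (fun j => splitIndex ν 1 j.succ) (y ^ 2 / 2 ^ (2 * M))) t s := by
  have hx0 : ((|x| : ℝ) : ℂ) ≠ 0 := by exact_mod_cast abs_ne_zero.2 hx
  have h1 : ((|x| : ℝ) : ℂ) ^ s = |x| * ((|x| : ℝ) : ℂ) ^ (s - 1) := by
    nth_rewrite 1 [show s = 1 + (s - 1) by ring]
    rw [Complex.cpow_add _ _ hx0, Complex.cpow_one]
  have h2 : ((2 : ℂ) ^ (t - s)) ^ M =
      ((2 : ℂ) ^ (1 - s)) ^ M * ((2 : ℂ) ^ (1 + t)) ^ M * (2 ^ (2 * M))⁻¹ := by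
    rw [show t - s = 1 - s + (1 + t) - (2 : ℕ) by push_cast; ring,
      Complex.cpow_sub _ _ two_ne_zero, Complex.cpow_natCast, Complex.cpow_add _ _ two_ne_zero,
      div_pow, ← pow_mul, mul_pow, div_eq_mul_inv]
  have r1 : 1 + ((1 : ℝ) : ℂ) / 2 + (s - (1 : ℝ)) / 2 = (s + 2) / 2 := by push_cast; ring
  have r2 : ∀ n : ℂ, 1 + (n + ((1 : ℝ) : ℂ)) / 2 + (s - (1 : ℝ)) / 2 = (n + s + 2) / 2 :=
    fun n => by push_cast; ring
  have r3 : ∀ n : ℂ, 1 + n / 2 + (s - (1 : ℝ)) / 2 = (n + s + 1) / 2 := fun n => by push_cast; ring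
  have r4 : ((1 : ℝ) : ℂ) / 2 - ((1 : ℝ) - 2 - t) / 2 = (t + 2) / 2 := by push_cast; ring
  have r5 : ∀ n : ℂ, (n + ((1 : ℝ) : ℂ)) / 2 - ((1 : ℝ) - 2 - t) / 2 = (n + t + 2) / 2 :=
    fun n => by push_cast; ring
  have r6 : ∀ n : ℂ, n / 2 - ((1 : ℝ) - 2 - t) / 2 = (n + t + 1) / 2 := fun n => by push_cast; ring
  have r7 : -((s - (1 : ℝ)) / 2) = (1 - s) / 2 := by push_cast; ring
  have r8 : 1 + (((1 : ℝ) : ℂ) - 2 - t) / 2 = (1 - t) / 2 := by push_cast; ring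
  have r9 : 2 * ((s - (1 : ℝ)) / 2) = s - 1 := by push_cast; ring
  have r10 : 2 * ((((1 : ℝ) : ℂ) - 2 - t) / 2) = -t - 1 := by push_cast; ring
  have r11 : -2 * ((s - (1 : ℝ)) / 2) = 1 - s := by push_cast; ring
  have r12 : -2 * ((((1 : ℝ) : ℂ) - 2 - t) / 2) = 1 + t := by push_cast; ring
  rw [oddIntegrand, productIntegrand, regFactor_splitIndex ν _ hx, gammaFactor_splitIndex ν _ hy]
  simp only [r1, r2, r3, r4, r5, r6, r7, r8, r9, r10, r11, r12]
  simp only [Gamma_add_one_div_eq]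
  simp only [Finset.prod_mul_distrib, Finset.prod_const, Finset.card_univ, Fintype.card_fin,
    mul_inv, h1, h2, div_eq_mul_inv]
  push_cast
  ring

theorem finiteEvenIntegrand_eq_productIntegrand {M : ℕ} (ν : Fin M → ℕ) (n : ℕ) {x y : ℝ}
    (hx : x ≠ 0) (hy : y ≠ 0) (t s : ℂ) :
    finiteEvenIntegrand ν n x y t s = productIntegrand (|y| / 2 ^ (2 * M)) 0
      (fun σ => Complex.Gamma (-σ) / Complex.Gamma (n - σ) *
        regFactor (fun j => splitIndex ν (-1) j.succ) (x ^ 2 / 2 ^ (2 * M)) σ)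
      (fun w => gammaFactor (fun j => splitIndex ν (-1) j.succ) (y ^ 2 / 2 ^ (2 * M)) w *
        Complex.Gamma (n + 1 + w)) t s := by
  rw [finiteEvenIntegrand, evenIntegrand_eq_productIntegrand ν hx hy, productIntegrand,
    productIntegrand, show (n : ℂ) - (s - (0 : ℝ)) / 2 = (2 * n - s) / 2 by push_cast; ring,
    show (n : ℂ) + 1 + ((0 : ℝ) - 2 - t) / 2 = (2 * n - t) / 2 by push_cast; ring]
  ring

theorem finiteOddIntegrand_eq_productIntegrand {M : ℕ} (ν : Fin M → ℕ) (n : ℕ) {x y : ℝ}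
    (hx : x ≠ 0) (hy : y ≠ 0) (t s : ℂ) :
    finiteOddIntegrand ν n x y t s = productIntegrand (|x| / 2 ^ (2 * M)) 1
      (fun σ => Complex.Gamma (-σ) / Complex.Gamma (n - σ) *
        regFactor (fun j => splitIndex ν 1 j.succ) (x ^ 2 / 2 ^ (2 * M)) σ)
      (fun w => gammaFactor (fun j => splitIndex ν 1 j.succ) (y ^ 2 / 2 ^ (2 * M)) w *
        Complex.Gamma (n + 1 + w)) t s := by
  rw [finiteOddIntegrand, oddIntegrand_eq_productIntegrand ν hx hy, productIntegrand,
    productIntegrand, show (n : ℂ) - (s - (1 : ℝ)) / 2 = (2 * n - s + 1) / 2 by push_cast; ring,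
    show (n : ℂ) + 1 + ((1 : ℝ) - 2 - t) / 2 = (2 * n - t + 1) / 2 by push_cast; ring]
  ring

/-! ### Kernels with factorized integrand -/

/-- Both sides are the same series of residues. -/
theorem kernel_eq_meijerKernel {q : ℕ} {μ : Fin (q + 1 + 1) → ℝ} {δ : ℝ} (h0 : μ 0 = 0)
    (hδ : -1 / 2 ≤ δ) (hδ' : δ ≤ 0) (hγ0 : μ 1 = 2 * δ + 1 / 2)
    (hγ : ∀ j : Fin (q + 1), δ ≤ μ j.succ) {X Y : ℝ} (hX : 0 < X) (hY : 0 < Y)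
    {e c a η : ℝ} (he : e = 2 * δ + 1) (hc' : c < -1 / 2) (hc : -1 < c)
    (hca : c < a) (ha : a < 0) (hη : 0 < η) (K : ℝ) :
    (1 / (2 * (2 * Real.pi * Complex.I) ^ 2) * verticalIntegral c fun t =>
      hairpinIntegral a η fun s => productIntegrand K e
        (fun σ => Complex.Gamma (-σ) * regFactor (fun j => μ j.succ) X σ)
        (gammaFactor (fun j => μ j.succ) Y) t s) = K * meijerKernel μ X Y := by
  rw [verticalIntegral_hairpinIntegral_productIntegrand]
  have h1 := (hasSum_meijerKernel (ρ := (e - 2 - c) / 2) h0 hδ hδ' hγ0 hγ (by linarith)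
    (by linarith) hX hY).2
  have h2 := hasSum_verticalIntegral_hairpinIntegral (ρ := (e - 2 - c) / 2) hδ hδ' hγ0 hγ
    (by linarith) (by linarith) hX hY (a := (a - e) / 2) (η := η / 2) (by linarith) (by linarith)
    (by linarith)
  have hpi : (2 * Real.pi * Complex.I : ℂ) ≠ 0 := Complex.two_pi_I_ne_zero
  have h3 := h1.mul_left ((2 * Real.pi * Complex.I : ℂ) ^ 2)
  have h4 : (fun k : ℕ => (2 * Real.pi * Complex.I : ℂ) ^ 2 *
      (residueCoeff (fun j => μ j.succ) X k * (1 / (2 * Real.pi * Complex.I) *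
        verticalIntegral ((e - 2 - c) / 2) fun w =>
          gammaFactor (fun j => μ j.succ) Y w * (k + 1 + w)⁻¹))) =
      fun k : ℕ => 2 * Real.pi * Complex.I * residueCoeff (fun j => μ j.succ) X k *
        verticalIntegral ((e - 2 - c) / 2) fun w =>
          gammaFactor (fun j => μ j.succ) Y w * (k + 1 + w)⁻¹ := by
    ext k
    field_simp
  rw [h4] at h3
  simp only [mul_assoc (Complex.Gamma _)]
  rw [← h3.unique h2]
  field_simp

/-- The scaling limit for the integrands of the shape `productIntegrand`. -/
theorem tendsto_rescaled_kernel {q : ℕ} {γ : Fin (q + 1) → ℝ} {δ : ℝ} (hδ : -1 / 2 ≤ δ)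
    (hδ' : δ ≤ 0) (hγ0 : γ 0 = 2 * δ + 1 / 2) (hγ : ∀ j, δ ≤ γ j) {X Y : ℝ} (hX : 0 < X)
    (hY : 0 < Y) {e c a η : ℝ} (he : e = 2 * δ + 1) (hc : -1 < c) (hc' : c < -1 / 2)
    (hca : c < a) (ha : a < 0) (hη : 0 < η) {cn an bn ηn : ℕ → ℝ}
    (hfin : ∀ n : ℕ, 1 ≤ n → -1 < cn n ∧ cn n < 0 ∧ cn n < an n ∧ an n < 0 ∧
      2 * (n : ℝ) - 1 < bn n ∧ 0 < ηn n) (K : ℝ) :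
    Tendsto (fun n : ℕ => (n : ℂ)⁻¹ * verticalIntegral (cn n) fun t =>
      rectangleIntegral (an n) (bn n) (ηn n) fun s => productIntegrand K e
        (fun σ => Complex.Gamma (-σ) / Complex.Gamma (n - σ) * regFactor γ (X / n) σ)
        (fun w => gammaFactor γ (Y / n) w * Complex.Gamma (n + 1 + w)) t s) atTop
      (𝓝 (verticalIntegral c fun t => hairpinIntegral a η fun s => productIntegrand K e
        (fun σ => Complex.Gamma (-σ) * regFactor γ X σ) (gammaFactor γ Y) t s)) := by
  have h := (tendsto_verticalIntegral_rectangleIntegral hδ hδ' hγ0 hγ (ρ := (e - 2 - c) / 2)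
    (by linarith) (by linarith) hX hY (ρn := fun n => (e - 2 - cn n) / 2)
    (a := fun n => (an n - e) / 2) (b := fun n => (bn n - e) / 2) (η := fun n => ηn n / 2)
    (fun n hn => by
      obtain ⟨h1, h2, h3, h4, h5, h6⟩ := hfin n hn
      refine ⟨?_, ?_, ?_, ?_, ?_, ?_⟩ <;> linarith)
    (a₀ := (a - e) / 2) (η₀ := η / 2) (by linarith) (by linarith) (by linarith)).const_mul
      (2 * (K : ℂ))
  simp only [verticalIntegral_hairpinIntegral_productIntegrand,
    verticalIntegral_rectangleIntegral_productIntegrand, mul_assoc] at h ⊢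
  refine h.congr fun n => ?_
  ring

theorem theorem5p1 (M : ℕ) (ν : Fin M → ℕ)
    -- contours of the limiting kernels
    (c a η : ℝ) (hc : -1 < c) (hc' : c < -1 / 2) (hca : c < a) (ha : a < 0) (hη : 0 < η)
    -- contours of the kernels of index `2n`
    (c' a' b' η' : ℕ → ℝ)
    (hfin : ∀ n : ℕ, 1 ≤ n → -1 < c' n ∧ c' n < 0 ∧ c' n < a' n ∧ a' n < 0 ∧
      2 * (n : ℝ) - 1 < b' n ∧ 0 < η' n)
    (x y : ℝ) (hx : x ≠ 0) (hy : y ≠ 0) :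
    -- all the double integrals converge absolutely
    (∀ n : ℕ, 1 ≤ n →
      RectangleAbsConv (c' n) (a' n) (b' n) (η' n) (finiteEvenIntegrand ν n x y) ∧
      RectangleAbsConv (c' n) (a' n) (b' n) (η' n) (finiteOddIntegrand ν n x y)) ∧
    HairpinAbsConv c a η (evenIntegrand ν x y) ∧
    HairpinAbsConv c a η (oddIntegrand ν x y) ∧
    -- the limit at the origin
    Tendsto
      (fun n : ℕ => ((1 / √(n : ℝ) : ℝ) : ℂ) *
        finiteKernel ν n (c' n) (a' n) (b' n) (η' n) (x / √(n : ℝ)) (y / √(n : ℝ)))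
      atTop (𝓝 (evenKernel ν c a η x y + oddKernel ν c a η x y)) ∧
    -- the even part as a Meijer G-kernel
    IntervalIntegrable
      (meijerKernelIntegrand (splitIndex ν (-1)) (x ^ 2 / 2 ^ (2 * M)) (y ^ 2 / 2 ^ (2 * M)))
      volume 0 1 ∧
    evenKernel ν c a η x y = ((|y| / 2 ^ (2 * M) : ℝ) : ℂ) *
      meijerKernel (splitIndex ν (-1)) (x ^ 2 / 2 ^ (2 * M)) (y ^ 2 / 2 ^ (2 * M)) ∧
    -- the odd part as a Meijer G-kernel
    IntervalIntegrable
      (meijerKernelIntegrand (splitIndex ν 1) (x ^ 2 / 2 ^ (2 * M)) (y ^ 2 / 2 ^ (2 * M)))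
      volume 0 1 ∧
    oddKernel ν c a η x y = ((Real.sign (x * y) * |x| / 2 ^ (2 * M) : ℝ) : ℂ) *
      meijerKernel (splitIndex ν 1) (x ^ 2 / 2 ^ (2 * M)) (y ^ 2 / 2 ^ (2 * M)) := by
  have hX : 0 < x ^ 2 / 2 ^ (2 * M) := by positivity
  have hY : 0 < y ^ 2 / 2 ^ (2 * M) := by positivity
  have hev : ∀ j : Fin (2 * M + 1), -1 / 2 ≤ splitIndex ν (-1) j.succ := fun j =>
    splitIndex_ge ν (by norm_num) (by norm_num) _
  have hod : ∀ j : Fin (2 * M + 1), 0 ≤ splitIndex ν 1 j.succ := fun j =>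
    splitIndex_ge ν le_rfl (by norm_num) _
  have hev0 : splitIndex ν (-1) 1 = 2 * (-1 / 2) + 1 / 2 := by rw [splitIndex_one]; norm_num
  have hod0 : splitIndex ν 1 1 = 2 * 0 + 1 / 2 := by rw [splitIndex_one]; norm_num
  have hev1 : (0 : ℝ) = 2 * (-1 / 2) + 1 := by norm_num
  have hod1 : (1 : ℝ) = 2 * 0 + 1 := by norm_num
  have hhalf : (-1 / 2 : ℝ) ≤ 0 := by norm_num
  have eqE := evenIntegrand_eq_productIntegrand ν hx hy
  have eqO := oddIntegrand_eq_productIntegrand ν hx hy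
  have eqE' := fun n => finiteEvenIntegrand_eq_productIntegrand ν n hx hy
  have eqO' := fun n => finiteOddIntegrand_eq_productIntegrand ν n hx hy
  refine ⟨fun n hn => ⟨?_, ?_⟩, ?_, ?_, ?_, ?_, ?_, ?_, ?_⟩
  · obtain ⟨h1, h2, h3, h4, h5, h6⟩ := hfin n hn
    have h7 : (1 : ℝ) ≤ n := by exact_mod_cast hn
    rw [show finiteEvenIntegrand ν n x y = _ from funext₂ (eqE' n)]
    exact rectangleAbsConv_regFactor_gammaFactor le_rfl hhalf hev0 hev hX hY n hev1 h1 h3 h4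
      (by linarith) (by linarith) h6
  · obtain ⟨h1, h2, h3, h4, h5, h6⟩ := hfin n hn
    have h7 : (1 : ℝ) ≤ n := by exact_mod_cast hn
    rw [show finiteOddIntegrand ν n x y = _ from funext₂ (eqO' n)]
    exact rectangleAbsConv_regFactor_gammaFactor hhalf le_rfl hod0 hod hX hY n hod1 h1 h3 h4
      (by linarith) (by linarith) h6
  · rw [show evenIntegrand ν x y = _ from funext₂ eqE]
    exact hairpinAbsConv_regFactor_gammaFactor le_rfl hhalf hev0 hev hX hY hev1 hc hc' hca ha hη
  · rw [show oddIntegrand ν x y = _ from funext₂ eqO]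
    exact hairpinAbsConv_regFactor_gammaFactor hhalf le_rfl hod0 hod hX hY hod1 hc hc' hca ha hη
  · have tE := (tendsto_rescaled_kernel le_rfl hhalf hev0 hev hX hY hev1 hc hc' hca ha hη hfin
      (|y| / 2 ^ (2 * M))).const_mul (1 / (2 * (2 * Real.pi * Complex.I) ^ 2) : ℂ)
    have tO := (tendsto_rescaled_kernel hhalf le_rfl hod0 hod hX hY hod1 hc hc' hca ha hη hfin
      (|x| / 2 ^ (2 * M))).const_mul
        ((Real.sign (x * y) : ℂ) / (2 * (2 * Real.pi * Complex.I) ^ 2) : ℂ)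
    have t := tE.add tO
    simp only [← eqE, ← eqO] at t
    refine t.congr' ?_
    filter_upwards [eventually_ge_atTop 1] with n hn
    have hn0 : (0 : ℝ) < n := by exact_mod_cast hn
    have hr : 0 < √(n : ℝ) := Real.sqrt_pos.2 hn0
    have hsq : √(n : ℝ) ^ 2 = n := Real.sq_sqrt hn0.le
    have hsqc : ((√(n : ℝ) : ℝ) : ℂ) ^ 2 = n := by exact_mod_cast congrArg Complex.ofReal hsq
    have hrc : ((√(n : ℝ) : ℝ) : ℂ) ≠ 0 := by exact_mod_cast hr.ne'
    have hsign : Real.sign (x / √(n : ℝ) * (y / √(n : ℝ))) = Real.sign (x * y) := by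
      rw [div_mul_div_comm, ← sq, hsq]
      rcases (mul_ne_zero hx hy).lt_or_gt with h | h
      · rw [Real.sign_of_neg h, Real.sign_of_neg (div_neg_of_neg_of_pos h hn0)]
      · rw [Real.sign_of_pos h, Real.sign_of_pos (div_pos h hn0)]
    have hdiv : ∀ z : ℝ, (z / √(n : ℝ)) ^ 2 / 2 ^ (2 * M) = z ^ 2 / 2 ^ (2 * M) / n := fun z => by
      rw [div_pow, hsq, div_right_comm]
    have habs : ∀ z : ℝ, |z / √(n : ℝ)| = |z| / √(n : ℝ) := fun z => by
      rw [abs_div, abs_of_pos hr]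
    simp only [finiteKernel, finiteEvenKernel, finiteOddKernel, hsign,
      finiteEvenIntegrand_eq_productIntegrand ν n (div_ne_zero hx hr.ne') (div_ne_zero hy hr.ne'),
      finiteOddIntegrand_eq_productIntegrand ν n (div_ne_zero hx hr.ne') (div_ne_zero hy hr.ne'),
      hdiv, habs, verticalIntegral_rectangleIntegral_productIntegrand]
    rw [← hsqc]
    push_cast
    field_simp
  · exact (hasSum_meijerKernel (splitIndex_zero ν (-1)) le_rfl hhalf hev0 hev (ρ := -5 / 8)
      (by norm_num) (by norm_num) hX hY).1
  · simp only [evenKernel, eqE]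
    exact kernel_eq_meijerKernel (splitIndex_zero ν (-1)) le_rfl hhalf hev0 hev hX hY hev1 hc' hc
      hca ha hη _
  · exact (hasSum_meijerKernel (splitIndex_zero ν 1) hhalf le_rfl hod0 hod (ρ := -1 / 8)
      (by norm_num) (by norm_num) hX hY).1
  · simp only [oddKernel, eqO]
    have := kernel_eq_meijerKernel (splitIndex_zero ν 1) hhalf le_rfl hod0 hod hX hY hod1 hc' hc
      hca ha hη (|x| / 2 ^ (2 * M))
    rw [div_eq_mul_one_div, mul_assoc, this]
    push_cast
    ring
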